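/- Let $G$ be a simple simply-connected complex algebraic group with maximal torus $T$, Borel subgroup $B_G\supset T$ and unipotent radical $N\subset B_G$; let $\mathfrak g,\mathfrak t,\mathfrak n$ be the Lie algebras of $G,T,N$. Let $\alpha_i$ and $h_i=\alpha_i^\vee$ ($i\in I$) be the simple roots and coroots, $P$ the weight lattice, and let $e_i,f_i\in\mathfrak g$ be root vectors of weights $\alpha_i,-\alpha_i$ with $[e_i,f_i]=h_i$. Put $U^+=U(\mathfrak n)\subset U(\mathfrak g)$. For $n\in N$, $F\in\mathbb C[N]$ put $n\cdot F=F(?\,n)$ and $F\cdot n=F(n\,?)$; these actions differentiate to actions of $U(\mathfrak n)$, and we set $\langle F,a\rangle=\langle a,F\rangle=(a\cdot F)(1_N)$ for $a\in U(\mathfrak n)$. Let $T_i$ be the automorphism of $U(\mathfrak g)$ extending $\mathrm{Ad}_{\overline s_i}$, where $\overline s_i=\exp(-e_i)\exp(f_i)\exp(-e_i)$. A crystal on a set $B\not\ni 0$ consists of maps $\mathrm{wt}:B\to P$, $\varepsilon_i,\varphi_i:B\to\mathbb Z\cup\{-\infty\}$, $\tilde e_i,\tilde f_i:B\to B\cup\{0\}$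 ($i\in I$) with $\varphi_i(b)=\langle h_i,\mathrm{wt}(b)\rangle+\varepsilon_i(b)$; $b=\tilde e_ib'\Leftrightarrow\tilde f_ib=b'$; if $\tilde e_ib\ne0$ then $\mathrm{wt}(\tilde e_ib)=\mathrm{wt}(b)+\alpha_i$, $\varepsilon_i(\tilde e_ib)=\varepsilon_i(b)-1$, $\varphi_i(\tilde e_ib)=\varphi_i(b)+1$; and $\tilde e_ib=\tilde f_ib=0$ if $\varphi_i(b)=\varepsilon_i(b)=-\infty$. It is upper semi-normal if for all $b$ and $i$ one has $\tilde e_i^nb=0$ for some $n$, and $\varepsilon_i(b)=\max\{n\ge0\mid\tilde e_i^nb\ne0\}$. A biperfect basis of $\mathbb C[N]$ is a linear basis $B$ containing the constant function $1$, with two upper semi-normal crystal structures $(\mathrm{wt},\varepsilon_i,\varphi_i,\tilde e_i,\tilde f_i)$ and $(\mathrm{wt},\varepsilon_i^*,\varphi_i^*,\tilde e_i^*,\tilde f_i^*)$ having the same weight map, such that each $b\in B$ is homogeneous of degree $\mathrm{wt}(b)$ for the action $(t\cdot F)(n)=F(t^{-1}nt)$ of $T$, and such that for all $i\in I$, $b\in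 B$, $$e_i\cdot b\in\varepsilon_i(b)\,\tilde e_ib+\mathrm{span}\{b'\in B\mid\varepsilon_i(b')<\varepsilon_i(b)-1\},\qquad b\cdot e_i\in\varepsilon_i^*(b)\,\tilde e_i^*b+\mathrm{span}\{b'\in B\mid\varepsilon_i^*(b')<\varepsilon_i^*(b)-1\}.$$ **Theorem.** Let $B$ be a biperfect basis of $\mathbb C[N]$, let $i\in I$, and let $b\in B$ with $\varepsilon_i^*(b)=0$. Then the Saito reflection $\sigma_i(b)=(\tilde f_i^*)^{\varphi_i(b)}(\tilde e_i)^{\varepsilon_i(b)}b$ is a well-defined element of $B$ (in particular $\varphi_i(b)\ge0$ and the result is not $0$), and $$\langle\sigma_i(b),u\rangle=\langle b,T_i(u)\rangle\qquad\text{for all }u\in U^+\cap T_i^{-1}(U^+).$$ Moreover $\langle\sigma_i(b),ue_i\rangle=0$ for all $u\in U^+$, and $\sigma_i(b)$ is the only element $F\in\mathbb C[N]$ such that $\langle F,u\rangle=\langle b,T_i(u)\rangle$ for all $u\in U^+\cap T_i^{-1}(U^+)$ and $\langle F,ue_i\rangle=0$ for all $u\in U^+$. -/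

import Mathlib

open LieAlgebra LieAlgebra.IsKilling

attribute [local instance 100] LieRing.ofAssociativeRing

noncomputable section

namespace Biperfect

/-! ### Lie-theoretic data -/

section LieData

variable {L : Type*} [LieRing L] [LieAlgebra ℂ L] [FiniteDimensional ℂ L] [LieAlgebra.IsSimple ℂ L]
variable {H : LieSubalgebra ℂ L} [H.IsCartanSubalgebra]

/-- The simple root `α_i`. -/
abbrev simpleRoot (Δ : (rootSystem H).Base) (i : Δ.support) : Module.Dual ℂ H :=
  (rootSystem H).root (i : H.root)

/-- The simple coroot `h_i = α_i^∨`, as an element of the Cartan subalgebra. -/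
abbrev simpleCoroot (Δ : (rootSystem H).Base) (i : Δ.support) : H :=
  (rootSystem H).coroot (i : H.root)

/-- The nilpotent Lie algebra `𝔫` spanned by the root spaces of the positive roots. -/
def nPlus (Δ : (rootSystem H).Base) : LieSubalgebra ℂ L :=
  LieSubalgebra.lieSpan ℂ L
    {x | ∃ α : H.root, Δ.IsPos α ∧ x ∈ LieAlgebra.rootSpace H (α : LieModule.Weight ℂ H L)}

/-- Root vectors `e_i` and `f_i` of weights `α_i` and `-α_i` with `[e_i, f_i] = h_i`. -/
structure RootVectors (Δ : (rootSystem H).Base) where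
  e : Δ.support → L
  f : Δ.support → L
  e_mem : ∀ i, e i ∈ LieAlgebra.rootSpace H (simpleRoot Δ i)
  f_mem : ∀ i, f i ∈ LieAlgebra.rootSpace H (-(simpleRoot Δ i) : Module.Dual ℂ H)
  lie_e_f : ∀ i, ⁅e i, f i⁆ = (simpleCoroot Δ i : L)

variable {Δ : (rootSystem H).Base}

theorem RootVectors.e_mem_nPlus (R : RootVectors Δ) (i : Δ.support) : R.e i ∈ nPlus Δ :=
  LieSubalgebra.subset_lieSpan ⟨i, RootPairing.Base.isPos_of_mem_support i.2, R.e_mem i⟩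

/-- `e_i` as an element of `𝔫`. -/
def RootVectors.eN (R : RootVectors Δ) (i : Δ.support) : nPlus Δ := ⟨R.e i, R.e_mem_nPlus i⟩

theorem simpleRoot_ne_zero (Δ : (rootSystem H).Base) (i : Δ.support) :
    simpleRoot Δ i ≠ 0 := (rootSystem H).ne_zero _

theorem RootVectors.isNilpotent_ad_e (R : RootVectors Δ) (i : Δ.support) :
    IsNilpotent (LieAlgebra.ad ℂ L (R.e i)) := by
  refine LieAlgebra.isNilpotent_ad_of_mem_rootSpace H ?_ (R.e_mem i)
  intro h
  exact simpleRoot_ne_zero Δ i (DFunLike.coe_injective h)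

theorem RootVectors.isNilpotent_ad_f (R : RootVectors Δ) (i : Δ.support) :
    IsNilpotent (LieAlgebra.ad ℂ L (R.f i)) := by
  refine LieAlgebra.isNilpotent_ad_of_mem_rootSpace H ?_ (R.f_mem i)
  intro h
  exact neg_ne_zero.mpr (simpleRoot_ne_zero Δ i) (DFunLike.coe_injective h)

/-- The Lie algebra automorphism `exp (ad x) = ∑ (ad x)^k / k!` for an ad-nilpotent `x`. -/
def expAd (x : L) (hx : IsNilpotent (LieAlgebra.ad ℂ L x)) : L ≃ₗ⁅ℂ⁆ L :=
  letI : Module ℚ L := Module.compHom L (algebraMap ℚ ℂ)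
  letI : LieAlgebra ℚ L :=
    { lie_smul := fun t x y => lie_smul (algebraMap ℚ ℂ t) x y }
  LieDerivation.exp (LieDerivation.ad ℂ L x) (by
    have h : (LieDerivation.ad ℂ L x).toLinearMap = LieAlgebra.ad ℂ L x := by
      ext y; simp
    rw [h]; exact hx)

/-- `Ad_{s̄_i}` on `𝔤`, where `s̄_i = exp(-e_i) exp(f_i) exp(-e_i)`. -/
def RootVectors.adSBar (R : RootVectors Δ) (i : Δ.support) : L ≃ₗ⁅ℂ⁆ L :=
  have he : IsNilpotent (LieAlgebra.ad ℂ L (-R.e i)) := by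
    rw [map_neg]; exact (R.isNilpotent_ad_e i).neg
  ((expAd (-R.e i) he).trans (expAd (R.f i) (R.isNilpotent_ad_f i))).trans (expAd (-R.e i) he)

/-- `T_i`, the extension of `Ad_{s̄_i}` to the enveloping algebra `U(𝔤)`. -/
def RootVectors.T (R : RootVectors Δ) (i : Δ.support) :
    UniversalEnvelopingAlgebra ℂ L →ₐ[ℂ] UniversalEnvelopingAlgebra ℂ L :=
  UniversalEnvelopingAlgebra.lift ℂ
    ((UniversalEnvelopingAlgebra.ι ℂ).comp (R.adSBar i : L →ₗ⁅ℂ⁆ L))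

/-- The inclusion `U(𝔫) → U(𝔤)`, whose image is `U⁺`. -/
def inclU (Δ : (rootSystem H).Base) :
    UniversalEnvelopingAlgebra ℂ (nPlus Δ) →ₐ[ℂ] UniversalEnvelopingAlgebra ℂ L :=
  UniversalEnvelopingAlgebra.lift ℂ ((UniversalEnvelopingAlgebra.ι ℂ).comp (nPlus Δ).incl)

/-- The weight lattice `P`. -/
def weightLattice (Δ : (rootSystem H).Base) : AddSubgroup (Module.Dual ℂ H) where
  carrier := {μ | ∀ i : Δ.support, ∃ k : ℤ, μ (simpleCoroot Δ i) = k}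
  zero_mem' := fun _ => ⟨0, by simp⟩
  add_mem' := by
    intro a b ha hb i
    obtain ⟨k, hk⟩ := ha i
    obtain ⟨l, hl⟩ := hb i
    exact ⟨k + l, by rw [LinearMap.add_apply, hk, hl, Int.cast_add]⟩
  neg_mem' := by
    intro a ha i
    obtain ⟨k, hk⟩ := ha i
    exact ⟨-k, by rw [LinearMap.neg_apply, hk, Int.cast_neg]⟩

/-- The simple root `α_i` as an element of `P`. -/
def simpleRootP (Δ : (rootSystem H).Base) (i : Δ.support) : weightLattice Δ :=
  ⟨simpleRoot Δ i, fun j => by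
    obtain ⟨k, hk⟩ := (rootSystem H).exists_value (S := ℤ) (i : H.root) (j : H.root)
    exact ⟨k, by simpa using hk.symm⟩⟩

/-- `⟨h_i, ·⟩ : P → ℤ`. -/
def corootP (Δ : (rootSystem H).Base) (i : Δ.support) : weightLattice Δ →+ ℤ where
  toFun μ := (μ.2 i).choose
  map_zero' := by
    have h := ((0 : weightLattice Δ).2 i).choose_spec
    have h0 : ((0 : weightLattice Δ) : Module.Dual ℂ H) (simpleCoroot Δ i) = 0 := rfl
    exact (Int.cast_eq_zero (α := ℂ)).1 (h.symm.trans h0)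
  map_add' := by
    intro μ ν
    have h := ((μ + ν).2 i).choose_spec
    have h1 := (μ.2 i).choose_spec
    have h2 := (ν.2 i).choose_spec
    have h3 : ((μ + ν : weightLattice Δ) : Module.Dual ℂ H) (simpleCoroot Δ i)
      = (μ : Module.Dual ℂ H) (simpleCoroot Δ i) + (ν : Module.Dual ℂ H) (simpleCoroot Δ i) := rfl
    rw [h, h1, h2] at h3
    exact_mod_cast h3

theorem corootP_spec (Δ : (rootSystem H).Base) (i : Δ.support) (μ : weightLattice Δ) :
    (μ : Module.Dual ℂ H) (simpleCoroot Δ i) = (corootP Δ i μ : ℂ) :=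
  (μ.2 i).choose_spec

end LieData

/-! ### The unipotent group `N` and its coordinate ring

`𝔤` is realized inside `𝔤𝔩_d` by a faithful representation `ρ` (for instance, the differential of a
closed embedding of the algebraic group `G` in `GL_d`). -/

section UnipotentGroup

variable {L : Type*} [LieRing L] [LieAlgebra ℂ L] {d : ℕ}

/-- `exp (ρ x)` as an element of `GL_d(ℂ)`. -/
def expGL (ρ : L →ₗ⁅ℂ⁆ Matrix (Fin d) (Fin d) ℂ) (x : L) : GL (Fin d) ℂ :=
  (Matrix.isUnit_exp (ρ x)).unit

theorem coe_expGL (ρ : L →ₗ⁅ℂ⁆ Matrix (Fin d) (Fin d) ℂ) (x : L) :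
    (expGL ρ x : Matrix (Fin d) (Fin d) ℂ) = NormedSpace.exp (ρ x) := rfl

/-- The subgroup of `GL_d(ℂ)` generated by `exp (ρ x)`, `x ∈ 𝔫`. For `𝔫` the span of the positive
root spaces, this is the unipotent radical `N` of the Borel subgroup. -/
def unipotentGroup (ρ : L →ₗ⁅ℂ⁆ Matrix (Fin d) (Fin d) ℂ) (𝔫 : LieSubalgebra ℂ L) :
    Subgroup (GL (Fin d) ℂ) :=
  Subgroup.closure (expGL ρ '' (𝔫 : Set L))

variable {ρ : L →ₗ⁅ℂ⁆ Matrix (Fin d) (Fin d) ℂ} {𝔫 : LieSubalgebra ℂ L}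

/-- `exp x ∈ N` for `x ∈ 𝔫`. -/
def expN (ρ : L →ₗ⁅ℂ⁆ Matrix (Fin d) (Fin d) ℂ) {𝔫 : LieSubalgebra ℂ L} (x : 𝔫) :
    unipotentGroup ρ 𝔫 :=
  ⟨expGL ρ x, Subgroup.subset_closure ⟨x, x.2, rfl⟩⟩

/-- The matrix of an element of `N`. -/
abbrev toMat (n : unipotentGroup ρ 𝔫) : Matrix (Fin d) (Fin d) ℂ := ((n : GL (Fin d) ℂ) : Matrix _ _ ℂ)

/-- The `(p, q)` matrix entry, as a function on `N`. -/
def entry (ρ : L →ₗ⁅ℂ⁆ Matrix (Fin d) (Fin d) ℂ) (𝔫 : LieSubalgebra ℂ L) (p q : Fin d) :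
    unipotentGroup ρ 𝔫 → ℂ := fun n => toMat n p q

/-- The coordinate ring `ℂ[N]`: restrictions to `N` of the polynomials in the matrix entries. -/
def coordRing (ρ : L →ₗ⁅ℂ⁆ Matrix (Fin d) (Fin d) ℂ) (𝔫 : LieSubalgebra ℂ L) :
    Subalgebra ℂ (unipotentGroup ρ 𝔫 → ℂ) :=
  Algebra.adjoin ℂ {F | ∃ p q : Fin d, F = entry ρ 𝔫 p q}

/-- `(x · F)(m) = d/dt F(m exp(tx))` at `t = 0`: the infinitesimal form of `n · F = F(? n)`. -/
def leftDer (x : 𝔫) (F : unipotentGroup ρ 𝔫 → ℂ) (m : unipotentGroup ρ 𝔫) : ℂ :=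
  deriv (fun t : ℂ => F (m * expN ρ (t • x))) 0

/-- `(F · x)(m) = d/dt F(exp(tx) m)` at `t = 0`: the infinitesimal form of `F · n = F(n ?)`. -/
def rightDer (x : 𝔫) (F : unipotentGroup ρ 𝔫 → ℂ) (m : unipotentGroup ρ 𝔫) : ℂ :=
  deriv (fun t : ℂ => F (expN ρ (t • x) * m)) 0

theorem toMat_mul (m n : unipotentGroup ρ 𝔫) : toMat (m * n) = toMat m * toMat n := rfl

theorem expN_zero_smul (x : 𝔫) : expN ρ ((0 : ℂ) • x) = 1 := by
  apply Subtype.ext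
  apply Units.ext
  change NormedSpace.exp (ρ (((0 : ℂ) • x : 𝔫) : L)) = 1
  simp

theorem hasDerivAt_exp_entry (A : Matrix (Fin d) (Fin d) ℂ) (k q : Fin d) :
    HasDerivAt (fun t : ℂ => NormedSpace.exp (t • A) k q) (A k q) 0 := by
  let _ : NormedRing (Matrix (Fin d) (Fin d) ℂ) := Matrix.linftyOpNormedRing
  let _ : NormedAlgebra ℂ (Matrix (Fin d) (Fin d) ℂ) := Matrix.linftyOpNormedAlgebra
  have h := hasDerivAt_exp_smul_const (𝕂 := ℂ) A 0
  simp only [zero_smul, NormedSpace.exp_zero, one_mul] at h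
  have h1 := hasDerivAt_pi.1 h k
  exact hasDerivAt_pi.1 h1 q

theorem expGL_entry (m : unipotentGroup ρ 𝔫) (x : 𝔫) (p q : Fin d) (t : ℂ) :
    entry ρ 𝔫 p q (m * expN ρ (t • x)) =
      ∑ k, toMat m p k * NormedSpace.exp (t • ρ (x : L)) k q := by
  change (toMat m * NormedSpace.exp (ρ ((t • x : 𝔫) : L))) p q = _
  rw [Matrix.mul_apply]
  simp

theorem expGL_entry' (m : unipotentGroup ρ 𝔫) (x : 𝔫) (p q : Fin d) (t : ℂ) :
    entry ρ 𝔫 p q (expN ρ (t • x) * m) =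
      ∑ k, NormedSpace.exp (t • ρ (x : L)) p k * toMat m k q := by
  change (NormedSpace.exp (ρ ((t • x : 𝔫) : L)) * toMat m) p q = _
  rw [Matrix.mul_apply]
  simp

theorem hasDerivAt_entry (m : unipotentGroup ρ 𝔫) (x : 𝔫) (p q : Fin d) :
    HasDerivAt (fun t : ℂ => entry ρ 𝔫 p q (m * expN ρ (t • x)))
      ((∑ k, ρ (x : L) k q • entry ρ 𝔫 p k) m) 0 := by
  simp only [expGL_entry]
  have h := HasDerivAt.fun_sum (u := Finset.univ) fun k _ =>
    (hasDerivAt_exp_entry (ρ (x : L)) k q).const_mul (toMat m p k)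
  convert! h using 1
  simp [entry, mul_comm]

theorem hasDerivAt_entry' (m : unipotentGroup ρ 𝔫) (x : 𝔫) (p q : Fin d) :
    HasDerivAt (fun t : ℂ => entry ρ 𝔫 p q (expN ρ (t • x) * m))
      ((∑ k, ρ (x : L) p k • entry ρ 𝔫 k q) m) 0 := by
  simp only [expGL_entry']
  have h := HasDerivAt.fun_sum (u := Finset.univ) fun k _ =>
    (hasDerivAt_exp_entry (ρ (x : L)) p k).mul_const (toMat m k q)
  convert! h using 1
  simp [entry]

theorem entry_mem (p q : Fin d) : entry ρ 𝔫 p q ∈ coordRing ρ 𝔫 :=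
  Algebra.subset_adjoin ⟨p, q, rfl⟩

theorem leftDer_spec (x : 𝔫) {F : unipotentGroup ρ 𝔫 → ℂ} (hF : F ∈ coordRing ρ 𝔫) :
    (∀ m, HasDerivAt (fun t : ℂ => F (m * expN ρ (t • x))) (leftDer x F m) 0) ∧
      leftDer x F ∈ coordRing ρ 𝔫 := by
  suffices h : ∃ G ∈ coordRing ρ 𝔫,
      ∀ m, HasDerivAt (fun t : ℂ => F (m * expN ρ (t • x))) (G m) 0 by
    obtain ⟨G, hG, h⟩ := h
    have hG' : leftDer x F = G := funext fun m => (h m).deriv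
    rw [hG']
    exact ⟨h, hG⟩
  induction hF using Algebra.adjoin_induction with
  | mem F hF =>
    obtain ⟨p, q, rfl⟩ := hF
    exact ⟨_, Subalgebra.sum_mem _ fun k _ => Subalgebra.smul_mem _ (entry_mem p k) _,
      fun m => hasDerivAt_entry m x p q⟩
  | algebraMap r => exact ⟨0, Subalgebra.zero_mem _, fun m => hasDerivAt_const (0 : ℂ) r⟩
  | add F G _ _ hF hG =>
    obtain ⟨F', hF', hF⟩ := hF
    obtain ⟨G', hG', hG⟩ := hG
    exact ⟨F' + G', Subalgebra.add_mem _ hF' hG', fun m => (hF m).add (hG m)⟩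
  | mul F G hFm hGm hF hG =>
    obtain ⟨F', hF', hF⟩ := hF
    obtain ⟨G', hG', hG⟩ := hG
    refine ⟨F' * G + F * G', Subalgebra.add_mem _ (Subalgebra.mul_mem _ hF' hGm)
      (Subalgebra.mul_mem _ hFm hG'), fun m => ?_⟩
    have h := (hF m).mul (hG m)
    simp only [expN_zero_smul, mul_one] at h
    exact h

theorem rightDer_spec (x : 𝔫) {F : unipotentGroup ρ 𝔫 → ℂ} (hF : F ∈ coordRing ρ 𝔫) :
    (∀ m, HasDerivAt (fun t : ℂ => F (expN ρ (t • x) * m)) (rightDer x F m) 0) ∧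
      rightDer x F ∈ coordRing ρ 𝔫 := by
  suffices h : ∃ G ∈ coordRing ρ 𝔫,
      ∀ m, HasDerivAt (fun t : ℂ => F (expN ρ (t • x) * m)) (G m) 0 by
    obtain ⟨G, hG, h⟩ := h
    have hG' : rightDer x F = G := funext fun m => (h m).deriv
    rw [hG']
    exact ⟨h, hG⟩
  induction hF using Algebra.adjoin_induction with
  | mem F hF =>
    obtain ⟨p, q, rfl⟩ := hF
    exact ⟨_, Subalgebra.sum_mem _ fun k _ => Subalgebra.smul_mem _ (entry_mem k q) _,
      fun m => hasDerivAt_entry' m x p q⟩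
  | algebraMap r => exact ⟨0, Subalgebra.zero_mem _, fun m => hasDerivAt_const (0 : ℂ) r⟩
  | add F G _ _ hF hG =>
    obtain ⟨F', hF', hF⟩ := hF
    obtain ⟨G', hG', hG⟩ := hG
    exact ⟨F' + G', Subalgebra.add_mem _ hF' hG', fun m => (hF m).add (hG m)⟩
  | mul F G hFm hGm hF hG =>
    obtain ⟨F', hF', hF⟩ := hF
    obtain ⟨G', hG', hG⟩ := hG
    refine ⟨F' * G + F * G', Subalgebra.add_mem _ (Subalgebra.mul_mem _ hF' hGm)
      (Subalgebra.mul_mem _ hFm hG'), fun m => ?_⟩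
    have h := (hF m).mul (hG m)
    simp only [expN_zero_smul, one_mul] at h
    exact h

theorem leftDer_entry (x : 𝔫) (p q : Fin d) :
    leftDer x (entry ρ 𝔫 p q) = ∑ k, ρ (x : L) k q • entry ρ 𝔫 p k :=
  funext fun m => (hasDerivAt_entry m x p q).deriv

/-- The left action of `x ∈ 𝔫` on `ℂ[N]`, as a derivation. -/
def leftDerivation (ρ : L →ₗ⁅ℂ⁆ Matrix (Fin d) (Fin d) ℂ) {𝔫 : LieSubalgebra ℂ L} (x : 𝔫) : Derivation ℂ (coordRing ρ 𝔫) (coordRing ρ 𝔫) :=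
  Derivation.mk'
    { toFun := fun F => ⟨leftDer x F, (leftDer_spec x F.2).2⟩
      map_add' := fun F G => Subtype.ext <| funext fun m =>
        (((leftDer_spec x F.2).1 m).add ((leftDer_spec x G.2).1 m)).deriv
      map_smul' := fun c F => Subtype.ext <| funext fun m =>
        (((leftDer_spec x F.2).1 m).const_mul c).deriv }
    (fun F G => Subtype.ext <| funext fun m => by
      have h := ((leftDer_spec x F.2).1 m).mul ((leftDer_spec x G.2).1 m)
      simp only [expN_zero_smul, mul_one] at h
      refine h.deriv.trans ?_
      change _ = (F : unipotentGroup ρ 𝔫 → ℂ) m * leftDer x G m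
        + (G : unipotentGroup ρ 𝔫 → ℂ) m * leftDer x F m
      ring)

theorem coe_leftDerivation (x : 𝔫) (F : coordRing ρ 𝔫) :
    (leftDerivation ρ x F : unipotentGroup ρ 𝔫 → ℂ) = leftDer x F := rfl

theorem leftDerivation_ext {D₁ D₂ : Derivation ℂ (coordRing ρ 𝔫) (coordRing ρ 𝔫)}
    (h : ∀ p q, D₁ ⟨entry ρ 𝔫 p q, entry_mem p q⟩ = D₂ ⟨entry ρ 𝔫 p q, entry_mem p q⟩) :
    D₁ = D₂ := by
  refine Derivation.ext_of_adjoin_eq_top _ (Algebra.adjoin_adjoin_coe_preimage (R := ℂ)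
    (s := {F | ∃ p q : Fin d, F = entry ρ 𝔫 p q})) ?_
  rintro ⟨F, hF⟩ ⟨p, q, hpq⟩
  obtain rfl : F = entry ρ 𝔫 p q := hpq
  exact h p q

theorem leftDerivation_entry (x : 𝔫) (p q : Fin d) :
    leftDerivation ρ x (⟨entry ρ 𝔫 p q, entry_mem p q⟩ : coordRing ρ 𝔫) =
      ∑ k, ρ (x : L) k q • (⟨entry ρ 𝔫 p k, entry_mem p k⟩ : coordRing ρ 𝔫) := by
  apply Subtype.ext
  rw [coe_leftDerivation, leftDer_entry]
  simp

theorem commutator_formula {V : Type*} [AddCommGroup V] [Module ℂ V] (D₁ D₂ : V →ₗ[ℂ] V)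
    (X Y : Matrix (Fin d) (Fin d) ℂ) (E : Fin d → Fin d → V)
    (h₁ : ∀ p q, D₁ (E p q) = ∑ k, X k q • E p k) (h₂ : ∀ p q, D₂ (E p q) = ∑ k, Y k q • E p k)
    (p q : Fin d) :
    D₁ (D₂ (E p q)) - D₂ (D₁ (E p q)) = ∑ k, (X * Y - Y * X) k q • E p k := by
  simp only [h₁, h₂, map_sum, map_smul, Finset.smul_sum, smul_smul, Matrix.sub_apply,
    Matrix.mul_apply, sub_smul, Finset.sum_smul, Finset.sum_sub_distrib]
  congr 1
  · rw [Finset.sum_comm]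
    simp only [mul_comm]
  · rw [Finset.sum_comm]
    simp only [mul_comm]

theorem leftDerivation_add (x y : 𝔫) :
    (leftDerivation ρ (x + y)) =
      leftDerivation ρ x + leftDerivation ρ y := by
  apply leftDerivation_ext
  intro p q
  rw [Derivation.add_apply, leftDerivation_entry, leftDerivation_entry, leftDerivation_entry,
    ← Finset.sum_add_distrib]
  refine Finset.sum_congr rfl fun k _ => ?_
  rw [← add_smul, ← Matrix.add_apply, ← map_add]; rfl

theorem leftDerivation_smul (c : ℂ) (x : 𝔫) :
    (leftDerivation ρ (c • x)) =
      c • leftDerivation ρ x := by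
  apply leftDerivation_ext
  intro p q
  rw [Derivation.smul_apply, leftDerivation_entry, leftDerivation_entry, Finset.smul_sum]
  refine Finset.sum_congr rfl fun k _ => ?_
  have h : ρ ((c • x : 𝔫) : L) = c • ρ (x : L) := map_smul ρ c (x : L)
  rw [h, Matrix.smul_apply, smul_assoc]

theorem leftDerivation_lie (x y : 𝔫) :
    (leftDerivation ρ ⁅x, y⁆) =
      ⁅leftDerivation ρ x, leftDerivation ρ y⁆ := by
  apply leftDerivation_ext
  intro p q
  rw [Derivation.commutator_apply, leftDerivation_entry, LieSubalgebra.coe_bracket,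
    LieHom.map_lie, LieRing.of_associative_ring_bracket]
  exact (commutator_formula (leftDerivation ρ x).toLinearMap
    (leftDerivation ρ y).toLinearMap (ρ (x : L)) (ρ (y : L))
    (fun p q => ⟨entry ρ 𝔫 p q, entry_mem p q⟩) (leftDerivation_entry x)
    (leftDerivation_entry y) p q).symm

/-- The left action of `𝔫` on `ℂ[N]`. -/
def leftAction (ρ : L →ₗ⁅ℂ⁆ Matrix (Fin d) (Fin d) ℂ) (𝔫 : LieSubalgebra ℂ L) :
    𝔫 →ₗ⁅ℂ⁆ Module.End ℂ (coordRing ρ 𝔫) where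
  toFun x := (leftDerivation ρ x).toLinearMap
  map_add' x y := by rw [leftDerivation_add]; rfl
  map_smul' c x := by rw [leftDerivation_smul]; rfl
  map_lie' {x y} := by rw [leftDerivation_lie]; rfl

/-- The right action of `x ∈ 𝔫` on `ℂ[N]`. -/
def rightAction (ρ : L →ₗ⁅ℂ⁆ Matrix (Fin d) (Fin d) ℂ) {𝔫 : LieSubalgebra ℂ L} (x : 𝔫) :
    Module.End ℂ (coordRing ρ 𝔫) where
  toFun F := ⟨rightDer x F, (rightDer_spec x F.2).2⟩
  map_add' F G := Subtype.ext <| funext fun m =>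
    (((rightDer_spec x F.2).1 m).add ((rightDer_spec x G.2).1 m)).deriv
  map_smul' c F := Subtype.ext <| funext fun m =>
    (((rightDer_spec x F.2).1 m).const_mul c).deriv

/-- The pairing `⟨a, F⟩ = (a · F)(1)` between `U(𝔫)` and `ℂ[N]`. -/
def pairing (F : coordRing ρ 𝔫) (a : UniversalEnvelopingAlgebra ℂ 𝔫) : ℂ :=
  (UniversalEnvelopingAlgebra.lift ℂ (leftAction ρ 𝔫) a F : unipotentGroup ρ 𝔫 → ℂ) 1

/-- `F ∈ ℂ[N]` is homogeneous of degree `μ` for the action `(t · F)(n) = F(t⁻¹ n t)` of the torus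
`T = {exp h : h ∈ 𝔱}`: one has `t · F = t^μ F`, where `t^μ = e^{μ(h)}` for `t = exp h`. -/
def IsHomogeneous {H : LieSubalgebra ℂ L} (μ : Module.Dual ℂ H) (F : coordRing ρ 𝔫) : Prop :=
  ∀ (h : H) (m n : unipotentGroup ρ 𝔫),
    (m : GL (Fin d) ℂ) = (expGL ρ (h : L))⁻¹ * n * expGL ρ (h : L) →
      (F : unipotentGroup ρ 𝔫 → ℂ) m = Complex.exp (μ h) * (F : unipotentGroup ρ 𝔫 → ℂ) n

end UnipotentGroup

/-! ### Crystals and biperfect bases -/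

section Crystals

/-- A crystal on a set `B`, for a lattice `P` with elements `α_i ∈ P` and forms `⟨h_i, ·⟩ : P → ℤ`.
`ℤ ∪ {-∞}` is `WithBot ℤ` and `B ∪ {0}` is `Option B`, with `0 = none`. -/
structure Crystal {I P : Type*} [AddCommGroup P] (α : I → P) (h : I → P →+ ℤ) (B : Type*) where
  wt : B → P
  ε : I → B → WithBot ℤ
  φ : I → B → WithBot ℤ
  e : I → B → Option B
  f : I → B → Option B
  φ_eq : ∀ i b, φ i b = ((h i (wt b) : ℤ) : WithBot ℤ) + ε i b
  e_eq_iff : ∀ i b b', e i b' = some b ↔ f i b = some b'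
  wt_e : ∀ i b b', e i b = some b' → wt b' = wt b + α i
  ε_e : ∀ i b b', e i b = some b' → ε i b = ε i b' + 1
  φ_e : ∀ i b b', e i b = some b' → φ i b' = φ i b + 1
  eq_none : ∀ i b, φ i b = ⊥ → ε i b = ⊥ → e i b = none ∧ f i b = none

/-- The `n`-th iterate of a map `B → B ∪ {0}`, with `0 ↦ 0`. -/
def opPow {B : Type*} (g : B → Option B) : ℕ → B → Option B
  | 0, b => some b
  | n + 1, b => (g b).bind (opPow g n)

/-- `ε_i(b) = max {n | ẽ_i^n b ≠ 0}`, this set being bounded. -/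
def Crystal.IsUpperSemiNormal {I P : Type*} [AddCommGroup P] {α : I → P} {h : I → P →+ ℤ}
    {B : Type*} (C : Crystal α h B) : Prop :=
  ∀ i b, (∃ n, opPow (C.e i) n b = none) ∧
    ∃ n : ℕ, C.ε i b = ((n : ℤ) : WithBot ℤ) ∧ IsGreatest {n | opPow (C.e i) n b ≠ none} n

/-- Compatibility of a linear basis `v` of `V` carrying a crystal structure with operators `E i`
(the action of `e_i`): the expansion of `E i (v b)` is `ε_i(b) ẽ_i b` plus a combination of the `b'`
with `ε_i(b') < ε_i(b) - 1`. -/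
def Crystal.IsCompatible {I P : Type*} [AddCommGroup P] {α : I → P} {h : I → P →+ ℤ}
    {B V : Type*} [AddCommGroup V] [Module ℂ V] (C : Crystal α h B) (v : Module.Basis B ℂ V)
    (E : I → Module.End ℂ V) : Prop :=
  ∀ (i : I) (b : B) (n : ℤ), C.ε i b = (n : WithBot ℤ) →
    E i (v b) - (n : ℂ) • ((C.e i b).elim 0 v) ∈
      Submodule.span ℂ (v '' {b' | C.ε i b' < ((n - 1 : ℤ) : WithBot ℤ)})

end Crystals

section BiperfectBasis

variable {L : Type*} [LieRing L] [LieAlgebra ℂ L] [FiniteDimensional ℂ L] [LieAlgebra.IsSimple ℂ L]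
variable {H : LieSubalgebra ℂ L} [H.IsCartanSubalgebra] {Δ : (rootSystem H).Base} {d : ℕ}

/-- A biperfect basis of `ℂ[N]`, indexed by `B`, together with its bicrystal structure. -/
structure BiperfectBasis (R : RootVectors Δ) (ρ : L →ₗ⁅ℂ⁆ Matrix (Fin d) (Fin d) ℂ)
    (B : Type*) where
  /-- the underlying linear basis -/
  vec : Module.Basis B ℂ (coordRing ρ (nPlus Δ))
  /-- the crystal structure `(wt, ε_i, φ_i, ẽ_i, f̃_i)` -/
  crystal : Crystal (simpleRootP Δ) (corootP Δ) B
  /-- the crystal structure `(wt, ε_i^*, φ_i^*, ẽ_i^*, f̃_i^*)` -/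
  starCrystal : Crystal (simpleRootP Δ) (corootP Δ) B
  upperSemiNormal : crystal.IsUpperSemiNormal
  starUpperSemiNormal : starCrystal.IsUpperSemiNormal
  wt_eq : starCrystal.wt = crystal.wt
  one_mem : ∃ b, vec b = 1
  homogeneous : ∀ b, IsHomogeneous (crystal.wt b : Module.Dual ℂ H) (vec b)
  compatible : crystal.IsCompatible vec fun i => leftAction ρ (nPlus Δ) (R.eN i)
  starCompatible : starCrystal.IsCompatible vec fun i => rightAction ρ (R.eN i)

/-- `b' = σ_i(b) = (f̃_i^*)^{φ_i(b)} ẽ_i^{ε_i(b)} b`: the exponents are nonnegative integers and the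
result is the (nonzero) element `b'`. -/
def BiperfectBasis.IsSaitoReflection {R : RootVectors Δ}
    {ρ : L →ₗ⁅ℂ⁆ Matrix (Fin d) (Fin d) ℂ} {B : Type*} (S : BiperfectBasis R ρ B)
    (i : Δ.support) (b b' : B) : Prop :=
  ∃ n p : ℕ, S.crystal.ε i b = ((n : ℤ) : WithBot ℤ) ∧ S.crystal.φ i b = ((p : ℤ) : WithBot ℤ) ∧
    (opPow (S.crystal.e i) n b).bind (opPow (S.starCrystal.f i) p) = some b'

end BiperfectBasis

end Biperfect

end

/-! Write U_i (`nilU`) for the subalgebra of U(𝔤) generated by the root spaces of the positive roots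
other than α_i. The span of these root spaces (`nilSpan`) is stable under ad e_i, ad f_i and ad h_i,
so the triple acts on U_i by commutators and T_i preserves U_i.

Let n = ε_i(b). The hypothesis ε_i^*(b) = 0 means b · e_i = 0. As U(𝔫) = U_i + e_i U(𝔫), a function
killed by the right action of e_i is determined by its restriction to U_i, and on such restrictions
the left action of e_i is the contragredient action of ad e_i. With the local nilpotence of ad e_i
and ad f_i, 𝔰𝔩₂-theory gives p = ⟨h_i, wt b⟩ + n = φ_i(b) ≥ 0 (`weight_add_nonneg`) and the
vanishing of f_i^{p+1} on the form of b.

Let ζ be the coordinate function on N dual to e_i. In ∑_j (-1)^{p-j} (f_i^{(p-j)} b) ζ^j the powers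
of ζ span a copy of the simple module V(p), and the sum is a lowest weight vector of weight -n. Call
it X: then e_i^{n+1} · X = 0, while X · e_i^p = p! b (`exists_reflectionVector`).

In a perfect basis the kernel of the k-th power of e_i is spanned by the elements with ε_i < k, and
e_i^m sends an element with ε_i = m to m! times the end of its string. Hence X has in its support an
x with ε_i^*(x) = p, (ẽ_i^*)^p x = b and ε_i(x) ≤ n. The two actions commute, so e_i^n · x · e_i^p =
p! n! ẽ_i^n b ≠ 0. This forces ε_i(x) = n, and b' = ẽ_i^n x satisfies (ẽ_i^*)^p b' = ẽ_i^n b, that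
is b' = σ_i(b).

So b = x · e_i^{(p)} and b' = e_i^{(n)} · x come from the same x, of h_i-weight -(p + n). The forms
z ↦ (-1)^k ⟨x, e_i^{(j)} z e_i^{(k)}⟩ on U_i are the coefficients of a vector in the dual of U_i
tensored with V(p) ⊗ V(n). It has weight 0 and is killed by e, hence also by f (`coef_adL_f`).
Invariance under exp(-e) exp(f) exp(-e) gives ⟨x, e_i^{(p)} T_i(z)⟩ = ⟨x, z e_i^{(n)}⟩
(`apply_exp_exp_exp`, `apply_T`), which is the formula for u in U_i.

For general u = ∑ a_k e_i^k with a_k in U_i, T_i(u) = ∑ (-1)^k T_i(a_k) f_i^k lies in U⁺ only if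
T_i(a_k) = 0 for k ≥ 1 (`eq_zero_of_sum_mul_uF_pow_eq`). Then T_i(u) = T_i(a_0), and u - a_0 lies in
U⁺ e_i, on which b' vanishes. Uniqueness follows from U(𝔫) = U_i + U(𝔫) e_i and the nondegeneracy of
the pairing (`eq_zero_of_pairing_eq_zero`). -/

noncomputable section

namespace Biperfect

set_option linter.unusedSectionVars false

/-! ### Polynomials in the matrix entries, on which all of 𝔤 acts -/

section PolynomialRepresentation

open MvPolynomial

variable {L : Type*} [LieRing L] [LieAlgebra ℂ L] {d : ℕ}

local notation "𝒰" => UniversalEnvelopingAlgebra ℂ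

/-- The derivation `X_{a,q} ↦ ∑ k, ρ(x)_{k q} X_{a,k}` of the polynomial ring in the entries of a
matrix with rows indexed by `r`. -/
def polyDer (ρ : L →ₗ⁅ℂ⁆ Matrix (Fin d) (Fin d) ℂ) (r : Type*) (x : L) :
    Derivation ℂ (MvPolynomial (r × Fin d) ℂ) (MvPolynomial (r × Fin d) ℂ) :=
  mkDerivation ℂ fun aq => ∑ k, ρ x k aq.2 • X (aq.1, k)

theorem polyDer_X (ρ : L →ₗ⁅ℂ⁆ Matrix (Fin d) (Fin d) ℂ) {r : Type*} (x : L) (a : r) (q : Fin d) :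
    polyDer ρ r x (X (a, q)) = ∑ k, ρ x k q • (X (a, k) : MvPolynomial (r × Fin d) ℂ) :=
  mkDerivation_X _ _ _

/-- The action of `L` by derivations on the polynomial ring in the entries of a matrix, induced by
right multiplication by `ρ x`. -/
def polyRep (ρ : L →ₗ⁅ℂ⁆ Matrix (Fin d) (Fin d) ℂ) (r : Type*) :
    L →ₗ⁅ℂ⁆ Module.End ℂ (MvPolynomial (r × Fin d) ℂ) where
  toFun x := (polyDer ρ r x).toLinearMap
  map_add' x y := by
    have h : polyDer ρ r (x + y) = polyDer ρ r x + polyDer ρ r y := by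
      refine derivation_ext ?_
      rintro ⟨a, q⟩
      simp [polyDer_X, add_smul, Finset.sum_add_distrib]
    rw [h]; rfl
  map_smul' c x := by
    have h : polyDer ρ r (c • x) = c • polyDer ρ r x := by
      refine derivation_ext ?_
      rintro ⟨a, q⟩
      simp only [Derivation.smul_apply, polyDer_X, map_smul, Matrix.smul_apply, Finset.smul_sum,
        smul_assoc]
    rw [h]; rfl
  map_lie' {x y} := by
    have h : polyDer ρ r ⁅x, y⁆ = ⁅polyDer ρ r x, polyDer ρ r y⁆ := by
      refine derivation_ext ?_
      rintro ⟨a, q⟩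
      rw [Derivation.commutator_apply, polyDer_X, LieHom.map_lie,
        LieRing.of_associative_ring_bracket]
      exact (commutator_formula (polyDer ρ r x).toLinearMap (polyDer ρ r y).toLinearMap (ρ x) (ρ y)
        (fun _ k => X (a, k)) (fun _ q => polyDer_X ρ x a q) (fun _ q => polyDer_X ρ y a q)
        q q).symm
    rw [h]; rfl

theorem polyRep_apply (ρ : L →ₗ⁅ℂ⁆ Matrix (Fin d) (Fin d) ℂ) (r : Type*) (x : L)
    (P : MvPolynomial (r × Fin d) ℂ) : polyRep ρ r x P = polyDer ρ r x P := rfl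

/-- The derivation `X_{p,q} ↦ ∑ k, ρ(x)_{p k} X_{k,q}`. -/
def polyDerRight (ρ : L →ₗ⁅ℂ⁆ Matrix (Fin d) (Fin d) ℂ) (x : L) :
    Derivation ℂ (MvPolynomial (Fin d × Fin d) ℂ) (MvPolynomial (Fin d × Fin d) ℂ) :=
  mkDerivation ℂ fun pq => ∑ k, ρ x pq.1 k • X (k, pq.2)

theorem polyDerRight_X (ρ : L →ₗ⁅ℂ⁆ Matrix (Fin d) (Fin d) ℂ) (x : L) (p q : Fin d) :
    polyDerRight ρ x (X (p, q)) =
      ∑ k, ρ x p k • (X (k, q) : MvPolynomial (Fin d × Fin d) ℂ) :=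
  mkDerivation_X _ _ _

/-- The two derivations are the infinitesimal right and left multiplications of a matrix, which
commute. -/
theorem polyDer_polyDerRight_comm (ρ : L →ₗ⁅ℂ⁆ Matrix (Fin d) (Fin d) ℂ) (x y : L)
    (P : MvPolynomial (Fin d × Fin d) ℂ) :
    polyDer ρ (Fin d) x (polyDerRight ρ y P) = polyDerRight ρ y (polyDer ρ (Fin d) x P) := by
  have h : ⁅polyDer ρ (Fin d) x, polyDerRight ρ y⁆ = 0 := by
    refine derivation_ext ?_
    rintro ⟨p, q⟩
    rw [Derivation.commutator_apply, polyDerRight_X, polyDer_X]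
    simp only [map_sum, Derivation.map_smul, polyDerRight_X, polyDer_X, Finset.smul_sum,
      Derivation.zero_apply, smul_smul]
    rw [Finset.sum_comm, sub_eq_zero]
    simp only [mul_comm]
  have h' := congrArg (fun D => D P) h
  simp only [Derivation.commutator_apply, Derivation.zero_apply] at h'
  exact sub_eq_zero.1 h'

/-- Evaluation at the identity matrix. -/
def evOne (d : ℕ) : MvPolynomial (Fin d × Fin d) ℂ →ₐ[ℂ] ℂ :=
  aeval fun pq => (1 : Matrix (Fin d) (Fin d) ℂ) pq.1 pq.2

/-- Infinitesimal translations on the two sides agree at the identity matrix: both send the variable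
X_{p,q} to ρ(x)_{p,q}. -/
theorem evOne_polyDer (ρ : L →ₗ⁅ℂ⁆ Matrix (Fin d) (Fin d) ℂ) (x : L)
    (P : MvPolynomial (Fin d × Fin d) ℂ) :
    evOne d (polyDer ρ (Fin d) x P) = evOne d (polyDerRight ρ x P) := by
  induction P using MvPolynomial.induction_on with
  | C a => simp
  | add P Q hP hQ => simp only [map_add, hP, hQ]
  | mul_X P pq hP =>
    obtain ⟨p, q⟩ := pq
    have h1 : evOne d (polyDer ρ (Fin d) x (X (p, q))) = ρ x p q := by
      rw [polyDer_X]; simp [evOne, Matrix.one_apply]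
    have h2 : evOne d (polyDerRight ρ x (X (p, q))) = ρ x p q := by
      rw [polyDerRight_X]; simp [evOne, Matrix.one_apply]
    simp only [Derivation.leibniz, map_add, smul_eq_mul, map_mul, hP, h1, h2]

/-- The linear form `u ↦ (u · P)(1)` on `U(L)`, for a polynomial `P` in the matrix entries. -/
def ell (ρ : L →ₗ⁅ℂ⁆ Matrix (Fin d) (Fin d) ℂ) (P : MvPolynomial (Fin d × Fin d) ℂ) :
    𝒰 L →ₗ[ℂ] ℂ :=
  (evOne d).toLinearMap ∘ₗ (LinearMap.applyₗ P) ∘ₗ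
    (UniversalEnvelopingAlgebra.lift ℂ (polyRep ρ (Fin d))).toLinearMap

theorem ell_apply (ρ : L →ₗ⁅ℂ⁆ Matrix (Fin d) (Fin d) ℂ) (P : MvPolynomial (Fin d × Fin d) ℂ)
    (u : 𝒰 L) :
    ell ρ P u = evOne d (UniversalEnvelopingAlgebra.lift ℂ (polyRep ρ (Fin d)) u P) := rfl

/-- U(𝔤) is spanned by words in 𝔤, which are built by adding one letter at a time on the left. -/
theorem enveloping_induction {𝔤 : Type*} [LieRing 𝔤] [LieAlgebra ℂ 𝔤] {C : 𝒰 𝔤 → Prop}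
    (one : C 1) (smul : ∀ (c : ℂ) u, C u → C (c • u)) (add : ∀ u v, C u → C v → C (u + v))
    (ι_mul : ∀ (x : 𝔤) u, C u → C (UniversalEnvelopingAlgebra.ι ℂ x * u)) (u : 𝒰 𝔤) : C u := by
  let S : Subalgebra ℂ (𝒰 𝔤) := Algebra.adjoin ℂ (Set.range (UniversalEnvelopingAlgebra.ι ℂ))
  let g : 𝔤 →ₗ⁅ℂ⁆ S :=
    { toFun := fun x => ⟨UniversalEnvelopingAlgebra.ι ℂ x, Algebra.subset_adjoin ⟨x, rfl⟩⟩
      map_add' := fun x y => Subtype.ext (map_add _ x y)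
      map_smul' := fun c x => Subtype.ext (map_smul _ c x)
      map_lie' := fun {x y} => Subtype.ext (LieHom.map_lie _ x y) }
  -- By the universal property, U(𝔤) → S → U(𝔤) is the identity, so the subalgebra generated by 𝔤 is
  -- everything.
  have hS : S.val.comp (UniversalEnvelopingAlgebra.lift ℂ g) = AlgHom.id ℂ _ := by
    ext x
    simp only [LieHom.comp_apply, AlgHom.coe_toLieHom, AlgHom.comp_apply,
      UniversalEnvelopingAlgebra.lift_ι_apply]
    rfl
  have hu : u ∈ S := by
    have h := congrArg (fun F => F u) hS
    simp only [AlgHom.comp_apply, AlgHom.id_apply] at h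
    rw [← h]
    exact Subtype.property _
  suffices h : ∀ v, C v → C (u * v) by simpa using h 1 one
  induction hu using Algebra.adjoin_induction with
  | mem a ha => obtain ⟨x, rfl⟩ := ha; exact fun v hv => ι_mul x v hv
  | algebraMap c => intro v hv; rw [← Algebra.smul_def]; exact smul c v hv
  | add a b _ _ ha hb => intro v hv; rw [add_mul]; exact add _ _ (ha v hv) (hb v hv)
  | mul a b _ _ ha hb => intro v hv; rw [mul_assoc]; exact ha _ (hb v hv)

theorem lift_polyDerRight_comm (ρ : L →ₗ⁅ℂ⁆ Matrix (Fin d) (Fin d) ℂ) (y : L) (u : 𝒰 L)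
    (P : MvPolynomial (Fin d × Fin d) ℂ) :
    UniversalEnvelopingAlgebra.lift ℂ (polyRep ρ (Fin d)) u (polyDerRight ρ y P) =
      polyDerRight ρ y (UniversalEnvelopingAlgebra.lift ℂ (polyRep ρ (Fin d)) u P) := by
  induction u using enveloping_induction with
  | one => simp
  | smul c u h => simp [h]
  | add u v hu hv => simp [hu, hv]
  | ι_mul x u h =>
    rw [map_mul, Module.End.mul_apply, Module.End.mul_apply, h,
      UniversalEnvelopingAlgebra.lift_ι_apply, polyRep_apply, polyRep_apply,
      polyDer_polyDerRight_comm]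

theorem ell_mul_ι (ρ : L →ₗ⁅ℂ⁆ Matrix (Fin d) (Fin d) ℂ) (P : MvPolynomial (Fin d × Fin d) ℂ)
    (u : 𝒰 L) (x : L) :
    ell ρ P (u * UniversalEnvelopingAlgebra.ι ℂ x) = ell ρ (polyDer ρ (Fin d) x P) u := by
  rw [ell_apply, ell_apply, map_mul, Module.End.mul_apply, UniversalEnvelopingAlgebra.lift_ι_apply,
    polyRep_apply]

/-- The factor x acts last and is evaluated at the identity, where it may be replaced by the
opposite translation; the latter commutes with the action of u. -/
theorem ell_ι_mul (ρ : L →ₗ⁅ℂ⁆ Matrix (Fin d) (Fin d) ℂ) (P : MvPolynomial (Fin d × Fin d) ℂ)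
    (u : 𝒰 L) (x : L) :
    ell ρ P (UniversalEnvelopingAlgebra.ι ℂ x * u) = ell ρ (polyDerRight ρ x P) u := by
  rw [ell_apply, ell_apply, map_mul, Module.End.mul_apply, UniversalEnvelopingAlgebra.lift_ι_apply,
    polyRep_apply, lift_polyDerRight_comm, evOne_polyDer]

end PolynomialRepresentation

/-! ### Restriction of polynomials to N -/

section Restriction

open MvPolynomial

variable {L : Type*} [LieRing L] [LieAlgebra ℂ L] {d : ℕ}
variable {ρ : L →ₗ⁅ℂ⁆ Matrix (Fin d) (Fin d) ℂ} {𝔫 : LieSubalgebra ℂ L}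

local notation "𝒰" => UniversalEnvelopingAlgebra ℂ

/-- Restriction of polynomials in the matrix entries to `N`. -/
def res (ρ : L →ₗ⁅ℂ⁆ Matrix (Fin d) (Fin d) ℂ) (𝔫 : LieSubalgebra ℂ L) :
    MvPolynomial (Fin d × Fin d) ℂ →ₐ[ℂ] coordRing ρ 𝔫 :=
  aeval fun pq => ⟨entry ρ 𝔫 pq.1 pq.2, entry_mem pq.1 pq.2⟩

theorem res_X (p q : Fin d) : res ρ 𝔫 (X (p, q)) = ⟨entry ρ 𝔫 p q, entry_mem p q⟩ := by
  simp [res]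

theorem coordRing_induction {C : coordRing ρ 𝔫 → Prop}
    (entries : ∀ p q, C ⟨entry ρ 𝔫 p q, entry_mem p q⟩) (algebraMap : ∀ c, C (algebraMap ℂ _ c))
    (add : ∀ F G, C F → C G → C (F + G)) (mul : ∀ F G, C F → C G → C (F * G))
    (F : coordRing ρ 𝔫) : C F := by
  obtain ⟨F, hF⟩ := F
  induction hF using Algebra.adjoin_induction with
  | mem F hF => obtain ⟨p, q, rfl⟩ := hF; exact entries p q
  | algebraMap c => exact algebraMap c
  | add F G hF hG h h' => exact add ⟨F, hF⟩ ⟨G, hG⟩ h h'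
  | mul F G hF hG h h' => exact mul ⟨F, hF⟩ ⟨G, hG⟩ h h'

/-- Lifting a function on N to a polynomial makes f_i and h_i available, which do not act on ℂ[N]
through translations by N. -/
theorem res_surjective : Function.Surjective (res ρ 𝔫) := by
  intro F
  induction F using coordRing_induction with
  | entries p q => exact ⟨X (p, q), res_X p q⟩
  | algebraMap c => exact ⟨C c, by simp [res]⟩
  | add F G hF hG =>
    obtain ⟨P, rfl⟩ := hF
    obtain ⟨Q, rfl⟩ := hG
    exact ⟨P + Q, map_add _ _ _⟩
  | mul F G hF hG =>
    obtain ⟨P, rfl⟩ := hF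
    obtain ⟨Q, rfl⟩ := hG
    exact ⟨P * Q, map_mul _ _ _⟩

theorem rightAction_mul (x : 𝔫) (F G : coordRing ρ 𝔫) :
    rightAction ρ x (F * G) = F * rightAction ρ x G + G * rightAction ρ x F := by
  refine Subtype.ext <| funext fun m => ?_
  have h := ((rightDer_spec x F.2).1 m).mul ((rightDer_spec x G.2).1 m)
  simp only [expN_zero_smul, one_mul] at h
  refine h.deriv.trans ?_
  change _ = (F : unipotentGroup ρ 𝔫 → ℂ) m * rightDer x G m
    + (G : unipotentGroup ρ 𝔫 → ℂ) m * rightDer x F m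
  ring

theorem leftAction_mul (x : 𝔫) (F G : coordRing ρ 𝔫) :
    leftAction ρ 𝔫 x (F * G) = F * leftAction ρ 𝔫 x G + G * leftAction ρ 𝔫 x F :=
  (leftDerivation ρ x).leibniz F G

/-- The right action of `x ∈ 𝔫` on `ℂ[N]`, as a derivation. -/
def rightDerivation (ρ : L →ₗ⁅ℂ⁆ Matrix (Fin d) (Fin d) ℂ) {𝔫 : LieSubalgebra ℂ L} (x : 𝔫) :
    Derivation ℂ (coordRing ρ 𝔫) (coordRing ρ 𝔫) :=
  Derivation.mk' (rightAction ρ x) (rightAction_mul x)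

theorem rightAction_entry (x : 𝔫) (p q : Fin d) :
    rightAction ρ x ⟨entry ρ 𝔫 p q, entry_mem p q⟩ =
      ∑ k, ρ (x : L) p k • (⟨entry ρ 𝔫 k q, entry_mem k q⟩ : coordRing ρ 𝔫) := by
  apply Subtype.ext
  refine (funext fun m => (hasDerivAt_entry' m x p q).deriv).trans ?_
  simp

theorem leftAction_one (x : 𝔫) : leftAction ρ 𝔫 x 1 = 0 :=
  (leftDerivation ρ x).map_one_eq_zero

theorem rightAction_one (x : 𝔫) : rightAction ρ x 1 = 0 :=
  (rightDerivation ρ x).map_one_eq_zero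

theorem leftAction_res (x : 𝔫) (P : MvPolynomial (Fin d × Fin d) ℂ) :
    leftAction ρ 𝔫 x (res ρ 𝔫 P) = res ρ 𝔫 (polyDer ρ (Fin d) x P) := by
  induction P using MvPolynomial.induction_on with
  | C a =>
    rw [derivation_C, map_zero]
    have h : res ρ 𝔫 (C a) = a • 1 := by simp [res, Algebra.algebraMap_eq_smul_one]
    rw [h, map_smul, leftAction_one, smul_zero]
  | add P Q hP hQ => simp only [map_add, hP, hQ]
  | mul_X P pq hP =>
    obtain ⟨p, q⟩ := pq
    rw [map_mul, leftAction_mul, hP, res_X, Derivation.leibniz, map_add, smul_eq_mul, smul_eq_mul,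
      map_mul, map_mul, res_X, polyDer_X]
    congr 2
    refine (leftDerivation_entry x p q).trans ?_
    simp only [map_sum, map_smul, res_X]

theorem rightAction_res (x : 𝔫) (P : MvPolynomial (Fin d × Fin d) ℂ) :
    rightAction ρ x (res ρ 𝔫 P) = res ρ 𝔫 (polyDerRight ρ x P) := by
  induction P using MvPolynomial.induction_on with
  | C a =>
    rw [derivation_C, map_zero]
    have h : res ρ 𝔫 (C a) = a • 1 := by simp [res, Algebra.algebraMap_eq_smul_one]
    rw [h, map_smul, rightAction_one, smul_zero]
  | add P Q hP hQ => simp only [map_add, hP, hQ]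
  | mul_X P pq hP =>
    obtain ⟨p, q⟩ := pq
    rw [map_mul, rightAction_mul, hP, res_X, Derivation.leibniz, map_add, smul_eq_mul, smul_eq_mul,
      map_mul, map_mul, res_X, polyDerRight_X, rightAction_entry]
    simp only [map_sum, map_smul, res_X]

theorem leftAction_rightAction_comm (x y : 𝔫) (F : coordRing ρ 𝔫) :
    leftAction ρ 𝔫 x (rightAction ρ y F) = rightAction ρ y (leftAction ρ 𝔫 x F) := by
  obtain ⟨P, rfl⟩ := res_surjective F
  rw [rightAction_res, leftAction_res, leftAction_res, rightAction_res, polyDer_polyDerRight_comm]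

theorem res_apply_one (P : MvPolynomial (Fin d × Fin d) ℂ) :
    (res ρ 𝔫 P : unipotentGroup ρ 𝔫 → ℂ) 1 = evOne d P := by
  induction P using MvPolynomial.induction_on with
  | C a => simp [res, evOne]
  | add P Q hP hQ => rw [map_add, map_add, ← hP, ← hQ]; rfl
  | mul_X P pq hP =>
    obtain ⟨p, q⟩ := pq
    rw [map_mul, map_mul, ← hP, res_X]
    have h : toMat (1 : unipotentGroup ρ 𝔫) = 1 := rfl
    simp [evOne, entry, h]

/-- The map `U(𝔫) → U(L)` induced by the inclusion of a Lie subalgebra. -/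
def envIncl (𝔫 : LieSubalgebra ℂ L) : 𝒰 𝔫 →ₐ[ℂ] 𝒰 L :=
  UniversalEnvelopingAlgebra.lift ℂ ((UniversalEnvelopingAlgebra.ι ℂ).comp 𝔫.incl)

theorem envIncl_ι (x : 𝔫) : envIncl 𝔫 (UniversalEnvelopingAlgebra.ι ℂ x) =
    UniversalEnvelopingAlgebra.ι ℂ (x : L) :=
  UniversalEnvelopingAlgebra.lift_ι_apply _ _ _

theorem lift_leftAction_res (u : 𝒰 𝔫) (P : MvPolynomial (Fin d × Fin d) ℂ) :
    UniversalEnvelopingAlgebra.lift ℂ (leftAction ρ 𝔫) u (res ρ 𝔫 P) =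
      res ρ 𝔫 (UniversalEnvelopingAlgebra.lift ℂ (polyRep ρ (Fin d)) (envIncl 𝔫 u) P) := by
  induction u using enveloping_induction with
  | one => simp
  | smul c u h => simp [h]
  | add u v hu hv => simp [hu, hv]
  | ι_mul x u h =>
    rw [map_mul, map_mul, map_mul, Module.End.mul_apply, Module.End.mul_apply, h, envIncl_ι,
      UniversalEnvelopingAlgebra.lift_ι_apply, UniversalEnvelopingAlgebra.lift_ι_apply,
      leftAction_res, polyRep_apply]

theorem pairing_res (P : MvPolynomial (Fin d × Fin d) ℂ) (u : 𝒰 𝔫) :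
    pairing (res ρ 𝔫 P) u = ell ρ P (envIncl 𝔫 u) := by
  rw [pairing, lift_leftAction_res, res_apply_one, ell_apply]

theorem pairing_add_left (F G : coordRing ρ 𝔫) (u : 𝒰 𝔫) :
    pairing (F + G) u = pairing F u + pairing G u := by
  simp [pairing]

theorem pairing_smul_left (c : ℂ) (F : coordRing ρ 𝔫) (u : 𝒰 𝔫) :
    pairing (c • F) u = c * pairing F u := by
  simp [pairing]

theorem pairing_mul_ι (F : coordRing ρ 𝔫) (u : 𝒰 𝔫) (x : 𝔫) :
    pairing F (u * UniversalEnvelopingAlgebra.ι ℂ x) = pairing (leftAction ρ 𝔫 x F) u := by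
  rw [pairing, map_mul, Module.End.mul_apply, UniversalEnvelopingAlgebra.lift_ι_apply, pairing]

theorem pairing_ι_mul (F : coordRing ρ 𝔫) (u : 𝒰 𝔫) (x : 𝔫) :
    pairing F (UniversalEnvelopingAlgebra.ι ℂ x * u) = pairing (rightAction ρ x F) u := by
  obtain ⟨P, rfl⟩ := res_surjective F
  rw [rightAction_res, pairing_res, pairing_res, map_mul, envIncl_ι, ell_ι_mul]

end Restriction

/-! ### Nondegeneracy of the pairing on the side of ℂ[N] -/

section Nondegeneracy

variable {L : Type*} [LieRing L] [LieAlgebra ℂ L] {d : ℕ}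
variable {ρ : L →ₗ⁅ℂ⁆ Matrix (Fin d) (Fin d) ℂ} {𝔫 : LieSubalgebra ℂ L}

theorem expN_add_smul (x : 𝔫) (s t : ℂ) :
    expN ρ ((s + t) • x) = expN ρ (s • x) * expN ρ (t • x) := by
  apply Subtype.ext
  apply Units.ext
  change NormedSpace.exp (ρ (((s + t) • x : 𝔫) : L)) =
    NormedSpace.exp (ρ ((s • x : 𝔫) : L)) * NormedSpace.exp (ρ ((t • x : 𝔫) : L))
  have h : ∀ c : ℂ, ρ ((c • x : 𝔫) : L) = c • ρ (x : L) := fun c => map_smul ρ c (x : L)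
  rw [h, h, h, add_smul]
  exact Matrix.exp_add_of_commute _ _ (((Commute.refl _).smul_left s).smul_right t)

theorem hasDerivAt_mul_expN (F : coordRing ρ 𝔫) (n : unipotentGroup ρ 𝔫) (x : 𝔫) (t : ℂ) :
    HasDerivAt (fun t : ℂ => (F : unipotentGroup ρ 𝔫 → ℂ) (n * expN ρ (t • x)))
      ((leftAction ρ 𝔫 x F : unipotentGroup ρ 𝔫 → ℂ) (n * expN ρ (t • x))) t := by
  have h := (leftDer_spec x F.2).1 (n * expN ρ (t • x))
  rw [← sub_self t] at h
  have h2 := h.comp_sub_const t t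
  convert! h2 using 1
  funext s
  rw [mul_assoc, ← expN_add_smul, add_sub_cancel]

/-- The function t ↦ F(n exp(tx)) is entire, and its derivatives at 0 are the values (x^k · F)(n).
-/
theorem apply_mul_expN_eq_zero (F : coordRing ρ 𝔫) (n : unipotentGroup ρ 𝔫) (x : 𝔫)
    (h : ∀ k : ℕ, (((leftAction ρ 𝔫 x) ^ k) F : unipotentGroup ρ 𝔫 → ℂ) n = 0) :
    (F : unipotentGroup ρ 𝔫 → ℂ) (n * expN ρ x) = 0 := by
  set f : ℂ → ℂ := fun t => (F : unipotentGroup ρ 𝔫 → ℂ) (n * expN ρ (t • x)) with hf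
  have hd : ∀ k, iteratedDeriv k f = fun t =>
      (((leftAction ρ 𝔫 x) ^ k) F : unipotentGroup ρ 𝔫 → ℂ) (n * expN ρ (t • x)) := by
    intro k
    induction k with
    | zero => simp [hf]
    | succ k ih =>
      rw [iteratedDeriv_succ, ih]
      funext t
      rw [(hasDerivAt_mul_expN _ n x t).deriv, pow_succ', Module.End.mul_apply]
  have hdiff : Differentiable ℂ f := fun t => (hasDerivAt_mul_expN F n x t).differentiableAt
  have hs := Complex.hasSum_taylorSeries_of_entire hdiff 0 1
  have hz : ∀ k : ℕ, ((k.factorial : ℂ)⁻¹ • ((1 : ℂ) - 0) ^ k • iteratedDeriv k f 0) = 0 := by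
    intro k
    rw [hd]
    simp only [expN_zero_smul, mul_one, h, smul_zero]
  simp only [hz] at hs
  have h1 := hs.unique hasSum_zero
  simpa [hf] using h1

/-- The hypothesis says that every u · F vanishes at 1. By Taylor expansion this property passes
from a point n to n exp(x), and N is generated by exponentials. -/
theorem eq_zero_of_pairing_eq_zero (F : coordRing ρ 𝔫) (hF : ∀ u, pairing F u = 0) : F = 0 := by
  suffices h : ∀ n : unipotentGroup ρ 𝔫, ∀ u, (UniversalEnvelopingAlgebra.lift ℂ
      (leftAction ρ 𝔫) u F : unipotentGroup ρ 𝔫 → ℂ) n = 0 by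
    refine Subtype.ext (funext fun n => ?_)
    simpa using h n 1
  have step : ∀ (n : unipotentGroup ρ 𝔫) (x : 𝔫), (∀ u, (UniversalEnvelopingAlgebra.lift ℂ
      (leftAction ρ 𝔫) u F : unipotentGroup ρ 𝔫 → ℂ) n = 0) →
      ∀ u, (UniversalEnvelopingAlgebra.lift ℂ
      (leftAction ρ 𝔫) u F : unipotentGroup ρ 𝔫 → ℂ) (n * expN ρ x) = 0 := by
    intro n x hn u
    refine apply_mul_expN_eq_zero _ n x fun k => ?_
    have := hn (UniversalEnvelopingAlgebra.ι ℂ x ^ k * u)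
    rwa [map_mul, map_pow, Module.End.mul_apply, UniversalEnvelopingAlgebra.lift_ι_apply] at this
  have key : ∀ g ∈ unipotentGroup ρ 𝔫, ∀ n : unipotentGroup ρ 𝔫, (n : GL (Fin d) ℂ) = g →
      ∀ u, (UniversalEnvelopingAlgebra.lift ℂ
      (leftAction ρ 𝔫) u F : unipotentGroup ρ 𝔫 → ℂ) n = 0 := by
    intro g hg
    induction hg using Subgroup.closure_induction_right with
    | one =>
      intro n hn u
      obtain rfl : n = 1 := Subtype.ext hn
      exact hF u
    | mul_right g hg y hy ih =>
      obtain ⟨x, hx, rfl⟩ := hy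
      intro n hn
      obtain rfl : n = ⟨g, hg⟩ * expN ρ ⟨x, hx⟩ := Subtype.ext hn
      exact step _ _ (ih ⟨g, hg⟩ rfl)
    | mul_inv_cancel g hg y hy ih =>
      obtain ⟨x, hx, rfl⟩ := hy
      intro n hn
      have hinv : (expN ρ (⟨x, hx⟩ : 𝔫))⁻¹ = expN ρ (-⟨x, hx⟩ : 𝔫) := by
        rw [inv_eq_iff_mul_eq_one]
        have h := expN_add_smul (ρ := ρ) (⟨x, hx⟩ : 𝔫) 1 (-1)
        rw [add_neg_cancel, expN_zero_smul, one_smul, neg_smul, one_smul] at h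
        exact h.symm
      obtain rfl : n = ⟨g, hg⟩ * expN ρ (-⟨x, hx⟩ : 𝔫) := by
        rw [← hinv]; exact Subtype.ext hn
      exact step _ _ (ih ⟨g, hg⟩ rfl)
  exact fun n => key _ n.2 n rfl

theorem eq_of_pairing_eq {F G : coordRing ρ 𝔫} (h : ∀ u, pairing F u = pairing G u) : F = G := by
  refine sub_eq_zero.1 (eq_zero_of_pairing_eq_zero _ fun u => ?_)
  have h2 := pairing_add_left (F - G) G u
  rw [sub_add_cancel, h] at h2
  linear_combination -h2

end Nondegeneracy

/-! ### Positive roots and the nilradical of the minimal parabolic -/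

section PositiveRoots

variable {L : Type*} [LieRing L] [LieAlgebra ℂ L] [FiniteDimensional ℂ L] [LieAlgebra.IsSimple ℂ L]
variable {H : LieSubalgebra ℂ L} [H.IsCartanSubalgebra]

theorem exists_heightVector (Δ : (rootSystem H).Base) :
    ∃ h₀ : H, ∀ α : H.root, (α : LieModule.Weight ℂ H L) h₀ = (Δ.height α : ℂ) := by
  -- The form equal to 1 on each simple root is, by biduality, evaluation at a vector of H.
  let φ : Module.Dual ℂ (Module.Dual ℂ H) := Δ.toWeightBasis.constr ℂ fun _ => (1 : ℂ)
  refine ⟨(Module.evalEquiv ℂ H).symm φ, fun α => ?_⟩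
  have h1 : ∀ ψ : Module.Dual ℂ H, ψ ((Module.evalEquiv ℂ H).symm φ) = φ ψ := fun ψ =>
    by simp
  obtain ⟨f, -, -, hf⟩ := Δ.exists_root_eq_sum_int α
  have h2 : φ ((rootSystem H).root α) = (Δ.height α : ℂ) := by
    rw [RootPairing.Base.height_eq_sum hf, hf, map_sum, Int.cast_sum]
    refine Finset.sum_congr rfl fun j hj => ?_
    have h3 : φ ((rootSystem H).root j) = 1 := by
      have h4 := Δ.toWeightBasis.constr_basis ℂ (fun _ => (1 : ℂ)) ⟨j, hj⟩
      rwa [RootPairing.Base.toWeightBasis_apply] at h4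
    rw [map_zsmul, h3]
    simp
  rw [← h2, ← h1]
  rfl

/-- A vector of `H` on which every root takes its height as value. -/
def heightVector (Δ : (rootSystem H).Base) : H := (exists_heightVector Δ).choose

theorem root_heightVector (Δ : (rootSystem H).Base) (α : H.root) :
    (α : LieModule.Weight ℂ H L) (heightVector Δ) = (Δ.height α : ℂ) :=
  (exists_heightVector Δ).choose_spec α

theorem root_isNonZero (α : H.root) : (α : LieModule.Weight ℂ H L).IsNonZero :=
  (Finset.mem_filter.1 α.2).2

theorem exists_root_of_mem_rootSpace {χ : H → ℂ} (hχ : χ ≠ 0) {x : L} (hx : x ∈ rootSpace H χ)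
    (hx0 : x ≠ 0) : ∃ α : H.root, ((α : LieModule.Weight ℂ H L) : H → ℂ) = χ := by
  have hbot : LieModule.genWeightSpace L χ ≠ ⊥ := by
    intro h
    have h2 : x ∈ LieModule.genWeightSpace L χ := hx
    rw [h] at h2
    exact hx0 ((LieSubmodule.mem_bot x).1 h2)
  let w : LieModule.Weight ℂ H L := ⟨χ, hbot⟩
  have hw : w.IsNonZero := fun h => hχ h
  exact ⟨⟨w, by simpa [LieSubalgebra.root] using hw⟩, rfl⟩

/-- The span of the positive root spaces. -/
def posSpan (Δ : (rootSystem H).Base) : Submodule ℂ L :=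
  Submodule.span ℂ
    {x | ∃ α : H.root, Δ.IsPos α ∧ x ∈ rootSpace H (α : LieModule.Weight ℂ H L)}

/-- The span of the root spaces of the positive roots other than `α_i`. -/
def nilSpan (Δ : (rootSystem H).Base) (i : Δ.support) : Submodule ℂ L :=
  Submodule.span ℂ
    {x | ∃ α : H.root, Δ.IsPos α ∧ α ≠ i ∧ x ∈ rootSpace H (α : LieModule.Weight ℂ H L)}

variable {Δ : (rootSystem H).Base}

theorem nilSpan_le_posSpan (i : Δ.support) : nilSpan Δ i ≤ posSpan Δ :=
  Submodule.span_mono fun _ ⟨α, h, _, hx⟩ => ⟨α, h, hx⟩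

/-- A nonzero bracket is a root vector whose root has height at least 2, hence is positive and not
simple. -/
theorem lie_rootSpace_mem_nilSpan (i : Δ.support) {α β : H.root} (hα : Δ.IsPos α)
    (hβ : Δ.IsPos β) {x y : L} (hx : x ∈ rootSpace H (α : LieModule.Weight ℂ H L))
    (hy : y ∈ rootSpace H (β : LieModule.Weight ℂ H L)) : ⁅x, y⁆ ∈ nilSpan Δ i := by
  by_cases h0 : ⁅x, y⁆ = 0
  · rw [h0]; exact Submodule.zero_mem _
  have hm : ⁅x, y⁆ ∈ rootSpace H (((α : LieModule.Weight ℂ H L) : H → ℂ) + β) :=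
    lie_mem_genWeightSpace_of_mem_genWeightSpace hx hy
  rw [RootPairing.Base.isPos_iff] at hα hβ
  have hne : ((α : LieModule.Weight ℂ H L) : H → ℂ) + (β : LieModule.Weight ℂ H L) ≠ 0 := by
    intro h
    have h1 := congrFun h (heightVector Δ)
    rw [Pi.add_apply, root_heightVector, root_heightVector, Pi.zero_apply] at h1
    norm_cast at h1
    lia
  obtain ⟨γ, hγ⟩ := exists_root_of_mem_rootSpace hne hm h0
  have hγ' : Δ.height γ = Δ.height α + Δ.height β := by
    have h1 := congrFun hγ (heightVector Δ)
    rw [Pi.add_apply, root_heightVector, root_heightVector, root_heightVector] at h1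
    exact_mod_cast h1
  refine Submodule.subset_span ⟨γ, ?_, ?_, ?_⟩
  · rw [RootPairing.Base.isPos_iff]; lia
  · rintro rfl
    rw [RootPairing.Base.height_one_of_mem_support i.2] at hγ'
    lia
  · rw [hγ]; exact hm

theorem lie_posSpan_mem_nilSpan (i : Δ.support) {x y : L} (hx : x ∈ posSpan Δ)
    (hy : y ∈ posSpan Δ) : ⁅x, y⁆ ∈ nilSpan Δ i := by
  induction hx using Submodule.span_induction with
  | mem x hx =>
    obtain ⟨α, hα, hx⟩ := hx
    induction hy using Submodule.span_induction with
    | mem y hy =>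
      obtain ⟨β, hβ, hy⟩ := hy
      exact lie_rootSpace_mem_nilSpan i hα hβ hx hy
    | zero => rw [lie_zero]; exact Submodule.zero_mem _
    | add a b _ _ ha hb => rw [lie_add]; exact Submodule.add_mem _ ha hb
    | smul c a _ ha => rw [lie_smul]; exact Submodule.smul_mem _ _ ha
  | zero => rw [zero_lie]; exact Submodule.zero_mem _
  | add a b _ _ ha hb => rw [add_lie]; exact Submodule.add_mem _ ha hb
  | smul c a _ ha => rw [smul_lie]; exact Submodule.smul_mem _ _ ha

theorem mem_nPlus_iff (i : Δ.support) {x : L} : x ∈ nPlus Δ ↔ x ∈ posSpan Δ := by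
  let N : LieSubalgebra ℂ L :=
    { posSpan Δ with
      lie_mem' := fun {x y} hx hy => nilSpan_le_posSpan i (lie_posSpan_mem_nilSpan i hx hy) }
  constructor
  · intro hx
    have h : nPlus Δ ≤ N := LieSubalgebra.lieSpan_le.2 fun y hy => Submodule.subset_span hy
    exact h hx
  · intro hx
    have h : posSpan Δ ≤ (nPlus Δ).toSubmodule :=
      Submodule.span_le.2 fun y hy => LieSubalgebra.subset_lieSpan hy
    exact h hx

theorem nilSpan_le_nPlus (i : Δ.support) {x : L} (hx : x ∈ nilSpan Δ i) : x ∈ nPlus Δ :=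
  (mem_nPlus_iff i).2 (nilSpan_le_posSpan i hx)

theorem lie_coe_of_mem_rootSpace {χ : H → ℂ} {x : L} (hx : x ∈ rootSpace H χ) (h : H) :
    ⁅(h : L), x⁆ = χ h • x :=
  lie_eq_smul_of_mem_rootSpace hx h

theorem lie_cartan_mem_nilSpan (i : Δ.support) (h : H) {x : L} (hx : x ∈ nilSpan Δ i) :
    ⁅(h : L), x⁆ ∈ nilSpan Δ i := by
  induction hx using Submodule.span_induction with
  | mem x hx =>
    obtain ⟨α, hα, hαi, hx⟩ := hx
    rw [lie_coe_of_mem_rootSpace hx]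
    exact Submodule.smul_mem _ _ (Submodule.subset_span ⟨α, hα, hαi, hx⟩)
  | zero => rw [lie_zero]; exact Submodule.zero_mem _
  | add a b _ _ ha hb => rw [lie_add]; exact Submodule.add_mem _ ha hb
  | smul c a _ ha => rw [lie_smul]; exact Submodule.smul_mem _ _ ha

variable (R : RootVectors Δ) (i : Δ.support)

theorem RootVectors.e_mem' : R.e i ∈ rootSpace H ((i : H.root) : LieModule.Weight ℂ H L) :=
  R.e_mem i

theorem RootVectors.f_mem' :
    R.f i ∈ rootSpace H (-(((i : H.root) : LieModule.Weight ℂ H L) : H → ℂ)) :=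
  R.f_mem i

theorem simpleRoot_simpleCoroot :
    ((i : H.root) : LieModule.Weight ℂ H L) (simpleCoroot Δ i) = 2 := by
  have h : ((i : H.root) : LieModule.Weight ℂ H L).IsNonZero :=
    root_isNonZero _
  exact root_apply_coroot h

theorem RootVectors.lie_h_e : ⁅(simpleCoroot Δ i : L), R.e i⁆ = (2 : ℂ) • R.e i := by
  rw [lie_coe_of_mem_rootSpace (R.e_mem' i), simpleRoot_simpleCoroot]

theorem RootVectors.lie_h_f : ⁅(simpleCoroot Δ i : L), R.f i⁆ = (-2 : ℂ) • R.f i := by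
  rw [lie_coe_of_mem_rootSpace (R.f_mem' i), Pi.neg_apply, simpleRoot_simpleCoroot]

theorem RootVectors.e_ne_zero : R.e i ≠ 0 := by
  intro h
  have h1 := R.lie_e_f i
  rw [h, zero_lie] at h1
  have h2 := simpleRoot_simpleCoroot i
  rw [show simpleCoroot Δ i = 0 from Subtype.ext h1.symm] at h2
  have h3 : simpleRoot Δ i 0 = 2 := h2
  rw [map_zero] at h3
  norm_num at h3

theorem RootVectors.lie_e_mem_nilSpan {x : L} (hx : x ∈ nilSpan Δ i) : ⁅R.e i, x⁆ ∈ nilSpan Δ i :=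
  lie_posSpan_mem_nilSpan i ((mem_nPlus_iff i).1 (R.e_mem_nPlus i)) (nilSpan_le_posSpan i hx)

/-- For a positive root α ≠ α_i, if α - α_i is a root then it is positive; it differs from α_i
because 2α_i is not a root. -/
theorem RootVectors.lie_f_mem_nilSpan {x : L} (hx : x ∈ nilSpan Δ i) :
    ⁅R.f i, x⁆ ∈ nilSpan Δ i := by
  induction hx using Submodule.span_induction with
  | mem x hx =>
    obtain ⟨α, hα, hαi, hx⟩ := hx
    by_cases h0 : ⁅R.f i, x⁆ = 0
    · rw [h0]; exact Submodule.zero_mem _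
    have hm : ⁅R.f i, x⁆ ∈ rootSpace H
        (-(((i : H.root) : LieModule.Weight ℂ H L) : H → ℂ) + (α : LieModule.Weight ℂ H L)) :=
      lie_mem_genWeightSpace_of_mem_genWeightSpace (R.f_mem' i) hx
    have hne : -(((i : H.root) : LieModule.Weight ℂ H L) : H → ℂ)
        + (α : LieModule.Weight ℂ H L) ≠ 0 := by
      intro h
      rw [neg_add_eq_zero] at h
      exact hαi (Subtype.ext (DFunLike.coe_injective h.symm))
    obtain ⟨γ, hγ⟩ := exists_root_of_mem_rootSpace hne hm h0
    have hroot : (rootSystem H).root γ = (rootSystem H).root α - (rootSystem H).root i := by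
      ext y
      have h1 := congrFun hγ y
      rw [Pi.add_apply, Pi.neg_apply] at h1
      exact h1.trans (by simp [neg_add_eq_sub])
    have hpos := hα.sub i.2 hroot
    refine Submodule.subset_span ⟨γ, hpos, ?_, ?_⟩
    · rintro rfl
      have h2 : ((α : LieModule.Weight ℂ H L) : H → ℂ)
          = 2 • (((i : H.root) : LieModule.Weight ℂ H L) : H → ℂ) := by
        rw [two_smul]
        nth_rewrite 1 [hγ]
        abel
      have hnz := root_isNonZero (i : H.root)
      have h3 := rootSpace_two_smul ((i : H.root) : LieModule.Weight ℂ H L) hnz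
      rw [← h2] at h3
      exact (α : LieModule.Weight ℂ H L).genWeightSpace_ne_bot' h3
    · rw [hγ]; exact hm
  | zero => rw [lie_zero]; exact Submodule.zero_mem _
  | add a b _ _ ha hb => rw [lie_add]; exact Submodule.add_mem _ ha hb
  | smul c a _ ha => rw [lie_smul]; exact Submodule.smul_mem _ _ ha

theorem RootVectors.exists_smul_e {x : L}
    (hx : x ∈ rootSpace H ((i : H.root) : LieModule.Weight ℂ H L)) : ∃ c : ℂ, x = c • R.e i := by
  have hnz : ((i : H.root) : LieModule.Weight ℂ H L).IsNonZero :=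
    root_isNonZero _
  have h1 := finrank_rootSpace_eq_one ((i : H.root) : LieModule.Weight ℂ H L) hnz
  have h2 := (finrank_eq_one_iff_of_nonzero' (⟨R.e i, R.e_mem' i⟩ :
    rootSpace H ((i : H.root) : LieModule.Weight ℂ H L))
    (fun h => R.e_ne_zero i (congrArg Subtype.val h))).1 h1 ⟨x, hx⟩
  obtain ⟨c, hc⟩ := h2
  exact ⟨c, (congrArg Subtype.val hc).symm⟩

theorem RootVectors.posSpan_decomp {x : L} (hx : x ∈ posSpan Δ) :
    ∃ y ∈ nilSpan Δ i, ∃ c : ℂ, x = y + c • R.e i := by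
  induction hx using Submodule.span_induction with
  | mem x hx =>
    obtain ⟨α, hα, hx⟩ := hx
    by_cases h : α = i
    · subst h
      obtain ⟨c, hc⟩ := R.exists_smul_e i hx
      exact ⟨0, Submodule.zero_mem _, c, by rw [zero_add, hc]⟩
    · exact ⟨x, Submodule.subset_span ⟨α, hα, h, hx⟩, 0, by simp⟩
  | zero => exact ⟨0, Submodule.zero_mem _, 0, by simp⟩
  | add a b _ _ ha hb =>
    obtain ⟨y, hy, c, rfl⟩ := ha
    obtain ⟨z, hz, c', rfl⟩ := hb
    exact ⟨y + z, Submodule.add_mem _ hy hz, c + c', by rw [add_smul]; abel⟩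
  | smul k a _ ha =>
    obtain ⟨y, hy, c, rfl⟩ := ha
    exact ⟨k • y, Submodule.smul_mem _ _ hy, k * c, by rw [smul_add, mul_smul]⟩

/-- Root spaces for distinct roots are independent. -/
theorem RootVectors.e_notMem_nilSpan : R.e i ∉ nilSpan Δ i := by
  intro h
  have hind := LieModule.iSupIndep_genWeightSpace ℂ H L
    (((i : H.root) : LieModule.Weight ℂ H L) : H → ℂ)
  have hle : nilSpan Δ i ≤ (⨆ χ, ⨆ (_ : χ ≠ (((i : H.root) : LieModule.Weight ℂ H L) : H → ℂ)),
      LieModule.genWeightSpace L χ : LieSubmodule ℂ H L).toSubmodule := by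
    refine Submodule.span_le.2 ?_
    rintro x ⟨α, -, hαi, hx⟩
    have hne : ((α : LieModule.Weight ℂ H L) : H → ℂ) ≠ (i : H.root).1 := fun h =>
      hαi (Subtype.ext (DFunLike.coe_injective h))
    exact (le_iSup₂_of_le (f := fun χ (_ : χ ≠ (((i : H.root) : LieModule.Weight ℂ H L) : H → ℂ)) =>
      LieModule.genWeightSpace L χ) _ hne le_rfl) hx
  have hmem : R.e i ∈ (LieModule.genWeightSpace L
      (((i : H.root) : LieModule.Weight ℂ H L) : H → ℂ) ⊓
      ⨆ χ, ⨆ (_ : χ ≠ (((i : H.root) : LieModule.Weight ℂ H L) : H → ℂ)),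
        LieModule.genWeightSpace L χ) := ⟨R.e_mem' i, hle h⟩
  rw [hind.eq_bot] at hmem
  exact R.e_ne_zero i ((LieSubmodule.mem_bot _).1 hmem)

end PositiveRoots

/-! ### Homogeneity under the torus, in infinitesimal form -/

section Homogeneity

open MvPolynomial

variable {d : ℕ}

/-- The hypothesis reads X A = (A - c) X, so X exp(A) = exp(A - c) X, and the scalar c splits off
the exponential. -/
theorem exp_conj_of_lie_eq_smul {A X : Matrix (Fin d) (Fin d) ℂ} {c : ℂ}
    (h : A * X - X * A = c • X) :
    NormedSpace.exp (-A) * X * NormedSpace.exp A = Complex.exp (-c) • X := by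
  let _ : NormedRing (Matrix (Fin d) (Fin d) ℂ) := Matrix.linftyOpNormedRing
  let _ : NormedAlgebra ℂ (Matrix (Fin d) (Fin d) ℂ) := Matrix.linftyOpNormedAlgebra
  have hsemi : SemiconjBy X A (A - c • (1 : Matrix (Fin d) (Fin d) ℂ)) := by
    rw [SemiconjBy, sub_mul, smul_mul_assoc, one_mul, ← h]
    abel
  have h1 : X * NormedSpace.exp A
      = NormedSpace.exp (A - c • (1 : Matrix (Fin d) (Fin d) ℂ)) * X := by
    have e1 := (NormedSpace.exp_series_hasSum_exp' (𝕂 := ℂ) A).mul_left X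
    have e2 := (NormedSpace.exp_series_hasSum_exp' (𝕂 := ℂ)
      (A - c • (1 : Matrix (Fin d) (Fin d) ℂ))).mul_right X
    refine e1.unique ?_
    convert! e2 using 1
    funext k
    rw [mul_smul_comm, smul_mul_assoc, (hsemi.pow_right k).eq]
  have h2 : NormedSpace.exp (A - c • (1 : Matrix (Fin d) (Fin d) ℂ))
      = NormedSpace.exp A * (Complex.exp (-c) • (1 : Matrix (Fin d) (Fin d) ℂ)) := by
    rw [sub_eq_add_neg, ← neg_smul, Matrix.exp_add_of_commute _ _
      ((Commute.one_right A).smul_right (-c))]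
    congr 1
    have h3 := NormedSpace.algebraMap_exp_comm (𝔸 := Matrix (Fin d) (Fin d) ℂ) (-c)
    rw [Algebra.algebraMap_eq_smul_one, Algebra.algebraMap_eq_smul_one] at h3
    rw [Complex.exp_eq_exp_ℂ]
    exact h3.symm
  have h4 : NormedSpace.exp (-A) * NormedSpace.exp A = 1 := by
    rw [← Matrix.exp_add_of_commute _ _ (Commute.refl A).neg_left, neg_add_cancel,
      NormedSpace.exp_zero]
  rw [mul_assoc, h1, h2, ← mul_assoc, ← mul_assoc, h4, one_mul, smul_mul_assoc, one_mul]

/-- Evaluation of a polynomial in the matrix entries at a matrix. -/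
def evMat (M : Matrix (Fin d) (Fin d) ℂ) : MvPolynomial (Fin d × Fin d) ℂ →ₐ[ℂ] ℂ :=
  aeval fun pq => M pq.1 pq.2

theorem evMat_X (M : Matrix (Fin d) (Fin d) ℂ) (p q : Fin d) : evMat M (X (p, q)) = M p q := by
  simp [evMat]

variable {L : Type*} [LieRing L] [LieAlgebra ℂ L]

theorem res_apply {ρ : L →ₗ⁅ℂ⁆ Matrix (Fin d) (Fin d) ℂ} {𝔫 : LieSubalgebra ℂ L}
    (P : MvPolynomial (Fin d × Fin d) ℂ) (n : unipotentGroup ρ 𝔫) :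
    (res ρ 𝔫 P : unipotentGroup ρ 𝔫 → ℂ) n = evMat (toMat n) P := by
  induction P using MvPolynomial.induction_on with
  | C a => simp [res, evMat]
  | add P Q hP hQ => rw [map_add, map_add, ← hP, ← hQ]; rfl
  | mul_X P pq hP =>
    obtain ⟨p, q⟩ := pq
    rw [map_mul, map_mul, ← hP, res_X, evMat_X]
    rfl

theorem hasDerivAt_conj_entry (A N : Matrix (Fin d) (Fin d) ℂ) (p q : Fin d) :
    HasDerivAt (fun t : ℂ => (NormedSpace.exp (t • -A) * N * NormedSpace.exp (t • A)) p q)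
      ((N * A - A * N) p q) 0 := by
  have h := HasDerivAt.fun_sum (u := Finset.univ) fun l _ =>
    (HasDerivAt.fun_sum (u := Finset.univ) fun k _ =>
      (hasDerivAt_exp_entry (-A) p k).mul_const (N k l)).mul (hasDerivAt_exp_entry A l q)
  simp only [zero_smul, NormedSpace.exp_zero] at h
  convert! h using 1
  simp only [Finset.sum_add_distrib]
  simp only [← Matrix.mul_apply, one_mul, mul_one]
  rw [Matrix.neg_mul, Matrix.sub_apply, Matrix.neg_apply]
  ring

theorem hasDerivAt_evMat_conj (ρ : L →ₗ⁅ℂ⁆ Matrix (Fin d) (Fin d) ℂ) (x : L)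
    (N : Matrix (Fin d) (Fin d) ℂ) (P : MvPolynomial (Fin d × Fin d) ℂ) :
    HasDerivAt (fun t : ℂ => evMat (NormedSpace.exp (t • -ρ x) * N * NormedSpace.exp (t • ρ x)) P)
      (evMat N (polyDer ρ (Fin d) x P - polyDerRight ρ x P)) 0 := by
  induction P using MvPolynomial.induction_on with
  | C a => simpa [evMat] using hasDerivAt_const (0 : ℂ) a
  | add P Q hP hQ =>
    simp only [map_add]
    convert! hP.add hQ using 1
    simp only [map_sub, map_add]
    ring
  | mul_X P pq hP =>
    obtain ⟨p, q⟩ := pq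
    simp only [map_mul, evMat_X]
    convert! hP.mul (hasDerivAt_conj_entry (ρ x) N p q) using 1
    simp only [zero_smul, NormedSpace.exp_zero, one_mul, mul_one]
    simp only [Derivation.leibniz, polyDer_X, polyDerRight_X, map_sub, map_add, smul_eq_mul,
      map_mul, map_sum, map_smul, evMat_X, Matrix.sub_apply, Matrix.mul_apply, mul_comm]
    ring

/-- Both sides are derivatives at t = 0 of the homogeneity relation for exp(th): conjugation
differentiates to left minus right, and the character to μ(h). As `IsHomogeneous` only compares
points already in N, `hconj` supplies the conjugates. -/
theorem res_sub_of_homogeneous {ρ : L →ₗ⁅ℂ⁆ Matrix (Fin d) (Fin d) ℂ} {𝔫 : LieSubalgebra ℂ L}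
    {H : LieSubalgebra ℂ L} {μ : Module.Dual ℂ H} {P : MvPolynomial (Fin d × Fin d) ℂ}
    (hP : IsHomogeneous μ (res ρ 𝔫 P)) (h : H)
    (hconj : ∀ (n : unipotentGroup ρ 𝔫) (t : ℂ), ∃ m : unipotentGroup ρ 𝔫,
      (m : GL (Fin d) ℂ) = (expGL ρ ((t • h : H) : L))⁻¹ * n * expGL ρ ((t • h : H) : L)) :
    res ρ 𝔫 (polyDer ρ (Fin d) (h : L) P - polyDerRight ρ (h : L) P) = μ h • res ρ 𝔫 P := by
  refine Subtype.ext (funext fun n => ?_)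
  rw [res_apply]
  have h1 := hasDerivAt_evMat_conj ρ (h : L) (toMat n) P
  have h2 : (fun t : ℂ => evMat (NormedSpace.exp (t • -ρ (h : L)) * toMat n *
      NormedSpace.exp (t • ρ (h : L))) P) = fun t => Complex.exp (t * μ h) *
        (res ρ 𝔫 P : unipotentGroup ρ 𝔫 → ℂ) n := by
    funext t
    obtain ⟨m, hm⟩ := hconj n t
    have h3 := hP (t • h) m n hm
    rw [map_smul, smul_eq_mul] at h3
    rw [← h3, res_apply]
    congr 2
    have h4 : toMat m = (((expGL ρ ((t • h : H) : L))⁻¹ : GL (Fin d) ℂ) : Matrix _ _ ℂ) * toMat n *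
        (expGL ρ ((t • h : H) : L) : Matrix _ _ ℂ) := by
      rw [toMat, hm]; rfl
    rw [h4, Matrix.coe_units_inv, coe_expGL, ← Matrix.exp_neg]
    have h5 : ρ ((t • h : H) : L) = t • ρ (h : L) := map_smul ρ t (h : L)
    rw [h5, smul_neg]
  rw [h2] at h1
  have h6 : HasDerivAt (fun t : ℂ => Complex.exp (t * μ h) *
      (res ρ 𝔫 P : unipotentGroup ρ 𝔫 → ℂ) n)
      (μ h * (res ρ 𝔫 P : unipotentGroup ρ 𝔫 → ℂ) n) 0 := by
    have h7 := (((hasDerivAt_id (0 : ℂ)).mul_const (μ h)).cexp).mul_const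
      ((res ρ 𝔫 P : unipotentGroup ρ 𝔫 → ℂ) n)
    simpa using h7
  exact h1.unique h6

variable [FiniteDimensional ℂ L] [LieAlgebra.IsSimple ℂ L]
variable {H : LieSubalgebra ℂ L} [H.IsCartanSubalgebra] {Δ : (rootSystem H).Base}

/-- Conjugation by exp(h) multiplies each root vector by a scalar. It follows that the torus
normalizes N. -/
theorem exists_conj_nPlus (ρ : L →ₗ⁅ℂ⁆ Matrix (Fin d) (Fin d) ℂ) (i : Δ.support) (h : H) {x : L}
    (hx : x ∈ nPlus Δ) : ∃ y ∈ nPlus Δ,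
      NormedSpace.exp (-ρ (h : L)) * ρ x * NormedSpace.exp (ρ (h : L)) = ρ y := by
  simp only [mem_nPlus_iff i] at hx ⊢
  induction hx using Submodule.span_induction with
  | mem x hx =>
    obtain ⟨α, hα, hx⟩ := hx
    refine ⟨Complex.exp (-((α : LieModule.Weight ℂ H L) h)) • x,
      Submodule.smul_mem _ _ (Submodule.subset_span ⟨α, hα, hx⟩), ?_⟩
    rw [map_smul]
    apply exp_conj_of_lie_eq_smul
    rw [← LieRing.of_associative_ring_bracket, ← LieHom.map_lie, lie_coe_of_mem_rootSpace hx,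
      map_smul]
  | zero => exact ⟨0, Submodule.zero_mem _, by simp⟩
  | add a b _ _ ha hb =>
    obtain ⟨y, hy, ha⟩ := ha
    obtain ⟨z, hz, hb⟩ := hb
    exact ⟨y + z, Submodule.add_mem _ hy hz, by rw [map_add, map_add, ← ha, ← hb, mul_add, add_mul]⟩
  | smul c a _ ha =>
    obtain ⟨y, hy, ha⟩ := ha
    exact ⟨c • y, Submodule.smul_mem _ _ hy, by
      rw [map_smul, map_smul, ← ha, mul_smul_comm, smul_mul_assoc]⟩

theorem exists_conj_unipotentGroup (ρ : L →ₗ⁅ℂ⁆ Matrix (Fin d) (Fin d) ℂ) (i : Δ.support) (h : H)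
    (n : unipotentGroup ρ (nPlus Δ)) : ∃ m : unipotentGroup ρ (nPlus Δ),
      (m : GL (Fin d) ℂ) = (expGL ρ (h : L))⁻¹ * n * expGL ρ (h : L) := by
  suffices hs : ∀ g ∈ unipotentGroup ρ (nPlus Δ),
      (expGL ρ (h : L))⁻¹ * g * expGL ρ (h : L) ∈ unipotentGroup ρ (nPlus Δ) from
    ⟨⟨_, hs n n.2⟩, rfl⟩
  intro g hg
  induction hg using Subgroup.closure_induction with
  | mem g hg =>
    obtain ⟨x, hx, rfl⟩ := hg
    obtain ⟨y, hy, hxy⟩ := exists_conj_nPlus ρ i h hx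
    refine Subgroup.subset_closure ⟨y, hy, ?_⟩
    apply Units.ext
    rw [coe_expGL, ← hxy, Matrix.exp_neg]
    have h1 := Matrix.exp_units_conj' (expGL ρ (h : L)) (ρ x)
    rw [Matrix.coe_units_inv] at h1
    rw [Units.val_mul, Units.val_mul, Matrix.coe_units_inv, coe_expGL]
    exact h1
  | one => rw [mul_one, inv_mul_cancel]; exact Subgroup.one_mem _
  | mul a b _ _ ha hb =>
    have := Subgroup.mul_mem _ ha hb
    convert! this using 1
    group
  | inv a _ ha =>
    have := Subgroup.inv_mem _ ha
    convert! this using 1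
    group

/-- The form that a lift of F defines on U(𝔫) sees ad h as multiplication by -μ(h): a function of
weight μ pairs only with elements of weight -μ. -/
theorem ell_lie_of_homogeneous {ρ : L →ₗ⁅ℂ⁆ Matrix (Fin d) (Fin d) ℂ} (i : Δ.support)
    {μ : Module.Dual ℂ H} {P : MvPolynomial (Fin d × Fin d) ℂ}
    (hP : IsHomogeneous μ (res ρ (nPlus Δ) P)) (h : H)
    (u : UniversalEnvelopingAlgebra ℂ (nPlus Δ)) :
    ell ρ P (UniversalEnvelopingAlgebra.ι ℂ (h : L) * inclU Δ u -
      inclU Δ u * UniversalEnvelopingAlgebra.ι ℂ (h : L)) =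
      -(μ h) * pairing (res ρ (nPlus Δ) P) u := by
  rw [map_sub, ell_ι_mul, ell_mul_ι]
  have h1 := res_sub_of_homogeneous hP h fun n t => exists_conj_unipotentGroup ρ i (t • h) n
  have h2 := pairing_smul_left (μ h) (res ρ (nPlus Δ) P) u
  rw [← h1, map_sub, sub_eq_add_neg, ← neg_one_smul ℂ, pairing_add_left, pairing_smul_left,
    pairing_res, pairing_res] at h2
  change _ - _ = _
  have h3 : envIncl (nPlus Δ) u = inclU Δ u := rfl
  rw [h3] at h2
  linear_combination -h2

end Homogeneity

/-! ### Locally finite 𝔰𝔩₂-modules and tensor products with V(p) -/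

section Sl2

variable {V : Type*} [AddCommGroup V] [Module ℂ V]

/-- Three operators satisfying the commutation relations of `𝔰𝔩₂`. -/
structure Sl2Ops (e f h : Module.End ℂ V) : Prop where
  ef : ∀ v, e (f v) - f (e v) = h v
  he : ∀ v, h (e v) - e (h v) = (2 : ℂ) • e v
  hf : ∀ v, h (f v) - f (h v) = (-2 : ℂ) • f v

namespace Sl2Ops

variable {e f h : Module.End ℂ V}

theorem swap (S : Sl2Ops e f h) : Sl2Ops f e (-h) where
  ef v := by rw [LinearMap.neg_apply, ← S.ef, neg_sub]
  he v := by
    have := S.hf v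
    simp only [LinearMap.neg_apply, map_neg]
    rw [neg_sub_neg, ← neg_sub, this, neg_smul, neg_neg]
  hf v := by
    have := S.he v
    simp only [LinearMap.neg_apply, map_neg]
    rw [neg_sub_neg, ← neg_sub, this, neg_smul]

theorem h_e_of_weight (S : Sl2Ops e f h) {v : V} {w : ℂ} (hv : h v = w • v) :
    h (e v) = (w + 2) • e v := by
  have := S.he v
  rw [hv, map_smul, sub_eq_iff_eq_add] at this
  rw [this, add_smul, add_comm]

theorem h_f_of_weight (S : Sl2Ops e f h) {v : V} {w : ℂ} (hv : h v = w • v) :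
    h (f v) = (w - 2) • f v := by
  have := S.hf v
  rw [hv, map_smul, sub_eq_iff_eq_add] at this
  rw [this, ← add_smul]
  congr 1
  ring

theorem h_e_pow_of_weight (S : Sl2Ops e f h) {v : V} {w : ℂ} (hv : h v = w • v) (k : ℕ) :
    h ((e ^ k) v) = (w + 2 * k) • (e ^ k) v := by
  induction k with
  | zero => simpa using hv
  | succ k ih =>
    rw [pow_succ', Module.End.mul_apply, S.h_e_of_weight ih]
    congr 1
    push_cast
    ring

theorem h_f_pow_of_weight (S : Sl2Ops e f h) {v : V} {w : ℂ} (hv : h v = w • v) (k : ℕ) :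
    h ((f ^ k) v) = (w - 2 * k) • (f ^ k) v := by
  induction k with
  | zero => simpa using hv
  | succ k ih =>
    rw [pow_succ', Module.End.mul_apply, S.h_f_of_weight ih]
    congr 1
    push_cast
    ring

/-- Moving f to the left past k + 1 factors e produces the weights w, w + 2, …, w + 2k, whose sum is
(k + 1)(w + k). -/
theorem e_pow_succ_f (S : Sl2Ops e f h) {v : V} {w : ℂ} (hv : h v = w • v) (k : ℕ) :
    (e ^ (k + 1)) (f v) = f ((e ^ (k + 1)) v) + ((k + 1) * (w + k)) • (e ^ k) v := by
  induction k with
  | zero =>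
    have := S.ef v
    rw [hv, sub_eq_iff_eq_add'] at this
    simpa using this
  | succ k ih =>
    have h1 := S.ef ((e ^ (k + 1)) v)
    rw [S.h_e_pow_of_weight hv, sub_eq_iff_eq_add'] at h1
    have h2 : ∀ (j : ℕ) (u : V), (e ^ (j + 1)) u = e ((e ^ j) u) := fun j u => by
      rw [pow_succ', Module.End.mul_apply]
    rw [h2 (k + 1) (f v), ih, map_add, map_smul, h1, h2 (k + 1) v, ← h2 k v, add_assoc, ← add_smul]
    congr 2
    push_cast
    ring

/-- On a weight space of weight w ≤ 0, e^{-w} is injective as soon as f is locally nilpotent.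
Induction on r reduces to f v = 0, since f v has weight w - 2 and is killed by e^{k+1}; then the
commutation formula turns e^{k+1} v = 0 into e^k v = 0, down to k = 0. -/
theorem eq_zero_of_weight (S : Sl2Ops e f h) {v : V} {w : ℤ} {r k : ℕ} (hv : h v = (w : ℂ) • v)
    (hr : (f ^ r) v = 0) (hk : (e ^ k) v = 0) (hkw : (k : ℤ) ≤ -w) : v = 0 := by
  induction r generalizing v w k with
  | zero => simpa using hr
  | succ r ih =>
    have hf : f v = 0 := by
      refine ih (v := f v) (w := w - 2) (k := k + 1) ?_ ?_ ?_ (by push_cast; lia)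
      · rw [S.h_f_of_weight hv]; push_cast; rfl
      · rwa [pow_succ, Module.End.mul_apply] at hr
      · rw [S.e_pow_succ_f hv, pow_succ', Module.End.mul_apply, hk]; simp
    clear ih
    induction k with
    | zero => simpa using hk
    | succ k ih =>
      refine ih ?_ (by push_cast at hkw; lia)
      have h1 := S.e_pow_succ_f hv k
      rw [hf, map_zero, hk, map_zero, zero_add] at h1
      refine (smul_eq_zero.1 h1.symm).resolve_left (mul_ne_zero (by exact_mod_cast k.succ_ne_zero) ?_)
      -- The bound `hkw` gives k + 1 ≤ -w, so w + k is negative.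
      have h2 : w + k ≠ 0 := by push_cast at hkw; lia
      exact_mod_cast h2

/-- The vector e^{n+1} v has weight n + 2 and is killed by f. With e and f exchanged it is a vector
of negative weight killed by the raising operator. -/
theorem e_pow_succ_eq_zero_of_f (S : Sl2Ops e f h) {v : V} {n r : ℕ}
    (hv : h v = (-(n : ℂ)) • v) (hf : f v = 0) (hr : (e ^ r) v = 0) : (e ^ (n + 1)) v = 0 := by
  have h1 := S.e_pow_succ_f hv n
  rw [hf, map_zero, neg_add_cancel, mul_zero, zero_smul, add_zero] at h1
  refine S.swap.eq_zero_of_weight (w := -(n + 2 : ℤ)) (r := r) (k := 1) ?_ ?_ ?_ (by lia)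
  · rw [LinearMap.neg_apply, S.h_e_pow_of_weight hv, ← neg_smul]
    congr 1
    push_cast
    ring
  · rw [← Module.End.mul_apply, ← pow_add, add_comm, pow_add, Module.End.mul_apply, hr, map_zero]
  · rw [pow_one]; exact h1.symm

theorem e_pow_f_pow_eq_zero (S : Sl2Ops e f h) {v : V} {w : ℂ} (hv : h v = w • v) {k : ℕ}
    (hk : (e ^ k) v = 0) (r : ℕ) : (e ^ (k + r)) ((f ^ r) v) = 0 := by
  induction r with
  | zero => simpa using hk
  | succ r ih =>
    rw [pow_succ' f, Module.End.mul_apply, ← add_assoc, S.e_pow_succ_f (S.h_f_pow_of_weight hv r),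
      pow_succ', Module.End.mul_apply, ih]
    simp

/-- The vector f^{p+1} v has weight -(p + n + 2) and is killed by e^{p+n+2}: the boundary case of
`eq_zero_of_weight`. -/
theorem f_pow_eq_zero (S : Sl2Ops e f h) {v : V} {n p r : ℕ} (hv : h v = ((p : ℂ) - n) • v)
    (hr : (f ^ r) v = 0) (he : (e ^ (n + 1)) v = 0) : (f ^ (p + 1)) v = 0 := by
  refine S.eq_zero_of_weight (w := (p : ℤ) - n - 2 * (p + 1)) (r := r) (k := n + 1 + (p + 1)) ?_ ?_
    (S.e_pow_f_pow_eq_zero hv he (p + 1)) (by push_cast; lia)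
  · rw [S.h_f_pow_of_weight hv]
    push_cast
    rfl
  · rw [← Module.End.mul_apply, ← pow_add, add_comm, pow_add, Module.End.mul_apply, hr, map_zero]

/-- The contragredient operators. -/
theorem dual (S : Sl2Ops e f h) : Sl2Ops (-e.dualMap) (-f.dualMap) (-h.dualMap) where
  ef φ := by
    ext v
    have := congrArg φ (S.ef v)
    simp only [LinearMap.sub_apply, LinearMap.neg_apply, LinearMap.dualMap_apply, map_neg,
      map_sub, neg_neg] at this ⊢
    linear_combination -this
  he φ := by
    ext v
    have := congrArg φ (S.he v)
    simp only [LinearMap.sub_apply, LinearMap.neg_apply, LinearMap.dualMap_apply, map_neg,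
      map_sub, neg_neg, LinearMap.smul_apply, map_smul, smul_eq_mul] at this ⊢
    linear_combination -this
  hf φ := by
    ext v
    have := congrArg φ (S.hf v)
    simp only [LinearMap.sub_apply, LinearMap.neg_apply, LinearMap.dualMap_apply, map_neg,
      map_sub, neg_neg, LinearMap.smul_apply, map_smul, smul_eq_mul] at this ⊢
    linear_combination -this

end Sl2Ops

/-- The shift `g ↦ (0, g₀, g₁, …)` of sequences. -/
def seqShift (g : ℕ → V) : ℕ → V
  | 0 => 0
  | j + 1 => g j

/-- The operator `e` on `V ⊗ ℂ[s]`, with `e = d/ds` on `ℂ[s]`. -/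
def seqE (e : Module.End ℂ V) : Module.End ℂ (ℕ → V) where
  toFun g j := e (g j) + ((j : ℂ) + 1) • g (j + 1)
  map_add' g g' := by funext j; simp only [Pi.add_apply, map_add, smul_add]; abel
  map_smul' c g := by
    funext j
    simp only [Pi.smul_apply, map_smul, RingHom.id_apply, smul_add, smul_comm c]

/-- The operator `f` on `V ⊗ ℂ[s]`, with `f = p s - s² d/ds` on `ℂ[s]`. -/
def seqF (p : ℕ) (f : Module.End ℂ V) : Module.End ℂ (ℕ → V) where
  toFun g j := f (g j) + ((p : ℂ) - j + 1) • seqShift g j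
  map_add' g g' := by
    funext j
    cases j
    · simp [seqShift]
    · simp only [seqShift, Pi.add_apply, map_add, smul_add]; abel
  map_smul' c g := by
    funext j
    cases j
    · simp [seqShift]
    · simp only [seqShift, Pi.smul_apply, map_smul, RingHom.id_apply, smul_add, smul_comm c]

/-- The operator `h` on `V ⊗ ℂ[s]`, with `h = p - 2 s d/ds` on `ℂ[s]`. -/
def seqH (p : ℕ) (h : Module.End ℂ V) : Module.End ℂ (ℕ → V) where
  toFun g j := h (g j) + ((p : ℂ) - 2 * j) • g j
  map_add' g g' := by funext j; simp only [Pi.add_apply, map_add, smul_add]; abel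
  map_smul' c g := by
    funext j
    simp only [Pi.smul_apply, map_smul, RingHom.id_apply, smul_add, smul_comm c]

theorem seqE_apply (e : Module.End ℂ V) (g : ℕ → V) (j : ℕ) :
    seqE e g j = e (g j) + ((j : ℂ) + 1) • g (j + 1) := rfl

theorem seqF_apply_zero (p : ℕ) (f : Module.End ℂ V) (g : ℕ → V) : seqF p f g 0 = f (g 0) := by
  change f (g 0) + _ • (0 : V) = _
  rw [smul_zero, add_zero]

theorem seqF_apply_succ (p : ℕ) (f : Module.End ℂ V) (g : ℕ → V) (j : ℕ) :
    seqF p f g (j + 1) = f (g (j + 1)) + ((p : ℂ) - j) • g j := by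
  change f (g (j + 1)) + ((p : ℂ) - ((j + 1 : ℕ) : ℂ) + 1) • g j = _
  congr 2
  push_cast
  ring

theorem seqH_apply (p : ℕ) (h : Module.End ℂ V) (g : ℕ → V) (j : ℕ) :
    seqH p h g j = h (g j) + ((p : ℂ) - 2 * j) • g j := rfl

/-- A sequence stands for a series in s with coefficients in V. Since f sends s^p to 0, the degrees
at most p form V ⊗ V(p). The construction can be iterated, which gives V ⊗ V(n) ⊗ V(p). -/
theorem Sl2Ops.seq {e f h : Module.End ℂ V} (S : Sl2Ops e f h) (p : ℕ) :
    Sl2Ops (seqE e) (seqF p f) (seqH p h) where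
  ef g := by
    funext j
    rw [Pi.sub_apply]
    cases j with
    | zero =>
      have := S.ef (g 0)
      simp only [seqE_apply, seqF_apply_zero, seqF_apply_succ, seqH_apply, map_add, map_smul,
        ← this, Nat.cast_zero]
      module
    | succ j =>
      have := S.ef (g (j + 1))
      simp only [seqE_apply, seqF_apply_succ, seqH_apply, map_add, map_smul, ← this, Nat.cast_succ]
      module
  he g := by
    funext j
    have := S.he (g j)
    rw [sub_eq_iff_eq_add] at this
    simp only [Pi.sub_apply, Pi.smul_apply, seqE_apply, seqH_apply, map_add, map_smul, this,
      Nat.cast_succ]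
    module
  hf g := by
    funext j
    have := S.hf (g j)
    rw [sub_eq_iff_eq_add] at this
    cases j with
    | zero =>
      simp only [Pi.sub_apply, Pi.smul_apply, seqF_apply_zero, seqH_apply, map_add, map_smul, this,
        Nat.cast_zero]
      module
    | succ j =>
      simp only [Pi.sub_apply, Pi.smul_apply, seqF_apply_succ, seqH_apply, map_add, map_smul, this,
        Nat.cast_succ]
      module

theorem seqE_pow_spec (e : Module.End ℂ V) {g : ℕ → V} {s : ℕ} (hg : ∀ j, s < j → g j = 0)
    (N : ℕ) : (∀ j, s < j → (seqE e ^ N) g j = 0) ∧ (seqE e ^ N) g s = (e ^ N) (g s) := by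
  induction N with
  | zero => exact ⟨hg, rfl⟩
  | succ N ih =>
    constructor
    · intro j hj
      rw [pow_succ', Module.End.mul_apply, seqE_apply, ih.1 j hj, ih.1 (j + 1) (by lia)]
      simp
    · rw [pow_succ', Module.End.mul_apply, seqE_apply, ih.2, ih.1 (s + 1) (by lia), pow_succ',
        Module.End.mul_apply, smul_zero, add_zero]

/-- The operator does not raise the degree in s and acts on the top coefficient as e, so the
coefficients are killed from the top down. -/
theorem seqE_locallyNilpotent {e : Module.End ℂ V} (he : ∀ v, ∃ r, (e ^ r) v = 0) {g : ℕ → V}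
    {s : ℕ} (hg : ∀ j, s ≤ j → g j = 0) : ∃ r, (seqE e ^ r) g = 0 := by
  induction s generalizing g with
  | zero => exact ⟨0, funext fun j => hg j (Nat.zero_le j)⟩
  | succ s ih =>
    obtain ⟨N, hN⟩ := he (g s)
    have h1 := seqE_pow_spec e (g := g) (s := s) hg N
    obtain ⟨r, hr⟩ := ih (g := (seqE e ^ N) g) fun j hj => by
      rcases hj.eq_or_lt with rfl | hj
      · rw [h1.2, hN]
      · exact h1.1 j hj
    exact ⟨r + N, by rw [pow_add, Module.End.mul_apply, hr]⟩

theorem seqF_pow_spec {p : ℕ} {f : Module.End ℂ V} {S : Submodule ℂ V} (hS : ∀ v ∈ S, f v ∈ S)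
    {g : ℕ → V} (hgS : ∀ j, g j ∈ S) (hgp : ∀ j, p < j → g j = 0) {s : ℕ}
    (hg : ∀ j, j < s → g j = 0) (N : ℕ) :
    (∀ j, (seqF p f ^ N) g j ∈ S) ∧ (∀ j, p < j → (seqF p f ^ N) g j = 0) ∧
      (∀ j, j < s → (seqF p f ^ N) g j = 0) ∧ (seqF p f ^ N) g s = (f ^ N) (g s) := by
  induction N with
  | zero => exact ⟨hgS, hgp, hg, rfl⟩
  | succ N ih =>
    obtain ⟨h1, h2, h3, h4⟩ := ih
    rw [pow_succ', pow_succ', Module.End.mul_apply, Module.End.mul_apply]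
    refine ⟨fun j => ?_, fun j hj => ?_, fun j hj => ?_, ?_⟩
    · cases j with
      | zero => rw [seqF_apply_zero]; exact hS _ (h1 0)
      | succ j =>
        rw [seqF_apply_succ]
        exact S.add_mem (hS _ (h1 _)) (S.smul_mem _ (h1 _))
    · obtain ⟨j, rfl⟩ : ∃ k, j = k + 1 := ⟨j - 1, by lia⟩
      rw [seqF_apply_succ, h2 _ hj, map_zero, zero_add]
      rcases (Nat.lt_succ_iff.1 hj).eq_or_lt with rfl | hj
      · rw [sub_self, zero_smul]
      · rw [h2 _ hj, smul_zero]
    · cases j with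
      | zero => rw [seqF_apply_zero, h3 _ hj, map_zero]
      | succ j => rw [seqF_apply_succ, h3 _ hj, h3 j (by lia), map_zero, smul_zero, add_zero]
    · cases s with
      | zero => rw [seqF_apply_zero, h4]
      | succ s => rw [seqF_apply_succ, h4, h3 s (by lia), smul_zero, add_zero]

/-- The operator does not lower the degree and preserves degrees at most p, so the coefficients are
killed from the bottom up. The submodule S allows coefficients that are themselves sequences of
bounded degree. -/
theorem seqF_locallyNilpotent {p : ℕ} {f : Module.End ℂ V} {S : Submodule ℂ V}
    (hS : ∀ v ∈ S, f v ∈ S) (hf : ∀ v ∈ S, ∃ r, (f ^ r) v = 0) {g : ℕ → V} (hgS : ∀ j, g j ∈ S)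
    (hgp : ∀ j, p < j → g j = 0) : ∃ r, (seqF p f ^ r) g = 0 := by
  suffices h : ∀ t s, s + t = p + 1 → ∀ g : ℕ → V, (∀ j, g j ∈ S) → (∀ j, p < j → g j = 0) →
      (∀ j, j < s → g j = 0) → ∃ r, (seqF p f ^ r) g = 0 from
    h (p + 1) 0 (by lia) g hgS hgp fun j hj => absurd hj (Nat.not_lt_zero j)
  intro t
  induction t with
  | zero =>
    intro s hs g _ hgp hg
    refine ⟨0, funext fun j => ?_⟩
    by_cases hj : j < s
    · exact hg j hj
    · exact hgp j (by lia)
  | succ t ih =>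
    intro s hs g hgS hgp hg
    obtain ⟨N, hN⟩ := hf (g s) (hgS s)
    obtain ⟨h1, h2, h3, h4⟩ := seqF_pow_spec hS hgS hgp hg N
    obtain ⟨r, hr⟩ := ih (s + 1) (by lia) _ h1 h2 fun j hj => by
      rcases (Nat.lt_succ_iff.1 hj).eq_or_lt with rfl | hj
      · rw [h4, hN]
      · exact h3 j hj
    exact ⟨r + N, by rw [pow_add, Module.End.mul_apply, hr]⟩

end Sl2

/-! ### 𝔰𝔩₂-triples in an associative algebra and an invariant vector -/

section AssociativeSl2

variable {A : Type*} [Ring A] [Algebra ℂ A]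

/-- The commutator with `x`. -/
def adL (x : A) : Module.End ℂ A := LinearMap.mulLeft ℂ x - LinearMap.mulRight ℂ x

theorem adL_apply (x z : A) : adL x z = x * z - z * x := rfl

theorem adL_mul (x y z : A) : adL x (y * z) = adL x y * z + y * adL x z := by
  simp only [adL_apply]
  noncomm_ring

/-- An `𝔰𝔩₂`-triple in an associative algebra. -/
structure Sl2Elts (e f h : A) : Prop where
  ef : e * f - f * e = h
  he : h * e - e * h = (2 : ℂ) • e
  hf : h * f - f * h = (-2 : ℂ) • f

variable {e f h : A}

theorem Sl2Elts.adL (S : Sl2Elts e f h) : Sl2Ops (adL e) (adL f) (adL h) where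
  ef v := by
    rw [← S.ef]
    simp only [adL_apply]
    noncomm_ring
  he v := by
    have h1 : Biperfect.adL h (Biperfect.adL e v) - Biperfect.adL e (Biperfect.adL h v) =
        Biperfect.adL (h * e - e * h) v := by
      simp only [adL_apply]
      noncomm_ring
    rw [h1, S.he, adL_apply, adL_apply, smul_mul_assoc, mul_smul_comm, smul_sub]
  hf v := by
    have h1 : Biperfect.adL h (Biperfect.adL f v) - Biperfect.adL f (Biperfect.adL h v) =
        Biperfect.adL (h * f - f * h) v := by
      simp only [adL_apply]
      noncomm_ring
    rw [h1, S.hf, adL_apply, adL_apply, smul_mul_assoc, mul_smul_comm, smul_sub]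

theorem Sl2Ops.restrict {V : Type*} [AddCommGroup V] [Module ℂ V] {e f h : Module.End ℂ V}
    (S : Sl2Ops e f h) {M : Submodule ℂ V} (he : ∀ v ∈ M, e v ∈ M) (hf : ∀ v ∈ M, f v ∈ M)
    (hh : ∀ v ∈ M, h v ∈ M) : Sl2Ops (e.restrict he) (f.restrict hf) (h.restrict hh) where
  ef v := Subtype.ext (S.ef v)
  he v := Subtype.ext (S.he v)
  hf v := Subtype.ext (S.hf v)

theorem dualMap_pow_apply {V : Type*} [AddCommGroup V] [Module ℂ V] (f : Module.End ℂ V) (r : ℕ)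
    (φ : Module.Dual ℂ V) : (((-f.dualMap) ^ r : Module.End ℂ (Module.Dual ℂ V)) φ) =
      ((-1 : ℂ) ^ r) • φ ∘ₗ (f ^ r) := by
  induction r generalizing φ with
  | zero => simp [Module.End.one_eq_id]
  | succ r ih =>
    rw [pow_succ, Module.End.mul_apply, ih]
    ext v
    simp only [LinearMap.smul_apply, LinearMap.comp_apply, LinearMap.neg_apply,
      LinearMap.dualMap_apply, smul_eq_mul, pow_succ', Module.End.mul_apply]
    ring

theorem restrict_pow_coe {V : Type*} [AddCommGroup V] [Module ℂ V] {f : Module.End ℂ V}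
    {M : Submodule ℂ V} (hf : ∀ v ∈ M, f v ∈ M) (r : ℕ) (v : M) :
    (((f.restrict hf) ^ r) v : V) = (f ^ r) v := by
  induction r with
  | zero => rfl
  | succ r ih => rw [pow_succ', pow_succ', Module.End.mul_apply, Module.End.mul_apply, ← ih]; rfl

/-- The linear forms `z ↦ (-1)^k l(e^(j) z e^(k))`, with divided powers of `e`. -/
def coef (l : A →ₗ[ℂ] ℂ) (e : A) (j k : ℕ) : A →ₗ[ℂ] ℂ :=
  ((-1 : ℂ) ^ k * ((j.factorial : ℂ)⁻¹ * (k.factorial : ℂ)⁻¹)) •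
    (l ∘ₗ LinearMap.mulRight ℂ (e ^ k) ∘ₗ LinearMap.mulLeft ℂ (e ^ j))

theorem coef_apply (l : A →ₗ[ℂ] ℂ) (e : A) (j k : ℕ) (z : A) :
    coef l e j k z = ((-1 : ℂ) ^ k * ((j.factorial : ℂ)⁻¹ * (k.factorial : ℂ)⁻¹)) *
      l (e ^ j * z * e ^ k) := rfl

/-- The sign and the divided powers in `coef` are chosen so that this identity says that the family
of the `coef l e j k`, seen as coefficients of s^j t^k, is killed by e acting through the dual of ad
e and through ∂/∂s + ∂/∂t. -/
theorem coef_adL_e (l : A →ₗ[ℂ] ℂ) (e : A) (j k : ℕ) (z : A) :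
    coef l e j k (adL e z) = ((k : ℂ) + 1) * coef l e j (k + 1) z +
      ((j : ℂ) + 1) * coef l e (j + 1) k z := by
  have h1 : e ^ j * adL e z * e ^ k = e ^ (j + 1) * z * e ^ k - e ^ j * z * e ^ (k + 1) := by
    rw [adL_apply, pow_succ, pow_succ']
    noncomm_ring
  rw [coef_apply, coef_apply, coef_apply, h1, map_sub, Nat.factorial_succ, Nat.factorial_succ]
  have hj : (j.factorial : ℂ) ≠ 0 := by exact_mod_cast j.factorial_ne_zero
  have hk : (k.factorial : ℂ) ≠ 0 := by exact_mod_cast k.factorial_ne_zero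
  have hj' : (j : ℂ) + 1 ≠ 0 := by exact_mod_cast j.succ_ne_zero
  have hk' : (k : ℂ) + 1 ≠ 0 := by exact_mod_cast k.succ_ne_zero
  push_cast
  field_simp
  ring

theorem Sl2Elts.adL_h_pow (S : Sl2Elts e f h) (k : ℕ) :
    Biperfect.adL h (e ^ k) = (2 * k : ℂ) • e ^ k := by
  induction k with
  | zero => simp [adL_apply]
  | succ k ih =>
    rw [pow_succ, adL_mul, ih, adL_apply, S.he, smul_mul_assoc, mul_smul_comm, ← add_smul]
    congr 1
    push_cast
    ring

theorem Sl2Elts.coef_adL_h (S : Sl2Elts e f h) {l : A →ₗ[ℂ] ℂ} {m : ℂ} {j k : ℕ} {z : A}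
    (hl : l (Biperfect.adL h (e ^ j * z * e ^ k)) = m * l (e ^ j * z * e ^ k)) :
    coef l e j k (Biperfect.adL h z) = (m - 2 * j - 2 * k) * coef l e j k z := by
  have h1 : Biperfect.adL h (e ^ j * z * e ^ k) =
      e ^ j * Biperfect.adL h z * e ^ k + (2 * j + 2 * k : ℂ) • (e ^ j * z * e ^ k) := by
    rw [adL_mul, adL_mul, S.adL_h_pow, S.adL_h_pow]
    simp only [smul_mul_assoc, mul_smul_comm, add_mul, add_smul]
    abel
  rw [h1, map_add, map_smul, smul_eq_mul] at hl
  rw [coef_apply, coef_apply]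
  linear_combination ((-1 : ℂ) ^ k * ((j.factorial : ℂ)⁻¹ * (k.factorial : ℂ)⁻¹)) * hl

/-- A submodule stable under the commutators with `e`, `f`, `h`, and killed by a power of the
commutators with `e` and `f`. -/
structure IsAdStable (e f h : A) (M : Submodule ℂ A) : Prop where
  e_mem : ∀ z ∈ M, Biperfect.adL e z ∈ M
  f_mem : ∀ z ∈ M, Biperfect.adL f z ∈ M
  h_mem : ∀ z ∈ M, Biperfect.adL h z ∈ M
  e_nilpotent : ∃ r, ∀ z ∈ M, (Biperfect.adL e ^ r) z = 0
  f_nilpotent : ∃ r, ∀ z ∈ M, (Biperfect.adL f ^ r) z = 0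

theorem dual_restrict_locallyNilpotent {V : Type*} [AddCommGroup V] [Module ℂ V]
    {f : Module.End ℂ V} {M : Submodule ℂ V} (hf : ∀ v ∈ M, f v ∈ M)
    (hr : ∃ r, ∀ v ∈ M, (f ^ r) v = 0) :
    ∃ r, ∀ φ : Module.Dual ℂ M, ((-(f.restrict hf).dualMap) ^ r :
      Module.End ℂ (Module.Dual ℂ M)) φ = 0 := by
  obtain ⟨r, hr⟩ := hr
  refine ⟨r, fun φ => ?_⟩
  rw [dualMap_pow_apply]
  ext v
  have h1 : ((f.restrict hf) ^ r) v = 0 := Subtype.ext (by rw [restrict_pow_coe]; exact hr v v.2)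
  simp [h1]

/-- The forms `coef l e j k` on M are the coefficients of a vector Φ in the dual of M tensored with
V(p) and V(n). It is killed by e and has weight 0, so f Φ has weight -2 and is still killed by e; as
f is nilpotent on Φ, f Φ = 0. The claim is f Φ = 0 read coefficientwise. -/
theorem IsAdStable.coef_adL_f (S : Sl2Elts e f h) {M : Submodule ℂ A} (hM : IsAdStable e f h M)
    {l : A →ₗ[ℂ] ℂ} {p n : ℕ}
    (h0 : ∀ z ∈ M, ∀ j k, (p < j ∨ n < k) → l (e ^ j * z * e ^ k) = 0)
    (hw : ∀ z ∈ M, ∀ j k, l (Biperfect.adL h (e ^ j * z * e ^ k)) =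
      ((p : ℂ) + n) * l (e ^ j * z * e ^ k)) {z : A} (hz : z ∈ M) (j k : ℕ) :
    coef l e j k (Biperfect.adL f z) =
      ((p : ℂ) - j + 1) * seqShift (fun j => coef l e j k z) j +
        ((n : ℂ) - k + 1) * seqShift (fun k => coef l e j k z) k := by
  have S0 := (S.adL.restrict hM.e_mem hM.f_mem hM.h_mem).dual
  have S2 := (S0.seq n).seq p
  let Φ : ℕ → ℕ → Module.Dual ℂ M := fun j k => (coef l e j k) ∘ₗ M.subtype
  have hΦ : ∀ j k (z : M), Φ j k z = coef l e j k z := fun _ _ _ => rfl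
  set E := seqE (seqE (-((Biperfect.adL e).restrict hM.e_mem).dualMap)) with hE
  set F := seqF p (seqF n (-((Biperfect.adL f).restrict hM.f_mem).dualMap)) with hF
  set H := seqH p (seqH n (-((Biperfect.adL h).restrict hM.h_mem).dualMap)) with hH
  have eΦ : E Φ = 0 := by
    funext j k
    ext z
    have := coef_adL_e l e j k (z : A)
    simp only [hE, seqE_apply, Pi.add_apply, Pi.smul_apply, LinearMap.add_apply,
      LinearMap.smul_apply, LinearMap.neg_apply, LinearMap.dualMap_apply, hΦ, smul_eq_mul,
      LinearMap.coe_restrict_apply, Pi.zero_apply, LinearMap.zero_apply, this]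
    ring
  have hΦ0 : H Φ = 0 := by
    funext j k
    ext z
    have := S.coef_adL_h (hw z z.2 j k)
    simp only [hH, seqH_apply, Pi.add_apply, Pi.smul_apply, LinearMap.add_apply,
      LinearMap.smul_apply, LinearMap.neg_apply, LinearMap.dualMap_apply, hΦ, smul_eq_mul,
      LinearMap.coe_restrict_apply, Pi.zero_apply, LinearMap.zero_apply, this]
    ring
  obtain ⟨r₀, hr₀⟩ := dual_restrict_locallyNilpotent hM.f_mem hM.f_nilpotent
  -- Inner sequences of degree at most n, on which the inner f is locally nilpotent.
  let T : Submodule ℂ (ℕ → Module.Dual ℂ M) :=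
    { carrier := {g | ∀ k, n < k → g k = 0}
      add_mem' := fun {a b} ha hb k hk => by rw [Pi.add_apply, ha k hk, hb k hk, add_zero]
      zero_mem' := fun k _ => rfl
      smul_mem' := fun c a ha k hk => by rw [Pi.smul_apply, ha k hk, smul_zero] }
  have hTf : ∀ v ∈ T, seqF n (-((Biperfect.adL f).restrict hM.f_mem).dualMap) v ∈ T := by
    intro v hv
    have := (seqF_pow_spec (p := n) (S := ⊤) (s := 0)
      (f := -((Biperfect.adL f).restrict hM.f_mem).dualMap)
      (fun _ _ => Submodule.mem_top) (g := v) (fun _ => Submodule.mem_top) hv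
      (fun j hj => absurd hj (Nat.not_lt_zero j)) 1).2.1
    rwa [pow_one] at this
  have hΦT : ∀ j, Φ j ∈ T := fun j k hk => by
    ext z
    rw [hΦ, coef_apply, h0 z z.2 j k (Or.inr hk), mul_zero, LinearMap.zero_apply]
  have hΦp : ∀ j, p < j → Φ j = 0 := fun j hj => by
    funext k
    ext z
    rw [hΦ, coef_apply, h0 z z.2 j k (Or.inl hj), mul_zero]
    rfl
  obtain ⟨r, hr⟩ := seqF_locallyNilpotent (p := p) hTf (fun v hv =>
    seqF_locallyNilpotent (S := ⊤) (fun _ _ => Submodule.mem_top) (fun φ _ => ⟨r₀, hr₀ φ⟩)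
      (fun _ => Submodule.mem_top) hv) hΦT hΦp
  have fΦ : F Φ = 0 := by
    refine S2.eq_zero_of_weight (w := -2) (r := r) (k := 1) ?_ ?_ ?_ (by lia)
    · have := S2.h_f_of_weight (v := Φ) (w := 0) (by rw [hΦ0, zero_smul])
      rw [this]
      norm_num
    · rw [← hF] at hr
      rw [← Module.End.mul_apply, ← pow_succ, pow_succ', Module.End.mul_apply, hr, map_zero]
    -- The relation e f Φ - f e Φ = h Φ has e Φ = 0 and h Φ = 0.
    · have := S2.ef Φ
      rw [eΦ, hΦ0, map_zero, sub_zero] at this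
      rw [pow_one]
      exact this
  have h1 : F Φ j k ⟨z, hz⟩ = (0 : ℕ → ℕ → Module.Dual ℂ M) j k ⟨z, hz⟩ := by rw [fΦ]
  have hcalc : F Φ j k ⟨z, hz⟩ = -coef l e j k (Biperfect.adL f z) +
      ((n : ℂ) - k + 1) * seqShift (fun k => coef l e j k z) k +
      ((p : ℂ) - j + 1) * seqShift (fun j => coef l e j k z) j := by
    cases j with
    | zero =>
      cases k with
      | zero =>
        simp only [hF, seqF_apply_zero, seqShift, mul_zero, add_zero, LinearMap.neg_apply]
        rfl
      | succ k =>
        simp only [hF, seqF_apply_zero, seqF_apply_succ, seqShift, mul_zero, add_zero]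
        simp only [LinearMap.add_apply, LinearMap.neg_apply, LinearMap.smul_apply, hΦ,
          LinearMap.dualMap_apply, LinearMap.coe_restrict_apply, smul_eq_mul, Nat.cast_succ]
        ring
    | succ j =>
      cases k with
      | zero =>
        simp only [hF, seqF_apply_succ, Pi.add_apply, seqF_apply_zero, seqShift, mul_zero, add_zero]
        simp only [LinearMap.add_apply, LinearMap.neg_apply, Pi.smul_apply, LinearMap.smul_apply,
          hΦ, LinearMap.dualMap_apply, LinearMap.coe_restrict_apply, smul_eq_mul, Nat.cast_succ]
        ring
      | succ k =>
        simp only [hF, seqF_apply_succ, Pi.add_apply, seqShift]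
        simp only [LinearMap.add_apply, LinearMap.neg_apply, Pi.smul_apply, LinearMap.smul_apply,
          hΦ, LinearMap.dualMap_apply, LinearMap.coe_restrict_apply, smul_eq_mul, Nat.cast_succ]
        ring
  rw [hcalc, Pi.zero_apply, Pi.zero_apply, LinearMap.zero_apply] at h1
  linear_combination -h1

end AssociativeSl2

/-! ### Binomial sums for truncated exponentials -/

section ExpSums

open Finset

theorem sum_antidiagonal_regroup {E : Type*} [AddCommMonoid E] (F : ℕ → ℕ → E) {A B N : ℕ} (hN : A + B < N)
    (hA : ∀ a l, A < a → F a l = 0) (hB : ∀ a l, B < l → F a l = 0) :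
    ∑ r ∈ range N, ∑ x ∈ antidiagonal r, F x.1 x.2 =
      ∑ a ∈ range (A + 1), ∑ l ∈ range (B + 1), F a l := by
  rw [← Finset.sum_product', ← Finset.sum_fiberwise_of_maps_to (t := range N)
    (g := fun x : ℕ × ℕ => x.1 + x.2)]
  · refine Finset.sum_congr rfl fun r _ => ?_
    symm
    refine Finset.sum_subset (fun x hx => ?_) fun x hx hx' => ?_
    · exact mem_antidiagonal.2 (mem_filter.1 hx).2
    · by_cases h1 : A < x.1
      · exact hA _ _ h1
      · refine hB _ _ ?_
        by_contra h2
        refine hx' (mem_filter.2 ⟨mem_product.2 ⟨mem_range.2 ?_, mem_range.2 ?_⟩,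
          mem_antidiagonal.1 hx⟩) <;> lia
  · intro x hx
    rw [mem_product, mem_range, mem_range] at hx
    rw [mem_range]
    lia

/-- Collected along r = m + l, the coefficient of G(r) is (1 - 1)^r. This is exp(x) exp(-x) = 1 in
coordinates. -/
theorem alternating_sum_choose_mul (G : ℕ → ℂ) {K A B : ℕ} (hG : ∀ r, K < r → G r = 0)
    (hA : K ≤ A) (hB : K ≤ B) :
    ∑ m ∈ range (A + 1), ∑ l ∈ range (B + 1), (-1 : ℂ) ^ l * ((m + l).choose l : ℂ) * G (m + l) =
      G 0 := by
  rw [← sum_antidiagonal_regroup (fun m l => (-1 : ℂ) ^ l * ((m + l).choose l : ℂ) * G (m + l))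
    (N := A + B + 1) (by lia) (fun a l ha => by rw [hG _ (by lia), mul_zero])
    (fun a l ha => by rw [hG _ (by lia), mul_zero])]
  have h1 : ∀ r, ∑ x ∈ antidiagonal r, (-1 : ℂ) ^ x.2 * ((x.1 + x.2).choose x.2 : ℂ) *
      G (x.1 + x.2) = (0 : ℂ) ^ r * G r := by
    intro r
    have h2 : (0 : ℂ) ^ r = (-1 + 1) ^ r := by norm_num
    rw [h2, add_pow, sum_mul, ← Finset.Nat.sum_antidiagonal_swap,
      Finset.Nat.sum_antidiagonal_eq_sum_range_succ_mk]
    refine sum_congr rfl fun k hk => ?_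
    rw [mem_range] at hk
    simp only [Prod.swap, one_pow, mul_one]
    rw [Nat.sub_add_cancel (by lia)]
  simp only [h1]
  rw [Finset.sum_range_succ']
  simp

variable {A : Type*} [AddCommGroup A] [Module ℂ A]

/-- The factor r! · C(k + r, r) is (k + 1)⋯(k + r), accumulated by r successive shifts. -/
theorem apply_pow_of_shift {a : ℕ → A →ₗ[ℂ] ℂ} {X : Module.End ℂ A} {M : Submodule ℂ A}
    (hX : ∀ z ∈ M, X z ∈ M) (ha : ∀ k, ∀ z ∈ M, a k (X z) = ((k : ℂ) + 1) * a (k + 1) z) (r k : ℕ)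
    {z : A} (hz : z ∈ M) :
    a k ((X ^ r) z) = r.factorial * ((k + r).choose r : ℂ) * a (k + r) z := by
  induction r generalizing k z with
  | zero => simp
  | succ r ih =>
    rw [pow_succ, Module.End.mul_apply, ih k (hX z hz), ha _ z hz]
    have h1 := Nat.add_one_mul_choose_eq (k + r) r
    have h2 : ((k : ℂ) + r + 1) * ((k + r).choose r : ℂ) =
        ((k + r + 1).choose (r + 1) : ℂ) * ((r : ℂ) + 1) := by exact_mod_cast h1
    rw [Nat.factorial_succ, ← add_assoc]
    push_cast
    linear_combination (r.factorial : ℂ) * a (k + r + 1) z * h2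

/-- The operator is a sum of two commuting shifts, one in each index; this is the binomial expansion
of its r-th power, with divided powers. -/
theorem apply_pow_of_double_shift {g : ℕ → ℕ → A →ₗ[ℂ] ℂ} {X : Module.End ℂ A} {M : Submodule ℂ A}
    (hX : ∀ z ∈ M, X z ∈ M) (hg : ∀ i m, ∀ z ∈ M, g i m (X z) =
      ((m : ℂ) + 1) * g i (m + 1) z + ((i : ℂ) + 1) * g (i + 1) m z) (r i m : ℕ)
    {z : A} (hz : z ∈ M) :
    g i m ((X ^ r) z) = r.factorial * ∑ x ∈ antidiagonal r,
      ((i + x.1).choose x.1 : ℂ) * ((m + x.2).choose x.2 : ℂ) * g (i + x.1) (m + x.2) z := by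
  induction r generalizing z with
  | zero => simp
  | succ r ih =>
    rw [pow_succ, Module.End.mul_apply, ih (hX z hz), Nat.factorial_succ]
    push_cast
    -- Writing r + 1 as the sum of the two parts splits the sum; in each half the term with zero
    -- factor drops and the rest is reindexed over the antidiagonal of r.
    have h1 : ((r : ℂ) + 1) * ∑ x ∈ antidiagonal (r + 1), ((i + x.1).choose x.1 : ℂ) *
        ((m + x.2).choose x.2 : ℂ) * g (i + x.1) (m + x.2) z =
        ∑ x ∈ antidiagonal (r + 1), (x.1 : ℂ) * (((i + x.1).choose x.1 : ℂ) *
        ((m + x.2).choose x.2 : ℂ) * g (i + x.1) (m + x.2) z) +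
        ∑ x ∈ antidiagonal (r + 1), (x.2 : ℂ) * (((i + x.1).choose x.1 : ℂ) *
        ((m + x.2).choose x.2 : ℂ) * g (i + x.1) (m + x.2) z) := by
      rw [mul_sum, ← sum_add_distrib]
      refine sum_congr rfl fun x hx => ?_
      rw [HasAntidiagonal.mem_antidiagonal] at hx
      have h2 : (r : ℂ) + 1 = x.1 + x.2 := by exact_mod_cast hx.symm
      rw [h2, add_mul]
    rw [mul_comm ((r : ℂ) + 1) (r.factorial : ℂ), mul_assoc, h1, Finset.Nat.sum_antidiagonal_succ,
      Finset.Nat.sum_antidiagonal_succ']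
    simp only [Nat.cast_zero, zero_mul, zero_add, add_zero]
    rw [← sum_add_distrib]
    congr 1
    refine sum_congr rfl fun x _ => ?_
    rw [hg _ _ z hz]
    have h2 : ((i : ℂ) + x.1 + 1) * ((i + x.1).choose x.1 : ℂ) =
        ((i + x.1 + 1).choose (x.1 + 1) : ℂ) * ((x.1 : ℂ) + 1) := by
      exact_mod_cast Nat.add_one_mul_choose_eq (i + x.1) x.1
    have h3 : ((m : ℂ) + x.2 + 1) * ((m + x.2).choose x.2 : ℂ) =
        ((m + x.2 + 1).choose (x.2 + 1) : ℂ) * ((x.2 : ℂ) + 1) := by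
      exact_mod_cast Nat.add_one_mul_choose_eq (m + x.2) x.2
    push_cast
    rw [← add_assoc, ← add_assoc]
    linear_combination ((i + x.1).choose x.1 : ℂ) * g (i + x.1) (m + x.2 + 1) z * h3 +
      ((m + x.2).choose x.2 : ℂ) * g (i + x.1 + 1) (m + x.2) z * h2

end ExpSums

/-! ### Action of exp(-e) exp(f) exp(-e) on the invariant vector -/

section Exponential

open Finset

variable {A : Type*} [Ring A] [Algebra ℂ A]

/-- The truncated exponential series of the commutator with `x`. -/
def expSum (x : A) (N : ℕ) (z : A) : A := ∑ r ∈ range N, (r.factorial : ℂ)⁻¹ • (adL x ^ r) z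

theorem pow_mem_of_stable {V : Type*} [AddCommGroup V] [Module ℂ V] {X : Module.End ℂ V}
    {M : Submodule ℂ V} (hX : ∀ z ∈ M, X z ∈ M) (r : ℕ) {z : V} (hz : z ∈ M) : (X ^ r) z ∈ M := by
  induction r with
  | zero => exact hz
  | succ r ih => rw [pow_succ', Module.End.mul_apply]; exact hX _ ih

theorem expSum_mem {x : A} {M : Submodule ℂ A} (hx : ∀ z ∈ M, adL x z ∈ M) (N : ℕ) {z : A}
    (hz : z ∈ M) : expSum x N z ∈ M :=
  Submodule.sum_mem _ fun r _ => Submodule.smul_mem _ _ (pow_mem_of_stable hx r hz)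

theorem adL_neg (x : A) : adL (-x) = -adL x := by
  ext z
  simp only [adL_apply, LinearMap.neg_apply]
  noncomm_ring

theorem apply_expSum_neg (φ : A →ₗ[ℂ] ℂ) (x : A) (N : ℕ) (z : A) :
    φ (expSum (-x) N z) =
      ∑ r ∈ range N, (-1 : ℂ) ^ r * ((r.factorial : ℂ)⁻¹ * φ ((adL x ^ r) z)) := by
  rw [expSum, map_sum]
  refine sum_congr rfl fun r _ => ?_
  rw [map_smul, adL_neg, neg_pow, smul_eq_mul]
  have h : ((-1 : Module.End ℂ A) ^ r * adL x ^ r) z = (-1 : ℂ) ^ r • (adL x ^ r) z := by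
    rcases Nat.even_or_odd r with hr | hr
    · rw [hr.neg_one_pow, hr.neg_one_pow, one_mul, one_smul]
    · rw [hr.neg_one_pow, hr.neg_one_pow, neg_one_mul, LinearMap.neg_apply, neg_one_smul]
  rw [h, map_smul, smul_eq_mul]
  ring

/-- Because the vector of coefficients is invariant, each exponential of a commutator turns into
shifts of the indices (j, k). The three exponentials carry the corner (p, 0) to the corner (0, n),
as the Weyl group element does on V(p) ⊗ V(n). The bound on N makes the truncated sums long enough
to contain every nonzero term. -/
theorem IsAdStable.apply_exp_exp_exp {e f h : A} (S : Sl2Elts e f h) {M : Submodule ℂ A}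
    (hM : IsAdStable e f h M) {l : A →ₗ[ℂ] ℂ} {p n : ℕ}
    (h0 : ∀ z ∈ M, ∀ j k, (p < j ∨ n < k) → l (e ^ j * z * e ^ k) = 0)
    (hw : ∀ z ∈ M, ∀ j k, l (adL h (e ^ j * z * e ^ k)) =
      ((p : ℂ) + n) * l (e ^ j * z * e ^ k)) {z : A} (hz : z ∈ M) {N : ℕ} (hN : p + n < N) :
    (p.factorial : ℂ)⁻¹ * l (e ^ p * expSum (-e) N (expSum f N (expSum (-e) N z))) =
      (n.factorial : ℂ)⁻¹ * l (z * e ^ n) := by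
  have hc0 : ∀ z ∈ M, ∀ j k, (p < j ∨ n < k) → coef l e j k z = 0 := fun z hz j k hjk => by
    rw [coef_apply, h0 z hz j k hjk, mul_zero]
  have hneg : ∀ z ∈ M, adL (-e) z ∈ M := fun z hz => by
    rw [adL_neg]; exact M.neg_mem (hM.e_mem z hz)
  set z₁ := expSum (-e) N z with hz₁
  have hz₁M : z₁ ∈ M := expSum_mem hneg N hz
  set z₂ := expSum f N z₁ with hz₂
  have hz₂M : z₂ ∈ M := expSum_mem hM.f_mem N hz₁M
  -- The first index is already maximal, so ad e raises only the second.
  have step1 : coef l e p 0 (expSum (-e) N z₂) =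
      ∑ k ∈ range (n + 1), (-1 : ℂ) ^ k * coef l e p k z₂ := by
    rw [apply_expSum_neg]
    have ha : ∀ k, ∀ z ∈ M, coef l e p k (adL e z) = ((k : ℂ) + 1) * coef l e p (k + 1) z :=
      fun k z hz => by
        rw [coef_adL_e, hc0 z hz (p + 1) k (Or.inl p.lt_succ_self), mul_zero, add_zero]
    symm
    refine (sum_subset (range_mono (by lia)) fun k _ hk => ?_).trans (sum_congr rfl fun r _ => ?_)
    · rw [mem_range] at hk
      rw [hc0 z₂ hz₂M p k (Or.inr (by lia)), mul_zero]
    · have hr : (r.factorial : ℂ) ≠ 0 := by exact_mod_cast r.factorial_ne_zero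
      rw [apply_pow_of_shift hM.e_mem ha r 0 hz₂M, zero_add, Nat.choose_self, Nat.cast_one, mul_one,
        ← mul_assoc (r.factorial : ℂ)⁻¹, inv_mul_cancel₀ hr, one_mul]
  -- The second index is already maximal, so ad e raises only the first, and the sum over j undoes
  -- the alternating exponential.
  have step3 : ∑ j ∈ range (p + 1), coef l e j n z₁ = coef l e 0 n z := by
    have ha : ∀ k, ∀ z ∈ M, coef l e k n (adL e z) = ((k : ℂ) + 1) * coef l e (k + 1) n z :=
      fun k z hz => by
        rw [coef_adL_e, hc0 z hz k (n + 1) (Or.inr n.lt_succ_self), mul_zero, zero_add]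
    rw [← alternating_sum_choose_mul (fun k => coef l e k n z) (K := p) (A := p) (B := N - 1)
      (fun r hr => hc0 z hz r n (Or.inl hr)) le_rfl (by lia)]
    refine sum_congr rfl fun j _ => ?_
    rw [hz₁, apply_expSum_neg, Nat.sub_add_cancel (by lia)]
    refine sum_congr rfl fun r _ => ?_
    have hr : (r.factorial : ℂ) ≠ 0 := by exact_mod_cast r.factorial_ne_zero
    rw [apply_pow_of_shift (a := fun k => coef l e k n) hM.e_mem ha r j hz]
    field_simp
  -- In the reversed indices ad f is a double shift of the same shape as ad e. The guard is needed
  -- because p - i and n - m are truncated.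
  let g : ℕ → ℕ → A →ₗ[ℂ] ℂ := fun i m =>
    if i ≤ p ∧ m ≤ n then coef l e (p - i) (n - m) else 0
  have hgp : ∀ i m z, p < i → g i m z = 0 := fun i m z hi => by
    simp only [g]; rw [if_neg (by lia)]; rfl
  have hgn : ∀ i m z, n < m → g i m z = 0 := fun i m z hi => by
    simp only [g]; rw [if_neg (by lia)]; rfl
  have hg : ∀ i m, ∀ z ∈ M, g i m (adL f z) =
      ((m : ℂ) + 1) * g i (m + 1) z + ((i : ℂ) + 1) * g (i + 1) m z := by
    intro i m z hz
    by_cases hi : p < i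
    · rw [hgp i _ _ hi, hgp i _ _ hi, hgp (i + 1) _ _ (by lia), mul_zero, mul_zero, add_zero]
    by_cases hm : n < m
    · rw [hgn _ m _ hm, hgn _ (m + 1) _ (by lia), hgn _ m _ hm, mul_zero, mul_zero, add_zero]
    have e1 : g i m = coef l e (p - i) (n - m) := if_pos (by lia)
    have e2 : seqShift (fun j => coef l e j (n - m) z) (p - i) = g (i + 1) m z := by
      by_cases hip : i = p
      · rw [hip, Nat.sub_self, hgp _ _ _ p.lt_succ_self]; rfl
      · obtain ⟨q, hq⟩ : ∃ q, p - i = q + 1 := ⟨p - i - 1, by lia⟩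
        have : g (i + 1) m = coef l e (p - (i + 1)) (n - m) := if_pos (by lia)
        rw [this, hq, show p - (i + 1) = q by lia]
        rfl
    have e3 : seqShift (fun k => coef l e (p - i) k z) (n - m) = g i (m + 1) z := by
      by_cases hmn : m = n
      · rw [hmn, Nat.sub_self, hgn _ _ _ n.lt_succ_self]; rfl
      · obtain ⟨q, hq⟩ : ∃ q, n - m = q + 1 := ⟨n - m - 1, by lia⟩
        have : g i (m + 1) = coef l e (p - i) (n - (m + 1)) := if_pos (by lia)
        rw [this, hq, show n - (m + 1) = q by lia]
        rfl
    rw [e1, hM.coef_adL_f S h0 hw hz, e2, e3, Nat.cast_sub (by lia), Nat.cast_sub (by lia)]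
    ring
  -- The alternating sum over m cancels the part of exp(f) that acts on the second index; the part
  -- on the first index remains as a plain sum.
  have step2 : ∑ m ∈ range (n + 1), (-1 : ℂ) ^ m * g 0 m z₂ = ∑ i ∈ range (p + 1), g i 0 z₁ := by
    have h1 : ∀ m, g 0 m z₂ = ∑ i ∈ range (p + 1), ∑ l ∈ range (n + 1),
        ((m + l).choose l : ℂ) * g i (m + l) z₁ := by
      intro m
      rw [← sum_antidiagonal_regroup (fun i l => ((m + l).choose l : ℂ) * g i (m + l) z₁) hN
        (fun a l ha => by rw [hgp _ _ _ ha, mul_zero])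
        (fun a l ha => by rw [hgn _ _ _ (by lia), mul_zero]), hz₂, expSum, map_sum]
      refine sum_congr rfl fun r _ => ?_
      have hr : (r.factorial : ℂ) ≠ 0 := by exact_mod_cast r.factorial_ne_zero
      rw [map_smul, apply_pow_of_double_shift hM.f_mem hg r 0 m hz₁M, smul_eq_mul, ← mul_assoc,
        inv_mul_cancel₀ hr, one_mul]
      refine sum_congr rfl fun x _ => ?_
      rw [zero_add, Nat.choose_self, Nat.cast_one, one_mul]
    simp only [h1, mul_sum]
    rw [sum_comm]
    refine sum_congr rfl fun i _ => ?_
    rw [sum_comm, ← alternating_sum_choose_mul (fun m => g i m z₁) (K := n) (A := n) (B := n)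
      (fun r hr => hgn _ _ _ hr) le_rfl le_rfl]
    refine sum_congr rfl fun a _ => sum_congr rfl fun m _ => ?_
    rw [add_comm m a, ← mul_assoc, ← Nat.choose_symm_add]
  -- Reversing the second index costs (-1)^n, which cancels at the end against the sign in `coef l e
  -- 0 n`.
  have hL : ∑ k ∈ range (n + 1), (-1 : ℂ) ^ k * coef l e p k z₂ =
      (-1 : ℂ) ^ n * ∑ m ∈ range (n + 1), (-1 : ℂ) ^ m * g 0 m z₂ := by
    rw [← Finset.sum_range_reflect, mul_sum]
    refine sum_congr rfl fun m hm => ?_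
    rw [mem_range] at hm
    have e1 : g 0 m = coef l e p (n - m) := if_pos (by lia)
    rw [e1, show n + 1 - 1 - m = n - m by lia, ← mul_assoc, ← pow_add]
    congr 1
    rw [show n + m = (n - m) + 2 * m by lia, pow_add, pow_mul, neg_one_sq, one_pow, mul_one]
  have hR : ∑ i ∈ range (p + 1), g i 0 z₁ = ∑ j ∈ range (p + 1), coef l e j n z₁ := by
    rw [← Finset.sum_range_reflect]
    refine sum_congr rfl fun m hm => ?_
    rw [mem_range] at hm
    have e1 : g (p + 1 - 1 - m) 0 = coef l e (p - (p + 1 - 1 - m)) (n - 0) := if_pos (by lia)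
    rw [e1, show p - (p + 1 - 1 - m) = m by lia, Nat.sub_zero]
  rw [hL, step2, hR, step3, coef_apply, coef_apply] at step1
  simp only [pow_zero, Nat.factorial_zero, Nat.cast_one, inv_one, mul_one, one_mul] at step1
  rw [step1, ← mul_assoc, ← mul_assoc, ← pow_add, ← two_mul, pow_mul, neg_one_sq, one_pow, one_mul]

end Exponential

/-! ### Exponentials of nilpotent elements in U(𝔤) -/

section EnvelopingSl2

open Finset

variable {A : Type*} [Ring A] [Algebra ℂ A]

theorem adL_pow_mul_eq_zero (x : A) {a b : ℕ} {y z : A} (hy : (adL x ^ a) y = 0)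
    (hz : (adL x ^ b) z = 0) : (adL x ^ (a + b)) (y * z) = 0 := by
  induction hn : a + b generalizing a b y z with
  | zero =>
    obtain rfl : a = 0 := by lia
    have : y = 0 := hy
    rw [this, zero_mul, map_zero]
  | succ n ih =>
    cases a with
    | zero =>
      have : y = 0 := hy
      rw [this, zero_mul, map_zero]
    | succ a =>
      cases b with
      | zero =>
        have : z = 0 := hz
        rw [this, mul_zero, map_zero]
      | succ b =>
        rw [pow_succ, Module.End.mul_apply, adL_mul, map_add,
          ih (a := a) (b := b + 1) (by rwa [pow_succ, Module.End.mul_apply] at hy) hz (by lia),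
          ih (a := a + 1) (b := b) hy (by rwa [pow_succ, Module.End.mul_apply] at hz) (by lia),
          add_zero]

theorem adL_pow_mul (x : A) (r : ℕ) (y z : A) :
    (r.factorial : ℂ)⁻¹ • (adL x ^ r) (y * z) = ∑ ab ∈ antidiagonal r,
      ((ab.1.factorial : ℂ)⁻¹ • (adL x ^ ab.1) y) *
        ((ab.2.factorial : ℂ)⁻¹ • (adL x ^ ab.2) z) := by
  induction r generalizing y z with
  | zero => simp
  | succ r ih =>
    have hsucc : ∀ (k : ℕ) (u : A), (k.factorial : ℂ)⁻¹ • (adL x ^ k) (adL x u) =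
        ((k : ℂ) + 1) • (((k + 1).factorial : ℂ)⁻¹ • (adL x ^ (k + 1)) u) := by
      intro k u
      have hk : (k : ℂ) + 1 ≠ 0 := by exact_mod_cast k.succ_ne_zero
      rw [pow_succ, Module.End.mul_apply, smul_smul, Nat.factorial_succ]
      congr 1
      push_cast
      rw [mul_inv, mul_inv_cancel_left₀ hk]
    have hr : (r : ℂ) + 1 ≠ 0 := by exact_mod_cast r.succ_ne_zero
    have key : ((r : ℂ) + 1) • (((r + 1).factorial : ℂ)⁻¹ • (adL x ^ (r + 1)) (y * z)) =
        ((r : ℂ) + 1) • ∑ ab ∈ antidiagonal (r + 1),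
          ((ab.1.factorial : ℂ)⁻¹ • (adL x ^ ab.1) y) *
            ((ab.2.factorial : ℂ)⁻¹ • (adL x ^ ab.2) z) := by
      rw [← hsucc, adL_mul, map_add, smul_add, ih, ih]
      have h1 : ((r : ℂ) + 1) • ∑ ab ∈ antidiagonal (r + 1),
          ((ab.1.factorial : ℂ)⁻¹ • (adL x ^ ab.1) y) *
            ((ab.2.factorial : ℂ)⁻¹ • (adL x ^ ab.2) z) =
          ∑ ab ∈ antidiagonal (r + 1), (ab.1 : ℂ) •
            (((ab.1.factorial : ℂ)⁻¹ • (adL x ^ ab.1) y) *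
            ((ab.2.factorial : ℂ)⁻¹ • (adL x ^ ab.2) z)) +
          ∑ ab ∈ antidiagonal (r + 1), (ab.2 : ℂ) •
            (((ab.1.factorial : ℂ)⁻¹ • (adL x ^ ab.1) y) *
            ((ab.2.factorial : ℂ)⁻¹ • (adL x ^ ab.2) z)) := by
        rw [smul_sum, ← sum_add_distrib]
        refine sum_congr rfl fun ab hab => ?_
        rw [HasAntidiagonal.mem_antidiagonal] at hab
        have h2 : (r : ℂ) + 1 = ab.1 + ab.2 := by exact_mod_cast hab.symm
        rw [h2, add_smul]
      rw [h1, Finset.Nat.sum_antidiagonal_succ, Finset.Nat.sum_antidiagonal_succ']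
      simp only [Nat.cast_zero, zero_smul, zero_add]
      congr 1
      · refine sum_congr rfl fun ab _ => ?_
        rw [hsucc, smul_mul_assoc]
        push_cast
        rfl
      · refine sum_congr rfl fun ab _ => ?_
        rw [hsucc, mul_smul_comm]
        push_cast
        rfl
    exact smul_right_injective _ hr key

theorem expSum_mul (x : A) {a b N : ℕ} {y z : A} (hy : (adL x ^ a) y = 0)
    (hz : (adL x ^ b) z = 0) (hN : a + b < N) :
    expSum x N (y * z) = expSum x (a + 1) y * expSum x (b + 1) z := by
  have hpow : ∀ {c k : ℕ} {u : A}, (adL x ^ c) u = 0 → c < k → (adL x ^ k) u = 0 := by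
    intro c k u hu hk
    rw [show k = (k - c) + c by lia, pow_add, Module.End.mul_apply, hu, map_zero]
  simp only [expSum, adL_pow_mul]
  rw [sum_antidiagonal_regroup (fun r s => ((r.factorial : ℂ)⁻¹ • (adL x ^ r) y) *
        ((s.factorial : ℂ)⁻¹ • (adL x ^ s) z)) hN
      (fun r s hr => by rw [hpow hy hr, smul_zero, zero_mul])
      (fun r s hr => by rw [hpow hz hr, smul_zero, mul_zero]), sum_mul_sum]

theorem expSum_of_le (x : A) {a N : ℕ} {y : A} (hy : (adL x ^ a) y = 0) (hN : a ≤ N) :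
    expSum x N y = expSum x a y := by
  refine (sum_subset (range_mono hN) fun k _ hk => ?_).symm
  rw [mem_range] at hk
  rw [show k = (k - a) + a by lia, pow_add, Module.End.mul_apply, hy, map_zero, smul_zero]

variable {L : Type*} [LieRing L] [LieAlgebra ℂ L]

theorem expAd_apply {x : L} (hx : IsNilpotent (LieAlgebra.ad ℂ L x)) {y : L} {k : ℕ}
    (hk : (LieAlgebra.ad ℂ L x ^ k) y = 0) :
    expAd x hx y = ∑ r ∈ range k, (r.factorial : ℂ)⁻¹ • (LieAlgebra.ad ℂ L x ^ r) y := by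
  -- The same rational structure as in the definition of `expAd`, so that both exponentials are
  -- literally the same.
  let : Module ℚ L := Module.compHom L (algebraMap ℚ ℂ)
  let : LieAlgebra ℚ L :=
    { lie_smul := fun t x y => lie_smul (algebraMap ℚ ℂ t) x y }
  have h : (LieDerivation.ad ℂ L x).toLinearMap = LieAlgebra.ad ℂ L x := by
    ext y; simp
  have h1 : expAd x hx y = IsNilpotent.exp (LieDerivation.ad ℂ L x).toLinearMap y :=
    LieDerivation.exp_map_apply _ _ _
  rw [h1, h]
  have h2 := IsNilpotent.exp_smul_eq_sum (M := L) (a := LieAlgebra.ad ℂ L x) (m := y) (k := k) hk hx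
  refine h2.trans (sum_congr rfl fun r _ => ?_)
  change algebraMap ℚ ℂ ((r.factorial : ℚ)⁻¹) • (LieAlgebra.ad ℂ L x ^ r) y = _
  congr 1
  simp

/-- The automorphism of `U(L)` extending `exp (ad x)`. -/
def expU (x : L) (hx : IsNilpotent (LieAlgebra.ad ℂ L x)) :
    UniversalEnvelopingAlgebra ℂ L →ₐ[ℂ] UniversalEnvelopingAlgebra ℂ L :=
  UniversalEnvelopingAlgebra.lift ℂ
    ((UniversalEnvelopingAlgebra.ι ℂ).comp (expAd x hx : L →ₗ⁅ℂ⁆ L))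

theorem expU_ι (x : L) (hx : IsNilpotent (LieAlgebra.ad ℂ L x)) (y : L) :
    expU x hx (UniversalEnvelopingAlgebra.ι ℂ y) =
      UniversalEnvelopingAlgebra.ι ℂ (expAd x hx y) :=
  UniversalEnvelopingAlgebra.lift_ι_apply _ _ _

theorem adL_ι (x y : L) : adL (UniversalEnvelopingAlgebra.ι ℂ x)
    (UniversalEnvelopingAlgebra.ι ℂ y) = UniversalEnvelopingAlgebra.ι ℂ ⁅x, y⁆ := by
  rw [LieHom.map_lie, LieRing.of_associative_ring_bracket, adL_apply]

theorem adL_ι_pow (x y : L) (r : ℕ) : (adL (UniversalEnvelopingAlgebra.ι ℂ x) ^ r)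
    (UniversalEnvelopingAlgebra.ι ℂ y) =
      UniversalEnvelopingAlgebra.ι ℂ ((LieAlgebra.ad ℂ L x ^ r) y) := by
  induction r with
  | zero => rfl
  | succ r ih =>
    rw [pow_succ', pow_succ', Module.End.mul_apply, Module.End.mul_apply, ih, adL_ι,
      LieAlgebra.ad_apply]

theorem adL_one (x : A) : adL x 1 = 0 := by
  rw [adL_apply, mul_one, one_mul, sub_self]

/-- Both sides agree on 𝔤, and the exponential of a derivation is multiplicative. On U(𝔤) the
commutator with x is only locally nilpotent, so the length a depends on z. -/
theorem expU_eq_expSum (x : L) (hx : IsNilpotent (LieAlgebra.ad ℂ L x))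
    (z : UniversalEnvelopingAlgebra ℂ L) : ∃ a, (adL (UniversalEnvelopingAlgebra.ι ℂ x) ^ a) z = 0 ∧
      expU x hx z = expSum (UniversalEnvelopingAlgebra.ι ℂ x) a z := by
  induction z using enveloping_induction with
  | one =>
    refine ⟨1, by rw [pow_one, adL_one], ?_⟩
    simp [expSum]
  | smul c z h =>
    obtain ⟨a, h1, h2⟩ := h
    refine ⟨a, by rw [map_smul, h1, smul_zero], ?_⟩
    rw [map_smul, h2, expSum, expSum, smul_sum]
    exact sum_congr rfl fun r _ => by rw [map_smul, smul_comm]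
  | add z z' h h' =>
    obtain ⟨a, h1, h2⟩ := h
    obtain ⟨b, h3, h4⟩ := h'
    have h5 : (adL (UniversalEnvelopingAlgebra.ι ℂ x) ^ (a + b)) z = 0 := by
      rw [add_comm, pow_add, Module.End.mul_apply, h1, map_zero]
    have h6 : (adL (UniversalEnvelopingAlgebra.ι ℂ x) ^ (a + b)) z' = 0 := by
      rw [pow_add, Module.End.mul_apply, h3, map_zero]
    refine ⟨a + b, by rw [map_add, h5, h6, add_zero], ?_⟩
    rw [map_add, h2, h4, ← expSum_of_le _ h1 (Nat.le_add_right a b),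
      ← expSum_of_le _ h3 (Nat.le_add_left b a), expSum, expSum, expSum, ← sum_add_distrib]
    exact sum_congr rfl fun r _ => by rw [map_add, smul_add]
  | ι_mul y z h =>
    obtain ⟨b, h1, h2⟩ := h
    obtain ⟨a, ha⟩ := id hx
    have hay : (adL (UniversalEnvelopingAlgebra.ι ℂ x) ^ a) (UniversalEnvelopingAlgebra.ι ℂ y)
        = 0 := by
      rw [adL_ι_pow, ha, LinearMap.zero_apply, map_zero]
    have h3 := adL_pow_mul_eq_zero _ hay h1
    refine ⟨a + b + 1, ?_, ?_⟩
    · rw [pow_succ', Module.End.mul_apply, h3, map_zero]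
    · rw [expSum_mul _ hay h1 (Nat.lt_succ_self _), map_mul, h2,
        expSum_of_le _ h1 (Nat.le_succ b), expSum_of_le _ hay (Nat.le_succ a), expU_ι,
        expAd_apply _ (k := a) (by rw [ha]; rfl), expSum, map_sum]
      congr 1
      exact sum_congr rfl fun r _ => by rw [map_smul, adL_ι_pow]

theorem exists_expU_eq_expSum (x : L) (hx : IsNilpotent (LieAlgebra.ad ℂ L x))
    (z : UniversalEnvelopingAlgebra ℂ L) : ∃ a, ∀ N, a ≤ N →
      expU x hx z = expSum (UniversalEnvelopingAlgebra.ι ℂ x) N z := by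
  obtain ⟨a, h1, h2⟩ := expU_eq_expSum x hx z
  exact ⟨a, fun N hN => by rw [h2, expSum_of_le _ h1 hN]⟩

end EnvelopingSl2

/-! ### The action of the triple (e_i, f_i, h_i) and of T_i on U_i -/

section LeviAction

variable {L : Type*} [LieRing L] [LieAlgebra ℂ L] [FiniteDimensional ℂ L] [LieAlgebra.IsSimple ℂ L]
variable {H : LieSubalgebra ℂ L} [H.IsCartanSubalgebra] {Δ : (rootSystem H).Base}
variable (R : RootVectors Δ) (i : Δ.support)

/-- `e_i` in `U(𝔤)`. -/
abbrev RootVectors.uE : UniversalEnvelopingAlgebra ℂ L := UniversalEnvelopingAlgebra.ι ℂ (R.e i)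

/-- `f_i` in `U(𝔤)`. -/
abbrev RootVectors.uF : UniversalEnvelopingAlgebra ℂ L := UniversalEnvelopingAlgebra.ι ℂ (R.f i)

/-- `h_i` in `U(𝔤)`. -/
abbrev coU (Δ : (rootSystem H).Base) (i : Δ.support) : UniversalEnvelopingAlgebra ℂ L :=
  UniversalEnvelopingAlgebra.ι ℂ (simpleCoroot Δ i : L)

theorem RootVectors.sl2Elts : Sl2Elts (R.uE i) (R.uF i) (coU Δ i) where
  ef := by
    rw [← adL_apply, adL_ι, R.lie_e_f]
  he := by
    rw [← adL_apply, adL_ι, R.lie_h_e, map_smul]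
  hf := by
    rw [← adL_apply, adL_ι, R.lie_h_f, map_smul]

/-- The subalgebra of `U(𝔤)` generated by the root spaces of the positive roots other than `α_i`. -/
def nilU (Δ : (rootSystem H).Base) (i : Δ.support) :
    Subalgebra ℂ (UniversalEnvelopingAlgebra ℂ L) :=
  Algebra.adjoin ℂ (UniversalEnvelopingAlgebra.ι ℂ '' (nilSpan Δ i : Set L))

/-- The span of the products of at most `k` factors from the root spaces of the positive roots other
than `α_i`. -/
def nilFil (Δ : (rootSystem H).Base) (i : Δ.support) (k : ℕ) :
    Submodule ℂ (UniversalEnvelopingAlgebra ℂ L) :=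
  (1 ⊔ (nilSpan Δ i).map (UniversalEnvelopingAlgebra.ι ℂ : L →ₗ⁅ℂ⁆ _).toLinearMap) ^ k

variable {i}

theorem one_le_nilFil_one :
    (1 : Submodule ℂ (UniversalEnvelopingAlgebra ℂ L)) ≤
      1 ⊔ (nilSpan Δ i).map (UniversalEnvelopingAlgebra.ι ℂ : L →ₗ⁅ℂ⁆ _).toLinearMap := le_sup_left

theorem nilFil_mono : Monotone (nilFil Δ i) := fun _ _ h =>
  pow_le_pow_right' one_le_nilFil_one h

theorem exists_mem_nilFil {z : UniversalEnvelopingAlgebra ℂ L} (hz : z ∈ nilU Δ i) :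
    ∃ k, z ∈ nilFil Δ i k := by
  induction hz using Algebra.adjoin_induction with
  | mem z hz =>
    obtain ⟨x, hx, rfl⟩ := hz
    refine ⟨1, ?_⟩
    rw [nilFil, pow_one]
    exact Submodule.mem_sup_right ⟨x, hx, rfl⟩
  | algebraMap c =>
    refine ⟨0, ?_⟩
    rw [nilFil, pow_zero]
    exact Submodule.algebraMap_mem c
  | add a b _ _ ha hb =>
    obtain ⟨k, ha⟩ := ha
    obtain ⟨l, hb⟩ := hb
    exact ⟨max k l, Submodule.add_mem _ (nilFil_mono (le_max_left k l) ha)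
      (nilFil_mono (le_max_right k l) hb)⟩
  | mul a b _ _ ha hb =>
    obtain ⟨k, ha⟩ := ha
    obtain ⟨l, hb⟩ := hb
    refine ⟨k + l, ?_⟩
    rw [nilFil, pow_add]
    exact Submodule.mul_mem_mul ha hb

theorem nilFil_le (k : ℕ) : nilFil Δ i k ≤ Subalgebra.toSubmodule (nilU Δ i) := by
  have h1 : (1 : Submodule ℂ (UniversalEnvelopingAlgebra ℂ L)) ⊔
      (nilSpan Δ i).map (UniversalEnvelopingAlgebra.ι ℂ : L →ₗ⁅ℂ⁆ _).toLinearMap ≤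
      Subalgebra.toSubmodule (nilU Δ i) := by
    refine sup_le ?_ ?_
    · rw [Submodule.one_le]
      exact (nilU Δ i).one_mem
    · rintro _ ⟨x, hx, rfl⟩
      exact Algebra.subset_adjoin ⟨x, hx, rfl⟩
  induction k with
  | zero =>
    rw [nilFil, pow_zero, Submodule.one_le]
    exact (nilU Δ i).one_mem
  | succ k ih =>
    rw [nilFil, pow_succ]
    exact Submodule.mul_le.2 fun a ha b hb => (nilU Δ i).mul_mem (ih ha) (h1 hb)

theorem adL_nilFil {x : L} (hx : ∀ y ∈ nilSpan Δ i, ⁅x, y⁆ ∈ nilSpan Δ i) (k : ℕ) :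
    ∀ z ∈ nilFil Δ i k, adL (UniversalEnvelopingAlgebra.ι ℂ x) z ∈ nilFil Δ i k := by
  have h1 : ∀ z ∈ nilFil Δ i 1, adL (UniversalEnvelopingAlgebra.ι ℂ x) z ∈ nilFil Δ i 1 := by
    intro z hz
    rw [nilFil, pow_one] at hz ⊢
    obtain ⟨a, ha, b, hb, rfl⟩ := Submodule.mem_sup.1 hz
    obtain ⟨c, rfl⟩ := Submodule.mem_one.1 ha
    obtain ⟨y, hy, rfl⟩ := hb
    rw [map_add, Algebra.algebraMap_eq_smul_one, map_smul, adL_one, smul_zero, zero_add]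
    refine Submodule.mem_sup_right ⟨⁅x, y⁆, hx y hy, ?_⟩
    exact (adL_ι x y).symm
  induction k with
  | zero =>
    intro z hz
    rw [nilFil, pow_zero] at hz
    obtain ⟨c, rfl⟩ := Submodule.mem_one.1 hz
    rw [Algebra.algebraMap_eq_smul_one, map_smul, adL_one, smul_zero]
    exact Submodule.zero_mem _
  | succ k ih =>
    intro z hz
    rw [nilFil, pow_succ] at hz ⊢
    induction hz using Submodule.mul_induction_on' with
    | mem_mul_mem a ha b hb =>
      rw [adL_mul]
      have h2 := h1 b (by rw [nilFil, pow_one]; exact hb)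
      rw [nilFil, pow_one] at h2
      exact Submodule.add_mem _ (Submodule.mul_mem_mul (ih a ha) hb) (Submodule.mul_mem_mul ha h2)
    | add a _ b _ ha hb => rw [map_add]; exact Submodule.add_mem _ ha hb

/-- On a filtration step the exponent is uniform in z, unlike on the whole of U_i. Uniformity is
what makes the dual operator nilpotent too, and is the reason for working with `nilFil`. -/
theorem adL_nilFil_nilpotent {x : L} (hx : IsNilpotent (LieAlgebra.ad ℂ L x)) (k : ℕ) :
    ∃ r, ∀ z ∈ nilFil Δ i k, (adL (UniversalEnvelopingAlgebra.ι ℂ x) ^ r) z = 0 := by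
  obtain ⟨s, hs⟩ := hx
  have h1 : ∀ z ∈ nilFil Δ i 1, (adL (UniversalEnvelopingAlgebra.ι ℂ x) ^ (s + 1)) z = 0 := by
    intro z hz
    rw [nilFil, pow_one] at hz
    obtain ⟨a, ha, b, hb, rfl⟩ := Submodule.mem_sup.1 hz
    obtain ⟨c, rfl⟩ := Submodule.mem_one.1 ha
    obtain ⟨y, hy, rfl⟩ := hb
    rw [map_add, Algebra.algebraMap_eq_smul_one, map_smul, pow_succ, Module.End.mul_apply, adL_one,
      map_zero, smul_zero, zero_add, ← pow_succ]
    refine (adL_ι_pow x y (s + 1)).trans ?_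
    rw [pow_succ, hs, zero_mul, LinearMap.zero_apply, map_zero]
  induction k with
  | zero =>
    refine ⟨1, fun z hz => ?_⟩
    rw [nilFil, pow_zero] at hz
    obtain ⟨c, rfl⟩ := Submodule.mem_one.1 hz
    rw [Algebra.algebraMap_eq_smul_one, map_smul, pow_one, adL_one, smul_zero]
  | succ k ih =>
    obtain ⟨r, hr⟩ := ih
    refine ⟨r + (s + 1), fun z hz => ?_⟩
    rw [nilFil, pow_succ] at hz
    induction hz using Submodule.mul_induction_on' with
    | mem_mul_mem a ha b hb =>
      exact adL_pow_mul_eq_zero _ (hr a ha) (h1 b (by rw [nilFil, pow_one]; exact hb))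
    | add a _ b _ ha hb => rw [map_add, ha, hb, add_zero]

theorem RootVectors.isAdStable_nilFil (k : ℕ) :
    IsAdStable (R.uE i) (R.uF i) (coU Δ i) (nilFil Δ i k) where
  e_mem := adL_nilFil (fun _ hy => R.lie_e_mem_nilSpan i hy) k
  f_mem := adL_nilFil (fun _ hy => R.lie_f_mem_nilSpan i hy) k
  h_mem := adL_nilFil (fun _ hy => lie_cartan_mem_nilSpan i _ hy) k
  e_nilpotent := adL_nilFil_nilpotent (R.isNilpotent_ad_e i) k
  f_nilpotent := adL_nilFil_nilpotent (R.isNilpotent_ad_f i) k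

variable (i)

theorem RootVectors.isNilpotent_ad_neg_e : IsNilpotent (LieAlgebra.ad ℂ L (-R.e i)) := by
  rw [map_neg]; exact (R.isNilpotent_ad_e i).neg

theorem RootVectors.T_ι (x : L) : R.T i (UniversalEnvelopingAlgebra.ι ℂ x) =
    UniversalEnvelopingAlgebra.ι ℂ (R.adSBar i x) :=
  UniversalEnvelopingAlgebra.lift_ι_apply _ _ _

theorem RootVectors.adSBar_apply (x : L) : R.adSBar i x =
    expAd (-R.e i) (R.isNilpotent_ad_neg_e i) (expAd (R.f i) (R.isNilpotent_ad_f i)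
      (expAd (-R.e i) (R.isNilpotent_ad_neg_e i) x)) := rfl

theorem RootVectors.T_apply (z : UniversalEnvelopingAlgebra ℂ L) : R.T i z =
    expU (-R.e i) (R.isNilpotent_ad_neg_e i) (expU (R.f i) (R.isNilpotent_ad_f i)
      (expU (-R.e i) (R.isNilpotent_ad_neg_e i) z)) := by
  have h : R.T i = (expU (-R.e i) (R.isNilpotent_ad_neg_e i)).comp
      ((expU (R.f i) (R.isNilpotent_ad_f i)).comp
        (expU (-R.e i) (R.isNilpotent_ad_neg_e i))) := by
    ext x
    simp only [LieHom.comp_apply, AlgHom.coe_toLieHom, AlgHom.comp_apply, expU_ι, R.T_ι,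
      R.adSBar_apply]
  rw [h]
  rfl

theorem expAd_mem {L : Type*} [LieRing L] [LieAlgebra ℂ L] {x : L}
    (hx : IsNilpotent (LieAlgebra.ad ℂ L x)) {M : Submodule ℂ L} (hM : ∀ y ∈ M, ⁅x, y⁆ ∈ M) {y : L}
    (hy : y ∈ M) : expAd x hx y ∈ M := by
  obtain ⟨k, hk⟩ := id hx
  rw [expAd_apply hx (k := k) (by rw [hk]; rfl)]
  exact Submodule.sum_mem _ fun r _ => Submodule.smul_mem _ _
    (pow_mem_of_stable (X := LieAlgebra.ad ℂ L x) hM r hy)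

theorem RootVectors.adSBar_mem_nilSpan {x : L} (hx : x ∈ nilSpan Δ i) :
    R.adSBar i x ∈ nilSpan Δ i := by
  have he : ∀ y ∈ nilSpan Δ i, ⁅-R.e i, y⁆ ∈ nilSpan Δ i := fun y hy => by
    rw [neg_lie]; exact Submodule.neg_mem _ (R.lie_e_mem_nilSpan i hy)
  rw [R.adSBar_apply]
  exact expAd_mem _ he (expAd_mem _ (fun y hy => R.lie_f_mem_nilSpan i hy) (expAd_mem _ he hx))

theorem RootVectors.T_mem_nilU {z : UniversalEnvelopingAlgebra ℂ L} (hz : z ∈ nilU Δ i) :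
    R.T i z ∈ nilU Δ i := by
  induction hz using Algebra.adjoin_induction with
  | mem z hz =>
    obtain ⟨x, hx, rfl⟩ := hz
    rw [R.T_ι]
    exact Algebra.subset_adjoin ⟨_, R.adSBar_mem_nilSpan i hx, rfl⟩
  | algebraMap c => rw [AlgHom.commutes]; exact Subalgebra.algebraMap_mem _ _
  | add a b _ _ ha hb => rw [map_add]; exact Subalgebra.add_mem _ ha hb
  | mul a b _ _ ha hb => rw [map_mul]; exact Subalgebra.mul_mem _ ha hb

/-- Under the three exponentials e_i goes to e_i, then to e_i - h_i - f_i, then to -f_i. -/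
theorem RootVectors.adSBar_e : R.adSBar i (R.e i) = -R.f i := by
  have hee : ⁅R.e i, R.e i⁆ = 0 := lie_self _
  have hef := R.lie_e_f i
  have hfe : ⁅R.f i, R.e i⁆ = -(simpleCoroot Δ i : L) := by rw [← lie_skew, hef]
  have heh : ⁅R.e i, (simpleCoroot Δ i : L)⁆ = (-2 : ℂ) • R.e i := by
    rw [← lie_skew, R.lie_h_e, neg_smul]
  have hfh : ⁅R.f i, (simpleCoroot Δ i : L)⁆ = (2 : ℂ) • R.f i := by
    rw [← lie_skew, R.lie_h_f, neg_smul, neg_neg]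
  have hff : ⁅R.f i, R.f i⁆ = 0 := lie_self _
  have s1 : expAd (-R.e i) (R.isNilpotent_ad_neg_e i) (R.e i) = R.e i := by
    rw [expAd_apply _ (k := 1) (by rw [pow_one, LieAlgebra.ad_apply, neg_lie, hee, neg_zero])]
    simp
  have s2 : expAd (R.f i) (R.isNilpotent_ad_f i) (R.e i) =
      R.e i - (simpleCoroot Δ i : L) - R.f i := by
    have h1 : (LieAlgebra.ad ℂ L (R.f i) ^ 2) (R.e i) = (-2 : ℂ) • R.f i := by
      rw [pow_two, Module.End.mul_apply, LieAlgebra.ad_apply, LieAlgebra.ad_apply, hfe, lie_neg, hfh,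
        neg_smul]
    rw [expAd_apply _ (k := 3) (by
      rw [pow_succ', Module.End.mul_apply, h1, map_smul, LieAlgebra.ad_apply, hff, smul_zero])]
    rw [Finset.sum_range_succ, Finset.sum_range_succ, Finset.sum_range_one, h1, pow_one, pow_zero,
      LieAlgebra.ad_apply, hfe, Module.End.one_apply]
    simp only [Nat.factorial]
    norm_num
    module
  have s3 : expAd (-R.e i) (R.isNilpotent_ad_neg_e i) (R.f i) =
      R.f i - (simpleCoroot Δ i : L) - R.e i := by
    have h1 : (LieAlgebra.ad ℂ L (-R.e i) ^ 2) (R.f i) = (-2 : ℂ) • R.e i := by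
      rw [pow_two, Module.End.mul_apply, LieAlgebra.ad_apply, LieAlgebra.ad_apply, neg_lie, neg_lie,
        hef, lie_neg, heh, neg_neg]
    rw [expAd_apply _ (k := 3) (by
      rw [pow_succ', Module.End.mul_apply, h1, map_smul, LieAlgebra.ad_apply, neg_lie, hee, neg_zero,
        smul_zero])]
    rw [Finset.sum_range_succ, Finset.sum_range_succ, Finset.sum_range_one, h1, pow_one, pow_zero,
      LieAlgebra.ad_apply, neg_lie, hef, Module.End.one_apply]
    simp only [Nat.factorial]
    norm_num
    module
  have s4 : expAd (-R.e i) (R.isNilpotent_ad_neg_e i) (simpleCoroot Δ i : L) =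
      (simpleCoroot Δ i : L) + (2 : ℂ) • R.e i := by
    have h1 : (LieAlgebra.ad ℂ L (-R.e i)) (simpleCoroot Δ i : L) = (2 : ℂ) • R.e i := by
      rw [LieAlgebra.ad_apply, neg_lie, heh, neg_smul, neg_neg]
    rw [expAd_apply _ (k := 2) (by
      rw [pow_two, Module.End.mul_apply, h1, map_smul, LieAlgebra.ad_apply, neg_lie, hee, neg_zero,
        smul_zero])]
    rw [Finset.sum_range_succ, Finset.sum_range_one, pow_one, h1, pow_zero, Module.End.one_apply]
    simp
  rw [R.adSBar_apply, s1, s2, map_sub, map_sub, s1, s3, s4]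
  module

theorem RootVectors.T_uE : R.T i (R.uE i) = -R.uF i := by
  rw [R.T_ι, R.adSBar_e, map_neg]

/-- This transports `apply_exp_exp_exp` to T_i: beyond a bound depending on z, the three
automorphisms are truncated exponential sums of one common length. -/
theorem RootVectors.apply_T {l : UniversalEnvelopingAlgebra ℂ L →ₗ[ℂ] ℂ} {p n : ℕ}
    (h0 : ∀ z ∈ nilU Δ i, ∀ j k, (p < j ∨ n < k) → l (R.uE i ^ j * z * R.uE i ^ k) = 0)
    (hw : ∀ z ∈ nilU Δ i, ∀ j k, l (adL (coU Δ i) (R.uE i ^ j * z * R.uE i ^ k)) =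
      ((p : ℂ) + n) * l (R.uE i ^ j * z * R.uE i ^ k)) {z : UniversalEnvelopingAlgebra ℂ L}
    (hz : z ∈ nilU Δ i) :
    (p.factorial : ℂ)⁻¹ * l (R.uE i ^ p * R.T i z) =
      (n.factorial : ℂ)⁻¹ * l (z * R.uE i ^ n) := by
  obtain ⟨k, hk⟩ := exists_mem_nilFil hz
  obtain ⟨a, ha⟩ := exists_expU_eq_expSum (-R.e i) (R.isNilpotent_ad_neg_e i) z
  obtain ⟨b, hb⟩ := exists_expU_eq_expSum (R.f i) (R.isNilpotent_ad_f i)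
    (expU (-R.e i) (R.isNilpotent_ad_neg_e i) z)
  obtain ⟨c, hc⟩ := exists_expU_eq_expSum (-R.e i) (R.isNilpotent_ad_neg_e i)
    (expU (R.f i) (R.isNilpotent_ad_f i) (expU (-R.e i) (R.isNilpotent_ad_neg_e i) z))
  have h1 := (R.isAdStable_nilFil (i := i) k).apply_exp_exp_exp (R.sl2Elts i)
    (fun z hz => h0 z (nilFil_le k hz)) (fun z hz => hw z (nilFil_le k hz)) hk
    (N := p + n + 1 + a + b + c) (by lia)
  rw [R.T_apply, hc (p + n + 1 + a + b + c) (by lia), hb (p + n + 1 + a + b + c) (by lia),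
    ha (p + n + 1 + a + b + c) (by lia), map_neg]
  exact h1

end LeviAction

/-! ### Minors as highest weight vectors -/

section Minor

open MvPolynomial

local notation "𝒰" => UniversalEnvelopingAlgebra ℂ

theorem derivation_prod {A κ : Type*} [CommRing A] [Algebra ℂ A] [DecidableEq κ]
    (D : Derivation ℂ A A) (s : Finset κ) (f : κ → A) :
    D (∏ j ∈ s, f j) = ∑ i ∈ s, ∏ j ∈ s, Function.update f i (D (f i)) j := by
  induction s using Finset.induction_on with
  | empty => simp
  | insert a s ha ih =>
    rw [Finset.prod_insert ha, D.leibniz, ih, Finset.sum_insert ha, Finset.prod_insert ha,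
      Function.update_self, add_comm, smul_eq_mul, smul_eq_mul, Finset.mul_sum]
    congr 1
    · rw [mul_comm]
      congr 1
      refine Finset.prod_congr rfl fun j hj => ?_
      rw [Function.update_of_ne (ne_of_mem_of_not_mem hj ha)]
    · refine Finset.sum_congr rfl fun i hi => ?_
      rw [Finset.prod_insert ha, Function.update_of_ne (ne_of_mem_of_not_mem hi ha).symm]

theorem derivation_det {A κ : Type*} [CommRing A] [Algebra ℂ A] [DecidableEq κ] [Fintype κ]
    (D : Derivation ℂ A A) (Z : Matrix κ κ A) :
    D Z.det = ∑ c, (Z.updateCol c fun a => D (Z a c)).det := by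
  simp only [Matrix.det_apply]
  rw [map_sum, Finset.sum_comm]
  refine Finset.sum_congr rfl fun σ _ => ?_
  rw [← Finset.smul_sum]
  have h : ∀ (s : ℤˣ) (a : A), D (s • a) = s • D a := fun s a => by
    rw [Units.smul_def, Units.smul_def, map_zsmul]
  rw [h, derivation_prod]
  congr 1
  refine Finset.sum_congr rfl fun i _ => Finset.prod_congr rfl fun j _ => ?_
  by_cases hj : j = i
  · subst hj; simp
  · simp [hj]

/-- The derivation acts on Z as right multiplication by M, and the differential of the determinant
is the trace. -/
theorem derivation_det_of_eq_sum {A κ : Type*} [CommRing A] [Algebra ℂ A] [DecidableEq κ]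
    [Fintype κ] (D : Derivation ℂ A A) (Z : Matrix κ κ A) (M : Matrix κ κ ℂ)
    (h : ∀ a c, D (Z a c) = ∑ k, M k c • Z a k) : D Z.det = M.trace • Z.det := by
  rw [derivation_det, Matrix.trace, Finset.sum_smul]
  refine Finset.sum_congr rfl fun c _ => ?_
  have h1 := Matrix.det_updateCol_sum Z c fun k => algebraMap ℂ A (M k c)
  simp only [h, Matrix.diag_apply]
  rw [Algebra.smul_def, ← smul_eq_mul, ← h1]
  simp only [smul_eq_mul, Algebra.smul_def]

variable {L : Type*} [LieRing L] [LieAlgebra ℂ L] [FiniteDimensional ℂ L]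

/-- The adjoint representation as a matrix representation. -/
def adMatrix (L : Type*) [LieRing L] [LieAlgebra ℂ L] [FiniteDimensional ℂ L] :
    L →ₗ⁅ℂ⁆ Matrix (Fin (Module.finrank ℂ L)) (Fin (Module.finrank ℂ L)) ℂ where
  toFun x := LinearMap.toMatrixAlgEquiv (Module.finBasis ℂ L) (LieAlgebra.ad ℂ L x)
  map_add' x y := by rw [map_add, map_add]
  map_smul' c x := by rw [map_smul, map_smul]; rfl
  map_lie' {x y} := by
    rw [LieHom.map_lie, LieRing.of_associative_ring_bracket, map_sub, map_mul, map_mul,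
      LieRing.of_associative_ring_bracket]

/-- The linear form attached to `v`, in the variables of row `a`. -/
def rowForm {κ : Type*} (a : κ) (v : L) :
    MvPolynomial (κ × Fin (Module.finrank ℂ L)) ℂ :=
  ∑ q, (Module.finBasis ℂ L).repr v q • X (a, q)

/-- The variables of each row span a copy of the adjoint representation, so a minor behaves like a
decomposable element of the exterior algebra of 𝔤. -/
theorem polyDer_rowForm {κ : Type*} (a : κ) (x v : L) :
    polyDer (adMatrix L) κ x (rowForm a v) = rowForm a ⁅x, v⁆ := by
  simp only [rowForm, map_sum, Derivation.map_smul, polyDer_X, Finset.smul_sum, smul_smul]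
  rw [Finset.sum_comm]
  refine Finset.sum_congr rfl fun k _ => ?_
  rw [← Finset.sum_smul]
  congr 1
  have h := congrFun (LinearMap.toMatrix_mulVec_repr (Module.finBasis ℂ L) (Module.finBasis ℂ L)
    (LieAlgebra.ad ℂ L x) v) k
  rw [LieAlgebra.ad_apply] at h
  rw [← h, Matrix.mulVec, dotProduct]
  refine Finset.sum_congr rfl fun q _ => ?_
  rw [mul_comm]; rfl

theorem rowForm_sum {κ σ : Type*} [Fintype σ] (a : κ) (m : σ → ℂ) (v : σ → L) :
    rowForm a (∑ c, m c • v c) = ∑ c, m c • rowForm a (v c) := by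
  simp only [rowForm, map_sum, map_smul, Finsupp.coe_finsetSum, Finset.sum_apply,
    Finsupp.smul_apply, Finset.sum_smul, Finset.smul_sum, smul_eq_mul, mul_smul]
  rw [Finset.sum_comm]

/-- The minor of the columns `v`. -/
def minor {κ : Type*} [DecidableEq κ] [Fintype κ] (v : κ → L) :
    MvPolynomial (κ × Fin (Module.finrank ℂ L)) ℂ :=
  (Matrix.of fun a c => rowForm a (v c)).det

theorem polyDer_minor {κ : Type*} [DecidableEq κ] [Fintype κ] (v : κ → L) (x : L)
    (M : Matrix κ κ ℂ) (h : ∀ c, ⁅x, v c⁆ = ∑ k, M k c • v k) :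
    polyDer (adMatrix L) κ x (minor v) = M.trace • minor v := by
  refine derivation_det_of_eq_sum _ _ M fun a c => ?_
  rw [Matrix.of_apply, polyDer_rowForm, h, rowForm_sum]
  rfl

/-- A left inverse g of the independent family v specializes the variables so that the matrix
becomes the identity. -/
theorem minor_ne_zero {κ : Type*} [DecidableEq κ] [Fintype κ] {v : κ → L}
    (hv : LinearIndependent ℂ v) : minor v ≠ 0 := by
  obtain ⟨g, hg⟩ := LinearMap.exists_leftInverse_of_injective (Finsupp.linearCombination ℂ v)
    (LinearMap.ker_eq_bot.2 hv)
  have hgv : ∀ c, g (v c) = Finsupp.single c 1 := fun c => by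
    have := LinearMap.congr_fun hg (Finsupp.single c 1)
    simpa using this
  intro h
  have h1 := congrArg (aeval fun aq : κ × Fin (Module.finrank ℂ L) =>
    g (Module.finBasis ℂ L aq.2) aq.1) h
  rw [map_zero, minor, AlgHom.map_det] at h1
  have h2 : (aeval fun aq : κ × Fin (Module.finrank ℂ L) =>
      g (Module.finBasis ℂ L aq.2) aq.1).mapMatrix (Matrix.of fun a c => rowForm a (v c)) =
      (1 : Matrix κ κ ℂ) := by
    ext a c
    rw [AlgHom.mapMatrix_apply, Matrix.map_apply, Matrix.of_apply, rowForm, map_sum]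
    simp only [map_smul, aeval_X]
    have h3 : g (v c) a = ∑ q, (Module.finBasis ℂ L).repr (v c) q • g (Module.finBasis ℂ L q) a := by
      have h4 := congrArg (fun u => g u a) ((Module.finBasis ℂ L).sum_repr (v c))
      simp only [map_sum, map_smul, Finsupp.coe_finsetSum, Finset.sum_apply,
        Finsupp.smul_apply] at h4
      exact h4.symm
    rw [← h3, hgv, Matrix.one_apply, Finsupp.single_apply]
    simp only [eq_comm]
  rw [h2, Matrix.det_one] at h1
  exact one_ne_zero h1

/-- If `x` stabilizes `N` and `⁅x, e⁆ ∈ m e + N`, then `x` scales the minor of `e` and a basis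
of `N`. -/
theorem polyDer_minor_option {N : Submodule ℂ L} {e x : L} {m : ℂ}
    (hN : ∀ y ∈ N, LieAlgebra.ad ℂ L x y ∈ N) (he : ⁅x, e⁆ - m • e ∈ N) :
    polyDer (adMatrix L) (Option (Fin (Module.finrank ℂ N))) x
      (minor fun c => Option.elim c e fun k => (Module.finBasis ℂ N k : L)) =
    (m + LinearMap.trace ℂ N ((LieAlgebra.ad ℂ L x).restrict hN)) •
      minor fun c => Option.elim c e fun k => (Module.finBasis ℂ N k : L) := by
  set β := Module.finBasis ℂ N
  -- The matrix of ad x in the basis (e, basis of N) is block triangular: e maps to m e plus an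
  -- element of N, and N is stable.
  rw [polyDer_minor _ x (Matrix.of fun k c => Option.elim c
    (Option.elim k m fun k => β.repr ⟨_, he⟩ k)
    fun c => Option.elim k 0 fun k => β.repr ((LieAlgebra.ad ℂ L x).restrict hN (β c)) k)]
  · rw [Matrix.trace, Fintype.sum_option, LinearMap.trace_eq_matrix_trace ℂ β, Matrix.trace]
    simp [LinearMap.toMatrix_apply]
  · rintro (_ | c)
    · rw [Fintype.sum_option]
      have h := congrArg Subtype.val (β.sum_repr ⟨_, he⟩)
      simp only [AddSubmonoidClass.coe_finsetSum, Submodule.coe_smul] at h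
      simp only [Option.elim, Matrix.of_apply]
      rw [h]
      abel
    · rw [Fintype.sum_option]
      have h := congrArg Subtype.val (β.sum_repr ((LieAlgebra.ad ℂ L x).restrict hN (β c)))
      simp only [AddSubmonoidClass.coe_finsetSum, Submodule.coe_smul] at h
      simp only [Option.elim, Matrix.of_apply, zero_smul, zero_add]
      rw [h]
      rfl

/-- A nonzero multiple of ad z is a commutator of endomorphisms of N. -/
theorem trace_restrict_lie {N : Submodule ℂ L} {x y z : L}
    (hx : ∀ v ∈ N, LieAlgebra.ad ℂ L x v ∈ N) (hy : ∀ v ∈ N, LieAlgebra.ad ℂ L y v ∈ N)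
    (hz : ∀ v ∈ N, LieAlgebra.ad ℂ L z v ∈ N) {c : ℂ} (hc : c ≠ 0) (h : ⁅x, y⁆ = c • z) :
    LinearMap.trace ℂ N ((LieAlgebra.ad ℂ L z).restrict hz) = 0 := by
  have h1 : c • (LieAlgebra.ad ℂ L z).restrict hz =
      (LieAlgebra.ad ℂ L x).restrict hx * (LieAlgebra.ad ℂ L y).restrict hy -
      (LieAlgebra.ad ℂ L y).restrict hy * (LieAlgebra.ad ℂ L x).restrict hx := by
    ext v
    change c • ⁅z, (v : L)⁆ = ⁅x, ⁅y, (v : L)⁆⁆ - ⁅y, ⁅x, (v : L)⁆⁆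
    rw [← smul_lie, ← h, lie_lie]
  have h2 := congrArg (LinearMap.trace ℂ N) h1
  rw [map_smul, map_sub, LinearMap.trace_mul_comm, sub_self] at h2
  exact (smul_eq_zero.1 h2).resolve_left hc

end Minor

/-! ### Separation of powers of e and f in U(𝔤) -/

section Triangular

open MvPolynomial TensorProduct

variable {L : Type*} [LieRing L] [LieAlgebra ℂ L]

local notation "𝒰" => UniversalEnvelopingAlgebra ℂ

/-- The action of `x` on `𝒰 ⊗ M` that extends left multiplication and a representation `M`. -/
def tensorRep {M : Type*} [AddCommGroup M] [Module ℂ M] (D : L →ₗ⁅ℂ⁆ Module.End ℂ M) :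
    L →ₗ⁅ℂ⁆ Module.End ℂ (𝒰 L ⊗[ℂ] M) where
  toFun x := (LinearMap.mulLeft ℂ (UniversalEnvelopingAlgebra.ι ℂ x)).rTensor M +
    (D x).lTensor (𝒰 L)
  map_add' x y := by
    ext u m
    simp [TensorProduct.add_tmul, add_mul]
    abel
  map_smul' c x := by
    ext u m
    simp [TensorProduct.smul_tmul']
  map_lie' {x y} := by
    refine TensorProduct.ext' fun u m => ?_
    simp only [LinearMap.add_apply, LinearMap.rTensor_tmul, LinearMap.lTensor_tmul, LieHom.map_lie,
      LieRing.of_associative_ring_bracket, LinearMap.sub_apply, Module.End.mul_apply, map_add,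
      LinearMap.mulLeft_apply, sub_mul, TensorProduct.sub_tmul, TensorProduct.tmul_sub, mul_assoc]
    abel

variable {M : Type*} [AddCommGroup M] [Module ℂ M]

/-- The action of `𝒰` on `𝒰 ⊗ M`. -/
def tensorAct (D : L →ₗ⁅ℂ⁆ Module.End ℂ M) : 𝒰 L →ₐ[ℂ] Module.End ℂ (𝒰 L ⊗[ℂ] M) :=
  UniversalEnvelopingAlgebra.lift ℂ (tensorRep D)

theorem tensorAct_ι (D : L →ₗ⁅ℂ⁆ Module.End ℂ M) (x : L) (u : 𝒰 L) (m : M) :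
    tensorAct D (UniversalEnvelopingAlgebra.ι ℂ x) (u ⊗ₜ m) =
      (UniversalEnvelopingAlgebra.ι ℂ x * u) ⊗ₜ m + u ⊗ₜ D x m := by
  rw [tensorAct, UniversalEnvelopingAlgebra.lift_ι_apply]
  rfl

theorem tensorAct_ι_pow_of_eq_zero (D : L →ₗ⁅ℂ⁆ Module.End ℂ M) {x : L} {m : M} (h : D x m = 0)
    (k : ℕ) : tensorAct D (UniversalEnvelopingAlgebra.ι ℂ x ^ k) (1 ⊗ₜ m) =
      (UniversalEnvelopingAlgebra.ι ℂ x ^ k) ⊗ₜ m := by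
  induction k with
  | zero => simp
  | succ k ih =>
    rw [pow_succ', map_mul, Module.End.mul_apply, ih, tensorAct_ι, h, tmul_zero, add_zero]

theorem tensorAct_ι_pow (D : L →ₗ⁅ℂ⁆ Module.End ℂ M) (x : L) (m : M) (k : ℕ) :
    tensorAct D (UniversalEnvelopingAlgebra.ι ℂ x ^ k) (1 ⊗ₜ m) =
      ∑ ab ∈ Finset.HasAntidiagonal.antidiagonal k, (k.choose ab.1 : ℂ) •
        ((UniversalEnvelopingAlgebra.ι ℂ x ^ ab.1) ⊗ₜ[ℂ] ((D x ^ ab.2) m)) := by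
  set A := (LinearMap.mulLeft ℂ (UniversalEnvelopingAlgebra.ι ℂ x)).rTensor M with hA
  set C := (D x).lTensor (𝒰 L) with hC
  have hcomm : Commute A C := by
    refine TensorProduct.ext' fun u m => ?_
    simp [hA, hC]
  have h1 : tensorAct D (UniversalEnvelopingAlgebra.ι ℂ x) = A + C := by
    rw [tensorAct, UniversalEnvelopingAlgebra.lift_ι_apply]
    rfl
  have hAC : ∀ a b : ℕ, (A ^ a * C ^ b) (1 ⊗ₜ[ℂ] m) =
      (UniversalEnvelopingAlgebra.ι ℂ x ^ a) ⊗ₜ[ℂ] ((D x ^ b) m) := by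
    intro a b
    have hb : (C ^ b) ((1 : 𝒰 L) ⊗ₜ[ℂ] m) = 1 ⊗ₜ[ℂ] ((D x ^ b) m) := by
      induction b with
      | zero => simp
      | succ b ih => rw [pow_succ', Module.End.mul_apply, ih, hC, LinearMap.lTensor_tmul, pow_succ',
          Module.End.mul_apply]
    rw [Module.End.mul_apply, hb]
    induction a with
    | zero => simp
    | succ a ih => rw [pow_succ', Module.End.mul_apply, ih, hA, LinearMap.rTensor_tmul, pow_succ',
        LinearMap.mulLeft_apply]
  rw [map_pow, h1, hcomm.add_pow', LinearMap.sum_apply]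
  refine Finset.sum_congr rfl fun ab _ => ?_
  rw [← hAC, LinearMap.smul_apply, Nat.cast_smul_eq_nsmul]

/-- Contraction of the second factor by a linear form. -/
def contract (η : M →ₗ[ℂ] ℂ) : 𝒰 L ⊗[ℂ] M →ₗ[ℂ] 𝒰 L :=
  (TensorProduct.rid ℂ (𝒰 L)).toLinearMap ∘ₗ η.lTensor (𝒰 L)

theorem contract_tmul (η : M →ₗ[ℂ] ℂ) (u : 𝒰 L) (m : M) : contract η (u ⊗ₜ m) = η m • u := by
  rw [contract, LinearMap.comp_apply, LinearMap.lTensor_tmul]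
  exact TensorProduct.rid_tmul _ _

/-- The vectors killed by N form an f-stable subspace, because [f, N] ⊆ N. -/
theorem apply_pow_eq_zero_of_stable {D : L →ₗ⁅ℂ⁆ Module.End ℂ M} {N : Submodule ℂ L} {f : L}
    (hf : ∀ x ∈ N, ⁅f, x⁆ ∈ N) {w : M} (hN : ∀ x ∈ N, D x w = 0) (s : ℕ) {x : L} (hx : x ∈ N) :
    D x ((D f ^ s) w) = 0 := by
  induction s generalizing x with
  | zero => exact hN x hx
  | succ s ih =>
    have h1 : D ⁅f, x⁆ ((D f ^ s) w) = D f (D x ((D f ^ s) w)) - D x (D f ((D f ^ s) w)) := by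
      rw [LieHom.map_lie]; rfl
    rw [ih (hf x hx), ih hx, map_zero, zero_sub, zero_eq_neg] at h1
    rw [pow_succ', Module.End.mul_apply, h1]

theorem tensorAct_of_mem_adjoin {D : L →ₗ⁅ℂ⁆ Module.End ℂ M} {N : Submodule ℂ L} {m : M}
    (hN : ∀ x ∈ N, D x m = 0) {b : 𝒰 L}
    (hb : b ∈ Algebra.adjoin ℂ (UniversalEnvelopingAlgebra.ι ℂ '' (N : Set L))) (u : 𝒰 L) :
    tensorAct D b (u ⊗ₜ m) = (b * u) ⊗ₜ m := by
  induction hb using Algebra.adjoin_induction generalizing u with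
  | mem b hb =>
    obtain ⟨x, hx, rfl⟩ := hb
    rw [tensorAct_ι, hN x hx, tmul_zero, add_zero]
  | algebraMap r =>
    rw [AlgHom.commutes, Module.algebraMap_end_apply, Algebra.algebraMap_eq_smul_one,
      smul_mul_assoc, one_mul, smul_tmul']
  | add a b _ _ ha hb => rw [map_add, LinearMap.add_apply, ha, hb, add_mul, add_tmul]
  | mul a b _ _ ha hb => rw [map_mul, Module.End.mul_apply, hb, ha, mul_assoc]

/-- Acting on 1 ⊗ w and contracting with η realizes formal differentiation with respect to f: in the
binomial expansion of f^k on 1 ⊗ w only the term with one factor f on w survives, and the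
coefficient b passes through since N kills every f^s w. -/
theorem contract_tensorAct_mul_pow {D : L →ₗ⁅ℂ⁆ Module.End ℂ M} {N : Submodule ℂ L} {f : L}
    (hf : ∀ x ∈ N, ⁅f, x⁆ ∈ N) {w : M} (hN : ∀ x ∈ N, D x w = 0) {η : M →ₗ[ℂ] ℂ}
    (h1 : η (D f w) = 1) (h2 : ∀ s, s ≠ 1 → η ((D f ^ s) w) = 0) {b : 𝒰 L}
    (hb : b ∈ Algebra.adjoin ℂ (UniversalEnvelopingAlgebra.ι ℂ '' (N : Set L))) (k : ℕ) :
    contract η (tensorAct D (b * UniversalEnvelopingAlgebra.ι ℂ f ^ k) (1 ⊗ₜ w)) =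
      (k : ℂ) • (b * UniversalEnvelopingAlgebra.ι ℂ f ^ (k - 1)) := by
  rw [map_mul, Module.End.mul_apply, tensorAct_ι_pow]
  simp only [map_sum, map_smul,
    tensorAct_of_mem_adjoin (fun x hx => apply_pow_eq_zero_of_stable hf hN _ hx) hb, contract_tmul]
  rcases k with _ | k
  · have h20 : η w = 0 := h2 0 (by norm_num)
    simp [h20]
  · rw [Finset.sum_eq_single (k, 1)]
    · simp [h1]
    · rintro ⟨x, y⟩ hxy hne
      rw [Finset.HasAntidiagonal.mem_antidiagonal] at hxy
      rw [h2 y, zero_smul, smul_zero]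
      rintro rfl
      exact hne (by simp_all)
    · intro h; exact absurd (by simp) h

/-- The formal derivative of the left side is the displayed sum. The right side contributes nothing,
because e and N kill w and η(w) = 0. -/
theorem sum_smul_mul_pow_eq_zero {D : L →ₗ⁅ℂ⁆ Module.End ℂ M} {N : Submodule ℂ L} {e f : L}
    (hf : ∀ x ∈ N, ⁅f, x⁆ ∈ N) {w : M} (hN : ∀ x ∈ N, D x w = 0) (he : D e w = 0) {η : M →ₗ[ℂ] ℂ}
    (h1 : η (D f w) = 1) (h2 : ∀ s, s ≠ 1 → η ((D f ^ s) w) = 0) {b c : ℕ → 𝒰 L} {K K' : ℕ}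
    (hb : ∀ k, b k ∈ Algebra.adjoin ℂ (UniversalEnvelopingAlgebra.ι ℂ '' (N : Set L)))
    (hc : ∀ k, c k ∈ Algebra.adjoin ℂ (UniversalEnvelopingAlgebra.ι ℂ '' (N : Set L)))
    (h : ∑ k ∈ Finset.range (K + 1), b k * UniversalEnvelopingAlgebra.ι ℂ f ^ k =
      ∑ k ∈ Finset.range K', c k * UniversalEnvelopingAlgebra.ι ℂ e ^ k) :
    ∑ k ∈ Finset.range K, (((k + 1 : ℕ) : ℂ) • b (k + 1)) *
      UniversalEnvelopingAlgebra.ι ℂ f ^ k = 0 := by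
  have h3 := congrArg (fun u => contract η (tensorAct D u (1 ⊗ₜ w))) h
  simp only [map_sum, LinearMap.sum_apply,
    contract_tensorAct_mul_pow hf hN h1 h2 (hb _)] at h3
  rw [Finset.sum_range_succ', Nat.cast_zero, zero_smul, add_zero] at h3
  simp only [smul_mul_assoc]
  refine h3.trans (Finset.sum_eq_zero fun k _ => ?_)
  have h20 : η w = 0 := h2 0 (by norm_num)
  rw [map_mul, Module.End.mul_apply, tensorAct_ι_pow_of_eq_zero D he,
    tensorAct_of_mem_adjoin hN (hc _), contract_tmul, h20, zero_smul]

/-- If `∑ b_k f^k = ∑ c_k e^k` with coefficients in the subalgebra generated by `N`, then `b_k = 0`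
for `k ≥ 1`. -/
theorem eq_zero_of_sum_mul_pow_eq {D : L →ₗ⁅ℂ⁆ Module.End ℂ M} {N : Submodule ℂ L} {e f : L}
    (hf : ∀ x ∈ N, ⁅f, x⁆ ∈ N) {w : M} (hN : ∀ x ∈ N, D x w = 0) (he : D e w = 0) {η : M →ₗ[ℂ] ℂ}
    (h1 : η (D f w) = 1) (h2 : ∀ s, s ≠ 1 → η ((D f ^ s) w) = 0) {K : ℕ} : ∀ {b c : ℕ → 𝒰 L}
    {K' : ℕ}
    (_ : ∀ k, b k ∈ Algebra.adjoin ℂ (UniversalEnvelopingAlgebra.ι ℂ '' (N : Set L)))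
    (_ : ∀ k, c k ∈ Algebra.adjoin ℂ (UniversalEnvelopingAlgebra.ι ℂ '' (N : Set L)))
    (_ : ∑ k ∈ Finset.range (K + 1), b k * UniversalEnvelopingAlgebra.ι ℂ f ^ k =
      ∑ k ∈ Finset.range K', c k * UniversalEnvelopingAlgebra.ι ℂ e ^ k),
    ∀ k, k < K → b (k + 1) = 0 := by
  induction K with
  | zero => intro b c K' _ _ _ k hk; exact absurd hk (by lia)
  | succ K ih =>
    intro b c K' hb hc h
    have h3 := sum_smul_mul_pow_eq_zero hf hN he h1 h2 hb hc h
    -- The differentiated identity has right side 0, so the induction applies to it with K' = 0 and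
    -- gives the coefficients of index at least 2; the coefficient of index 1 is then all that
    -- remains of `h3`.
    have h4 := ih (b := fun k => ((k + 1 : ℕ) : ℂ) • b (k + 1)) (c := c) (K' := 0)
      (fun k => Subalgebra.smul_mem _ (hb _) _) hc (by rw [h3, Finset.range_zero, Finset.sum_empty])
    have h5 : ∀ k, ((k + 1 : ℕ) : ℂ) ≠ 0 := fun k => by exact_mod_cast k.succ_ne_zero
    have h6 : ∀ k, k < K → b (k + 2) = 0 := fun k hk =>
      (smul_eq_zero.1 (h4 k hk)).resolve_left (h5 _)
    intro k hk
    rcases k with _ | k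
    · rw [Finset.sum_range_succ', Finset.sum_eq_zero, zero_add, pow_zero, mul_one] at h3
      · exact (smul_eq_zero.1 h3).resolve_left (h5 _)
      · intro k hk
        rw [h6 k (Finset.mem_range.1 hk), smul_zero, zero_mul]
    · exact h6 k (by lia)

/-- A form that is `1` on `f w` and vanishes on the other `f^s w`. -/
theorem exists_form_of_weight {e f h : Module.End ℂ M} (S : Sl2Ops e f h) {w : M} {m : ℂ}
    (hw : h w = m • w) (hfw : f w ≠ 0) :
    ∃ η : M →ₗ[ℂ] ℂ, η (f w) = 1 ∧ ∀ s, s ≠ 1 → η ((f ^ s) w) = 0 := by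
  have hmem : ∀ s : ℕ, (f ^ s) w ∈ h.eigenspace (m - 2 * s) := fun s =>
    Module.End.mem_eigenspace_iff.2 (S.h_f_pow_of_weight hw s)
  -- The vectors f^s w lie in distinct eigenspaces of h; η is taken to vanish on all eigenspaces
  -- other than that of f w.
  have hnot : f w ∉ ⨆ μ, ⨆ (_ : μ ≠ m - 2 * (1 : ℕ)), h.eigenspace μ := by
    intro h1
    have h2 := (h.eigenspaces_iSupIndep (m - 2 * (1 : ℕ))).le_bot ⟨by simpa using hmem 1, h1⟩
    exact hfw ((Submodule.mem_bot ℂ).1 h2)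
  obtain ⟨η, hη, hle⟩ := Submodule.exists_le_ker_of_notMem hnot
  refine ⟨(η (f w))⁻¹ • η, by simp [hη], fun s hs => ?_⟩
  have h3 : (m - 2 * s : ℂ) ≠ m - 2 * (1 : ℕ) := by
    intro h4
    apply hs
    have h5 : (s : ℂ) = (1 : ℕ) := by linear_combination -h4 / 2
    exact_mod_cast h5
  have h6 : η ((f ^ s) w) = 0 := hle (Submodule.mem_iSup_of_mem _ (Submodule.mem_iSup_of_mem h3 (hmem s)))
  rw [LinearMap.smul_apply, h6, smul_zero]

end Triangular

/-! ### The highest weight vector attached to 𝔫 -/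

section TriangularRoots

variable {L : Type*} [LieRing L] [LieAlgebra ℂ L] [FiniteDimensional ℂ L] [LieAlgebra.IsSimple ℂ L]
variable {H : LieSubalgebra ℂ L} [H.IsCartanSubalgebra] {Δ : (rootSystem H).Base}
  (R : RootVectors Δ) (i : Δ.support)

theorem trace_rootVector {N : Submodule ℂ L} {α : H.root} {x : L}
    (hx : x ∈ rootSpace H (α : LieModule.Weight ℂ H L))
    (hH : ∀ h : H, ∀ y ∈ N, LieAlgebra.ad ℂ L (h : L) y ∈ N)
    (hN : ∀ y ∈ N, LieAlgebra.ad ℂ L x y ∈ N) :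
    LinearMap.trace ℂ N ((LieAlgebra.ad ℂ L x).restrict hN) = 0 := by
  have h1 : ((α : LieModule.Weight ℂ H L) : H → ℂ) ≠ 0 := root_isNonZero α
  obtain ⟨t, ht⟩ := Function.ne_iff.1 h1
  exact trace_restrict_lie (hH t) hN hN ht (lie_coe_of_mem_rootSpace hx t)

/-- A vector of highest weight `2` for `e_i`, killed by the other positive roots. -/
theorem RootVectors.exists_highestWeight : ∃ w : MvPolynomial
      (Option (Fin (Module.finrank ℂ (nilSpan Δ i))) × Fin (Module.finrank ℂ L)) ℂ,
    w ≠ 0 ∧ (∀ x ∈ nilSpan Δ i, polyRep (adMatrix L) _ x w = 0) ∧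
      polyRep (adMatrix L) _ (R.e i) w = 0 ∧
      polyRep (adMatrix L) _ (simpleCoroot Δ i : L) w = (2 : ℂ) • w := by
  have hH : ∀ h : H, ∀ y ∈ nilSpan Δ i, LieAlgebra.ad ℂ L (h : L) y ∈ nilSpan Δ i :=
    fun h y hy => lie_cartan_mem_nilSpan i h hy
  have he : ∀ y ∈ nilSpan Δ i, LieAlgebra.ad ℂ L (R.e i) y ∈ nilSpan Δ i :=
    fun y hy => R.lie_e_mem_nilSpan i hy
  have hf : ∀ y ∈ nilSpan Δ i, LieAlgebra.ad ℂ L (R.f i) y ∈ nilSpan Δ i :=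
    fun y hy => R.lie_f_mem_nilSpan i hy
  -- The columns form a basis of 𝔫, so this is the highest weight line of the top exterior power of
  -- 𝔫. Here h_i acts by its trace on 𝔫: the value 2 from e_i, and 0 from `nilSpan`, where h_i =
  -- [e_i, f_i] is a commutator.
  refine ⟨minor fun c => Option.elim c (R.e i) fun k =>
    (Module.finBasis ℂ (nilSpan Δ i) k : L), minor_ne_zero ?_, fun x hx => ?_, ?_, ?_⟩
  · rw [linearIndependent_option]
    refine ⟨?_, ?_⟩
    · exact (Module.finBasis ℂ (nilSpan Δ i)).linearIndependent.map' (nilSpan Δ i).subtype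
        (Submodule.ker_subtype _)
    · intro h
      refine R.e_notMem_nilSpan i (Submodule.span_le.2 ?_ h)
      rintro _ ⟨k, rfl⟩
      exact (Module.finBasis ℂ (nilSpan Δ i) k).2
  · induction hx using Submodule.span_induction with
    | mem x hx =>
      obtain ⟨α, hα, hαi, hx'⟩ := hx
      have hx : x ∈ nilSpan Δ i := Submodule.subset_span ⟨α, hα, hαi, hx'⟩
      have hN : ∀ y ∈ nilSpan Δ i, LieAlgebra.ad ℂ L x y ∈ nilSpan Δ i := fun y hy =>
        lie_posSpan_mem_nilSpan i (nilSpan_le_posSpan i hx) (nilSpan_le_posSpan i hy)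
      have h1 := polyDer_minor_option (m := 0) (e := R.e i) hN (by
        rw [zero_smul, sub_zero, ← lie_skew]
        exact Submodule.neg_mem _ (R.lie_e_mem_nilSpan i hx))
      rw [trace_rootVector hx' hH, add_zero, zero_smul] at h1
      exact h1
    | zero => rw [map_zero]; rfl
    | add x y _ _ hx hy => rw [map_add, LinearMap.add_apply, hx, hy, add_zero]
    | smul c x _ hx => rw [map_smul, LinearMap.smul_apply, hx, smul_zero]
  · have h1 := polyDer_minor_option (m := 0) (e := R.e i) he (by
      rw [zero_smul, sub_zero, lie_self]; exact Submodule.zero_mem _)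
    rw [trace_rootVector (R.e_mem' i) hH, add_zero, zero_smul] at h1
    exact h1
  · have h1 := polyDer_minor_option (m := 2) (e := R.e i) (hH (simpleCoroot Δ i)) (by
      rw [R.lie_h_e, sub_self]; exact Submodule.zero_mem _)
    rw [trace_restrict_lie he hf _ one_ne_zero (by rw [one_smul]; exact R.lie_e_f i),
      add_zero] at h1
    exact h1

/-- The highest weight vector w has e_i f_i w = h_i w = 2w ≠ 0, so f_i w ≠ 0 and a form η detecting
f_i w exists. This is the only part of the triangular decomposition that is needed. -/
theorem RootVectors.eq_zero_of_sum_mul_uF_pow_eq {b c : ℕ → UniversalEnvelopingAlgebra ℂ L}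
    {K K' : ℕ} (hb : ∀ k, b k ∈ nilU Δ i) (hc : ∀ k, c k ∈ nilU Δ i)
    (h : ∑ k ∈ Finset.range (K + 1), b k * R.uF i ^ k = ∑ k ∈ Finset.range K', c k * R.uE i ^ k)
    {k : ℕ} (hk : k < K) : b (k + 1) = 0 := by
  obtain ⟨w, hw0, hN, he, hh⟩ := R.exists_highestWeight i
  have S : Sl2Ops (polyRep (adMatrix L) (Option (Fin (Module.finrank ℂ (nilSpan Δ i)))) (R.e i))
      (polyRep (adMatrix L) _ (R.f i)) (polyRep (adMatrix L) _ (simpleCoroot Δ i : L)) := by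
    refine ⟨fun v => ?_, fun v => ?_, fun v => ?_⟩
    · rw [← R.lie_e_f, LieHom.map_lie]; rfl
    · rw [← LinearMap.smul_apply, ← map_smul, ← R.lie_h_e, LieHom.map_lie]; rfl
    · rw [← LinearMap.smul_apply, ← map_smul, ← R.lie_h_f, LieHom.map_lie]; rfl
  have hfw : polyRep (adMatrix L) _ (R.f i) w ≠ 0 := by
    intro h1
    have h2 := S.ef w
    rw [h1, he, map_zero, map_zero, sub_zero, hh] at h2
    exact hw0 ((smul_eq_zero.1 h2.symm).resolve_left two_ne_zero)
  obtain ⟨η, h1, h2⟩ := exists_form_of_weight S hh hfw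
  exact eq_zero_of_sum_mul_pow_eq (fun x hx => R.lie_f_mem_nilSpan i hx) hN he h1 h2 hb hc h k hk

end TriangularRoots

/-! ### U(𝔫) in terms of U_i and e_i -/

section Decomposition

variable {L : Type*} [LieRing L] [LieAlgebra ℂ L] [FiniteDimensional ℂ L] [LieAlgebra.IsSimple ℂ L]
variable {H : LieSubalgebra ℂ L} [H.IsCartanSubalgebra] {Δ : (rootSystem H).Base}
  (R : RootVectors Δ) (i : Δ.support)

theorem adL_mem_nilU {x : L} (hx : ∀ y ∈ nilSpan Δ i, ⁅x, y⁆ ∈ nilSpan Δ i)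
    {z : UniversalEnvelopingAlgebra ℂ L} (hz : z ∈ nilU Δ i) :
    adL (UniversalEnvelopingAlgebra.ι ℂ x) z ∈ nilU Δ i := by
  obtain ⟨k, hk⟩ := exists_mem_nilFil hz
  exact nilFil_le k (adL_nilFil hx k z hk)

theorem RootVectors.uE_mul_mem_nilU {z : UniversalEnvelopingAlgebra ℂ L} (hz : z ∈ nilU Δ i) :
    R.uE i * z - z * R.uE i ∈ nilU Δ i := by
  have h := adL_mem_nilU i (fun y hy => R.lie_e_mem_nilSpan i hy) hz
  rwa [adL_apply] at h

/-- The subalgebra of `U(𝔫)` generated by the root spaces of the positive roots other than `α_i`. -/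
def nilUN (Δ : (rootSystem H).Base) (i : Δ.support) :
    Subalgebra ℂ (UniversalEnvelopingAlgebra ℂ (nPlus Δ)) :=
  Algebra.adjoin ℂ (UniversalEnvelopingAlgebra.ι ℂ '' {x : nPlus Δ | (x : L) ∈ nilSpan Δ i})

theorem map_nilUN : (nilUN Δ i).map (inclU Δ) = nilU Δ i := by
  rw [nilUN, AlgHom.map_adjoin, nilU]
  congr 1
  ext z
  constructor
  · rintro ⟨_, ⟨x, hx, rfl⟩, rfl⟩
    exact ⟨x, hx, (envIncl_ι x).symm⟩
  · rintro ⟨x, hx, rfl⟩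
    exact ⟨_, ⟨⟨x, nilSpan_le_nPlus i hx⟩, hx, rfl⟩, envIncl_ι _⟩

theorem exists_nilUN {z : UniversalEnvelopingAlgebra ℂ L} (hz : z ∈ nilU Δ i) :
    ∃ u ∈ nilUN Δ i, inclU Δ u = z := by
  rw [← map_nilUN] at hz
  exact hz

theorem RootVectors.inclU_eN : inclU Δ (UniversalEnvelopingAlgebra.ι ℂ (R.eN i)) = R.uE i := envIncl_ι _

/-- Powers of e_i are moved to the right by e_i a = a e_i + [e_i, a], where the commutator stays in
U_i. -/
theorem RootVectors.inclU_mem_span_mul_pow (u : UniversalEnvelopingAlgebra ℂ (nPlus Δ)) :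
    inclU Δ u ∈ Submodule.span ℂ {v | ∃ a ∈ nilU Δ i, ∃ k : ℕ, v = a * R.uE i ^ k} := by
  induction u using enveloping_induction with
  | one => rw [map_one]; exact Submodule.subset_span ⟨1, (nilU Δ i).one_mem, 0, by simp⟩
  | smul c u hu => rw [map_smul]; exact Submodule.smul_mem _ _ hu
  | add u v hu hv => rw [map_add]; exact Submodule.add_mem _ hu hv
  | ι_mul x u hu =>
    obtain ⟨y, hy, c, hxy⟩ := R.posSpan_decomp i ((mem_nPlus_iff i).1 x.2)
    have hx : inclU Δ (UniversalEnvelopingAlgebra.ι ℂ x) =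
        UniversalEnvelopingAlgebra.ι ℂ y + c • R.uE i := by
      rw [← map_smul, ← map_add, ← hxy]; exact envIncl_ι x
    rw [map_mul, hx]
    generalize inclU Δ u = v at hu ⊢
    induction hu using Submodule.span_induction with
    | mem v hv =>
      obtain ⟨a, ha, k, rfl⟩ := hv
      have h1 : (UniversalEnvelopingAlgebra.ι ℂ y + c • R.uE i) * (a * R.uE i ^ k) =
          (UniversalEnvelopingAlgebra.ι ℂ y * a + c • (R.uE i * a - a * R.uE i)) * R.uE i ^ k +
            c • (a * R.uE i ^ (k + 1)) := by
        simp only [add_mul, smul_mul_assoc, sub_mul, smul_sub, pow_succ', mul_assoc]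
        abel
      rw [h1]
      refine Submodule.add_mem _ (Submodule.subset_span ⟨_, ?_, k, rfl⟩)
        (Submodule.smul_mem _ _ (Submodule.subset_span ⟨a, ha, _, rfl⟩))
      exact (nilU Δ i).add_mem ((nilU Δ i).mul_mem (Algebra.subset_adjoin ⟨y, hy, rfl⟩) ha)
        ((nilU Δ i).smul_mem (R.uE_mul_mem_nilU i ha) c)
    | zero => rw [mul_zero]; exact Submodule.zero_mem _
    | add v w _ _ hv hw => rw [mul_add]; exact Submodule.add_mem _ hv hw
    | smul k v _ hv => rw [mul_smul_comm]; exact Submodule.smul_mem _ _ hv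

theorem RootVectors.exists_sum_mul_pow (u : UniversalEnvelopingAlgebra ℂ (nPlus Δ)) :
    ∃ (a : ℕ → UniversalEnvelopingAlgebra ℂ L) (K : ℕ), (∀ k, a k ∈ nilU Δ i) ∧
      inclU Δ u = ∑ k ∈ Finset.range (K + 1), a k * R.uE i ^ k := by
  suffices h : ∀ v ∈ Submodule.span ℂ {v | ∃ a ∈ nilU Δ i, ∃ k : ℕ, v = a * R.uE i ^ k},
      ∃ (a : ℕ → UniversalEnvelopingAlgebra ℂ L) (K : ℕ), (∀ k, a k ∈ nilU Δ i) ∧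
      ∀ K', K ≤ K' → v = ∑ k ∈ Finset.range K', a k * R.uE i ^ k by
    obtain ⟨a, K, ha, h⟩ := h _ (R.inclU_mem_span_mul_pow i u)
    exact ⟨a, K, ha, h _ (Nat.le_succ K)⟩
  intro v hv
  induction hv using Submodule.span_induction with
  | mem v hv =>
    obtain ⟨a, ha, k, rfl⟩ := hv
    refine ⟨fun j => if j = k then a else 0, k + 1, fun j => ?_, fun K' hK => ?_⟩
    · dsimp only
      split_ifs
      · exact ha
      · exact (nilU Δ i).zero_mem
    · simp only [ite_mul, zero_mul]
      rw [Finset.sum_ite_eq' (Finset.range K') k fun j => a * R.uE i ^ j,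
        if_pos (Finset.mem_range.2 hK)]
  | zero => exact ⟨0, 0, fun _ => (nilU Δ i).zero_mem, fun _ _ => by simp⟩
  | add v w _ _ hv hw =>
    obtain ⟨a, K, ha, h⟩ := hv
    obtain ⟨a', K', ha', h'⟩ := hw
    refine ⟨a + a', max K K', fun k => (nilU Δ i).add_mem (ha k) (ha' k), fun m hm => ?_⟩
    rw [h m (le_trans (le_max_left _ _) hm), h' m (le_trans (le_max_right _ _) hm),
      ← Finset.sum_add_distrib]
    exact Finset.sum_congr rfl fun k _ => (add_mul _ _ _).symm
  | smul c v _ hv =>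
    obtain ⟨a, K, ha, h⟩ := hv
    refine ⟨c • a, K, fun k => (nilU Δ i).smul_mem (ha k) c, fun m hm => ?_⟩
    rw [h m hm, Finset.smul_sum]
    exact Finset.sum_congr rfl fun k _ => (smul_mul_assoc _ _ _).symm

theorem RootVectors.sum_mul_pow_mem_range {a : ℕ → UniversalEnvelopingAlgebra ℂ L} (ha : ∀ k, a k ∈ nilU Δ i)
    (K : ℕ) : ∃ v, inclU Δ v = ∑ k ∈ Finset.range K, a k * R.uE i ^ k := by
  have h : ∑ k ∈ Finset.range K, a k * R.uE i ^ k ∈ (inclU Δ).range := by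
    refine Subalgebra.sum_mem _ fun k _ => Subalgebra.mul_mem _ ?_ (Subalgebra.pow_mem _ ?_ _)
    · obtain ⟨u, -, hu⟩ := exists_nilUN i (ha k)
      exact ⟨u, hu⟩
    · exact ⟨_, R.inclU_eN i⟩
  exact h

theorem RootVectors.exists_decomp_of_sum {a : ℕ → UniversalEnvelopingAlgebra ℂ L} (ha : ∀ k, a k ∈ nilU Δ i)
    (K : ℕ) : ∃ v, ∑ k ∈ Finset.range (K + 1), a k * R.uE i ^ k =
      a 0 + inclU Δ (v * UniversalEnvelopingAlgebra.ι ℂ (R.eN i)) := by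
  obtain ⟨v, hv⟩ := R.sum_mul_pow_mem_range i (fun k => ha (k + 1)) K
  refine ⟨v, ?_⟩
  rw [map_mul, hv, R.inclU_eN, Finset.sum_range_succ', Finset.sum_mul, pow_zero, mul_one, add_comm]
  simp only [pow_succ, mul_assoc]

/-- `U(𝔫) = U_i + U(𝔫) e_i`. -/
theorem RootVectors.exists_decomp (u : UniversalEnvelopingAlgebra ℂ (nPlus Δ)) :
    ∃ a ∈ nilU Δ i, ∃ v,
      inclU Δ u = a + inclU Δ (v * UniversalEnvelopingAlgebra.ι ℂ (R.eN i)) := by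
  obtain ⟨a, K, ha, hu⟩ := R.exists_sum_mul_pow i u
  obtain ⟨v, hv⟩ := R.exists_decomp_of_sum i ha K
  exact ⟨a 0, ha 0, v, hu.trans hv⟩

/-- `U(𝔫) = U_i + e_i U(𝔫)`. -/
theorem RootVectors.exists_decomp_left (u : UniversalEnvelopingAlgebra ℂ (nPlus Δ)) :
    ∃ a ∈ nilU Δ i, ∃ v,
      inclU Δ u = a + inclU Δ (UniversalEnvelopingAlgebra.ι ℂ (R.eN i) * v) := by
  suffices h : ∀ k, ∀ z ∈ nilU Δ i, ∃ a ∈ nilU Δ i, ∃ v ∈ (inclU Δ).range,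
      z * R.uE i ^ k = a + R.uE i * v by
    have h2 : ∀ v ∈ Submodule.span ℂ {v | ∃ a ∈ nilU Δ i, ∃ k : ℕ, v = a * R.uE i ^ k},
        ∃ a ∈ nilU Δ i, ∃ w ∈ (inclU Δ).range, v = a + R.uE i * w := by
      intro v hv
      induction hv using Submodule.span_induction with
      | mem v hv => obtain ⟨a, ha, k, rfl⟩ := hv; exact h k a ha
      | zero => exact ⟨0, (nilU Δ i).zero_mem, 0, Subalgebra.zero_mem _, by simp⟩
      | add v w _ _ hv hw =>
        obtain ⟨a, ha, b, hb, rfl⟩ := hv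
        obtain ⟨a', ha', b', hb', rfl⟩ := hw
        exact ⟨a + a', (nilU Δ i).add_mem ha ha', b + b', Subalgebra.add_mem _ hb hb', by
          rw [mul_add]; abel⟩
      | smul c v _ hv =>
        obtain ⟨a, ha, b, hb, rfl⟩ := hv
        exact ⟨c • a, (nilU Δ i).smul_mem ha c, c • b, Subalgebra.smul_mem _ hb c, by
          rw [smul_add, mul_smul_comm]⟩
    obtain ⟨a, ha, _, ⟨v, rfl⟩, hv⟩ := h2 _ (R.inclU_mem_span_mul_pow i u)
    exact ⟨a, ha, v, by rw [map_mul, R.inclU_eN]; exact hv⟩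
  intro k
  induction k with
  | zero =>
    intro z hz
    exact ⟨z, hz, 0, Subalgebra.zero_mem _, by simp⟩
  | succ k ih =>
    intro z hz
    obtain ⟨a, ha, v, hv, h1⟩ := ih z hz
    have hE : R.uE i ∈ (inclU Δ).range := ⟨_, R.inclU_eN i⟩
    have haR : a ∈ (inclU Δ).range := by
      obtain ⟨u, -, hu⟩ := exists_nilUN i ha
      exact ⟨u, hu⟩
    -- From z e^k = a + e v one gets z e^{k+1} = a e + e v e, and a e = e a - [e, a].
    refine ⟨-(R.uE i * a - a * R.uE i), (nilU Δ i).neg_mem (R.uE_mul_mem_nilU i ha),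
      a + v * R.uE i, Subalgebra.add_mem _ haR (Subalgebra.mul_mem _ hv hE), ?_⟩
    rw [pow_succ, ← mul_assoc, h1, add_mul, mul_add, mul_assoc]
    abel

/-- If `u` and `T_i u` lie in `U⁺`, then `T_i u = T_i a` for some `a ∈ U_i ∩ (u + U⁺ e_i)`. -/
theorem RootVectors.exists_decomp_T {u u' : UniversalEnvelopingAlgebra ℂ (nPlus Δ)}
    (h : R.T i (inclU Δ u) = inclU Δ u') : ∃ a ∈ nilU Δ i, ∃ v,
      inclU Δ u = a + inclU Δ (v * UniversalEnvelopingAlgebra.ι ℂ (R.eN i)) ∧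
        inclU Δ u' = R.T i a := by
  obtain ⟨a, K, ha, hu⟩ := R.exists_sum_mul_pow i u
  obtain ⟨c, K', hc, hu'⟩ := R.exists_sum_mul_pow i u'
  obtain ⟨v, hv⟩ := R.exists_decomp_of_sum i ha K
  refine ⟨a 0, ha 0, v, hu.trans hv, ?_⟩
  have h1 : R.T i (inclU Δ u) =
      ∑ k ∈ Finset.range (K + 1), ((-1 : ℂ) ^ k • R.T i (a k)) * R.uF i ^ k := by
    rw [hu, map_sum]
    refine Finset.sum_congr rfl fun k _ => ?_
    rw [map_mul, map_pow, R.T_uE, ← neg_one_smul ℂ, smul_pow, mul_smul_comm, smul_mul_assoc]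
  -- As T_i(e_i) = -f_i, the element T_i(u) expands in powers of f_i with coefficients in U_i. It
  -- also lies in U⁺, which forces the coefficients of positive powers to vanish.
  have h2 : ∀ k, k < K → (-1 : ℂ) ^ (k + 1) • R.T i (a (k + 1)) = 0 := fun k hk =>
    R.eq_zero_of_sum_mul_uF_pow_eq i (b := fun k => (-1 : ℂ) ^ k • R.T i (a k))
      (fun k => (nilU Δ i).smul_mem (R.T_mem_nilU i (ha k)) _) hc
      (h1.symm.trans (h.trans hu')) hk
  rw [← h, h1, Finset.sum_range_succ', Finset.sum_eq_zero, zero_add, pow_zero, pow_zero, mul_one,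
    one_smul]
  intro k hk
  rw [h2 k (Finset.mem_range.1 hk), zero_mul]

end Decomposition

/-! ### Perfect bases: strings and kernels of powers -/

section Strings

theorem opPow_succ' {B : Type*} (g : B → Option B) (n : ℕ) (b : B) :
    opPow g (n + 1) b = (opPow g n b).bind g := by
  induction n generalizing b with
  | zero => simp [opPow]
  | succ n ih =>
    change (g b).bind (opPow g (n + 1)) = ((g b).bind (opPow g n)).bind g
    rw [Option.bind_assoc]
    congr 1
    funext c
    exact ih c

theorem opPow_eq_some_iff {B : Type*} {e f : B → Option B}
    (h : ∀ b b', e b' = some b ↔ f b = some b') (n : ℕ) (b b' : B) :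
    opPow e n b = some b' ↔ opPow f n b' = some b := by
  induction n generalizing b with
  | zero => simp [opPow, eq_comm]
  | succ n ih =>
    rw [opPow_succ' f]
    change (e b).bind (opPow e n) = _ ↔ _
    simp only [Option.bind_eq_some_iff, ih, h]
    exact ⟨fun ⟨a, h1, h2⟩ => ⟨a, h2, h1⟩, fun ⟨a, h1, h2⟩ => ⟨a, h2, h1⟩⟩

variable {B V : Type*} [AddCommGroup V] [Module ℂ V]

/-- A basis whose elements are arranged in strings along which `E` acts as a lowering operator, up to
shorter strings. -/
structure StringBasis (v : Module.Basis B ℂ V) (e f : B → Option B) (ε : B → ℕ)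
    (E : Module.End ℂ V) : Prop where
  e_eq_iff : ∀ b b', e b' = some b ↔ f b = some b'
  eps_e : ∀ b b', e b = some b' → ε b = ε b' + 1
  exists_e : ∀ b, ε b ≠ 0 → ∃ b', e b = some b'
  compatible : ∀ b, E (v b) - (ε b : ℂ) • ((e b).elim 0 v) ∈
    Submodule.span ℂ (v '' {b' | ε b' + 1 < ε b})

namespace StringBasis

variable {v : Module.Basis B ℂ V} {e f : B → Option B} {ε : B → ℕ} {E : Module.End ℂ V}

theorem map_span (S : StringBasis v e f ε E) {m : ℕ} {F : V}
    (hF : F ∈ Submodule.span ℂ (v '' {b | ε b < m + 1})) :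
    E F ∈ Submodule.span ℂ (v '' {b | ε b < m}) := by
  induction hF using Submodule.span_induction with
  | mem F hF =>
    obtain ⟨b, hb, rfl⟩ := hF
    have hb : ε b < m + 1 := hb
    rw [← sub_add_cancel (E (v b)) ((ε b : ℂ) • ((e b).elim 0 v))]
    refine Submodule.add_mem _ (Submodule.span_mono (Set.image_mono fun b' hb' => ?_)
      (S.compatible b)) (Submodule.smul_mem _ _ ?_)
    · have hb' : ε b' + 1 < ε b := hb'
      change ε b' < m
      lia
    · rcases h : e b with _ | b'
      · exact Submodule.zero_mem _
      · have h1 := S.eps_e b b' h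
        exact Submodule.subset_span ⟨b', (by lia : ε b' < m), rfl⟩
  | zero => rw [map_zero]; exact Submodule.zero_mem _
  | add F G _ _ hF hG => rw [map_add]; exact Submodule.add_mem _ hF hG
  | smul c F _ hF => rw [map_smul]; exact Submodule.smul_mem _ _ hF

theorem pow_eq_zero (S : StringBasis v e f ε E) {m : ℕ} {F : V}
    (hF : F ∈ Submodule.span ℂ (v '' {b | ε b < m})) : (E ^ m) F = 0 := by
  induction m generalizing F with
  | zero => simpa using hF
  | succ m ih => rw [pow_succ, Module.End.mul_apply, ih (S.map_span hF)]

/-- If ε b = m + 1, the correction terms in E (v b) have ε < m and are killed by E^m. Only the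
leading term propagates, with factors m + 1, m, …, 1. -/
theorem pow_apply (S : StringBasis v e f ε E) {m : ℕ} {b : B} (hb : ε b = m) :
    ∃ b', opPow e m b = some b' ∧ (E ^ m) (v b) = (m.factorial : ℂ) • v b' := by
  induction m generalizing b with
  | zero => exact ⟨b, rfl, by simp⟩
  | succ m ih =>
    obtain ⟨c, hc⟩ := S.exists_e b (by lia)
    have h1 := S.eps_e b c hc
    obtain ⟨b', h2, h3⟩ := ih (b := c) (by lia)
    refine ⟨b', by rw [opPow, hc]; exact h2, ?_⟩
    have h4 := S.compatible b
    rw [hc, hb] at h4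
    have h5 := S.pow_eq_zero (m := m) (Submodule.span_mono (Set.image_mono fun d hd => by
      have hd : ε d + 1 < m + 1 := hd
      change ε d < m
      lia) h4)
    rw [map_sub, sub_eq_zero] at h5
    rw [pow_succ, Module.End.mul_apply, h5, map_smul, Option.elim_some, h3, smul_smul,
      Nat.factorial_succ]
    push_cast
    rfl

/-- On the span of the elements with ε ≤ m, E^m kills those with ε < m and moves the others to the
ends of their strings. Distinct elements with ε = m have distinct ends, as f retraces the string. -/
theorem coord_pow_apply (S : StringBasis v e f ε E) {m : ℕ} {b b' : B} (hb : ε b = m)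
    (hb' : opPow e m b = some b') {F : V} (hF : F ∈ Submodule.span ℂ (v '' {b | ε b < m + 1})) :
    v.coord b' ((E ^ m) F) = m.factorial * v.coord b F := by
  classical
  induction hF using Submodule.span_induction with
  | mem F hF =>
    obtain ⟨c, hc, rfl⟩ := hF
    have hc : ε c < m + 1 := hc
    rcases (Nat.lt_succ_iff.1 hc).lt_or_eq with hlt | heq
    · rw [S.pow_eq_zero (Submodule.subset_span ⟨c, hlt, rfl⟩), map_zero, v.coord_apply,
        v.repr_self_apply, if_neg, mul_zero]
      rintro rfl
      lia
    · obtain ⟨c', h1, h2⟩ := S.pow_apply heq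
      rw [h2, map_smul, v.coord_apply, v.coord_apply, v.repr_self_apply, v.repr_self_apply,
        smul_eq_mul]
      congr 1
      refine if_congr ⟨?_, ?_⟩ rfl rfl
      · rintro rfl
        rw [opPow_eq_some_iff S.e_eq_iff] at h1 hb'
        exact Option.some_injective _ (h1.symm.trans hb')
      · rintro rfl
        exact Option.some_injective _ (h1.symm.trans hb')
  | zero => simp
  | add F G _ _ hF hG => simp only [map_add, hF, hG, mul_add]
  | smul c F _ hF => simp only [map_smul, hF, smul_eq_mul]; ring

theorem mem_span_of_coord {m : ℕ} {F : V} (hF : F ∈ Submodule.span ℂ (v '' {b | ε b < m + 1}))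
    (h : ∀ b, ε b = m → v.coord b F = 0) : F ∈ Submodule.span ℂ (v '' {b | ε b < m}) := by
  rw [v.mem_span_image] at hF ⊢
  intro b hb
  have h1 : ε b < m + 1 := hF hb
  have h2 : ε b ≠ m := fun h3 => (Finsupp.mem_support_iff.1 hb) (h b h3)
  change ε b < m
  lia

theorem exists_mem_span (v : Module.Basis B ℂ V) (ε : B → ℕ) (F : V) :
    ∃ m, F ∈ Submodule.span ℂ (v '' {b | ε b < m}) := by
  have hF := v.mem_span F
  induction hF using Submodule.span_induction with
  | mem F hF =>
    obtain ⟨b, rfl⟩ := hF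
    exact ⟨ε b + 1, Submodule.subset_span ⟨b, Nat.lt_succ_self _, rfl⟩⟩
  | zero => exact ⟨0, Submodule.zero_mem _⟩
  | add F G _ _ hF hG =>
    obtain ⟨m, hF⟩ := hF
    obtain ⟨k, hG⟩ := hG
    exact ⟨max m k, Submodule.add_mem _
      (Submodule.span_mono (Set.image_mono fun b hb => lt_of_lt_of_le hb (le_max_left m k)) hF)
      (Submodule.span_mono (Set.image_mono fun b hb => lt_of_lt_of_le hb (le_max_right m k)) hG)⟩
  | smul c F _ hF =>
    obtain ⟨m, hF⟩ := hF
    exact ⟨m, Submodule.smul_mem _ _ hF⟩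

/-- Descent on the filtration by ε: while m ≥ k, E^m F = 0 shows that the coordinates of F on
elements with ε = m vanish. -/
theorem mem_span_of_pow_eq_zero (S : StringBasis v e f ε E) {k : ℕ} {F : V}
    (hF : (E ^ k) F = 0) : F ∈ Submodule.span ℂ (v '' {b | ε b < k}) := by
  obtain ⟨m, hm⟩ := exists_mem_span v ε F
  induction m with
  | zero =>
    have h : {b | ε b < 0} ⊆ {b | ε b < k} := fun b hb => absurd hb (Nat.not_lt_zero (ε b))
    exact Submodule.span_mono (Set.image_mono h) hm
  | succ m ih =>
    rcases lt_or_ge m k with h | h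
    · have h' : {b | ε b < m + 1} ⊆ {b | ε b < k} := fun b hb =>
        lt_of_lt_of_le (show ε b < m + 1 from hb) h
      exact Submodule.span_mono (Set.image_mono h') hm
    · refine ih (mem_span_of_coord hm fun b hb => ?_)
      obtain ⟨b', hb', -⟩ := S.pow_apply hb
      have h1 := S.coord_pow_apply hb hb' hm
      rw [← Nat.sub_add_cancel h, pow_add, Module.End.mul_apply, hF, map_zero, map_zero,
        zero_eq_mul] at h1
      exact h1.resolve_left (by exact_mod_cast Nat.factorial_ne_zero _)

theorem exists_pow_eq_zero (S : StringBasis v e f ε E) (F : V) : ∃ m, (E ^ m) F = 0 := by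
  obtain ⟨m, hm⟩ := exists_mem_span v ε F
  exact ⟨m, S.pow_eq_zero hm⟩

theorem pow_succ_eq_zero (S : StringBasis v e f ε E) (b : B) : (E ^ (ε b + 1)) (v b) = 0 :=
  S.pow_eq_zero (Submodule.subset_span ⟨b, Nat.lt_succ_self _, rfl⟩)

/-- Some basis element in the support of `F` is moved by `e^p` to `b`. -/
theorem exists_of_pow_apply (S : StringBasis v e f ε E) {p : ℕ} {b : B} {F : V}
    (hF : (E ^ (p + 1)) F = 0) (hb : (E ^ p) F = (p.factorial : ℂ) • v b) :
    ∃ x, v.coord x F ≠ 0 ∧ ε x = p ∧ opPow e p x = some b := by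
  classical
  have h1 := S.mem_span_of_pow_eq_zero hF
  have hp : (p.factorial : ℂ) ≠ 0 := by exact_mod_cast p.factorial_ne_zero
  -- Without such an x, F would lie in the span of the elements with ε < p, and E^p F would be 0.
  have h2 : ∃ x, v.coord x F ≠ 0 ∧ ε x = p := by
    by_contra! h
    have h3 := S.pow_eq_zero (mem_span_of_coord h1 fun x hx => by
      by_contra h4
      exact h x h4 hx)
    rw [hb] at h3
    exact v.ne_zero b ((smul_eq_zero.1 h3).resolve_left hp)
  obtain ⟨x, hx, hxp⟩ := h2
  refine ⟨x, hx, hxp, ?_⟩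
  obtain ⟨x', hx', -⟩ := S.pow_apply hxp
  have h3 := S.coord_pow_apply hxp hx' h1
  rw [hb, map_smul, smul_eq_mul] at h3
  have h4 : v.coord x' (v b) ≠ 0 := by
    rw [mul_left_cancel₀ hp h3]; exact hx
  rw [v.coord_apply, v.repr_self_apply] at h4
  rw [hx', (ite_ne_right_iff.1 h4).1]

theorem eps_le_of_pow_eq_zero (S : StringBasis v e f ε E) {k : ℕ} {F : V} (hF : (E ^ k) F = 0)
    {x : B} (hx : v.coord x F ≠ 0) : ε x < k :=
  v.mem_span_image.1 (S.mem_span_of_pow_eq_zero hF) (Finsupp.mem_support_iff.2 hx)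

theorem eps_eq (S : StringBasis v e f ε E) {k : ℕ} {x : B} (h : (E ^ k) (v x) ≠ 0)
    (h' : (E ^ (k + 1)) (v x) = 0) : ε x = k := by
  classical
  have h1 := S.eps_le_of_pow_eq_zero h' (x := x) (by
    rw [v.coord_apply, v.repr_self_apply, if_pos rfl]; exact one_ne_zero)
  by_contra h2
  exact h (S.pow_eq_zero (Submodule.subset_span ⟨x, (by lia : ε x < k), rfl⟩))

end StringBasis

/-- Upper semi-normality makes ε_i a natural number, positive exactly when ẽ_i can be applied. So
each index i gives a `StringBasis` with values of ε in ℕ. -/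
theorem Crystal.stringBasis {I P : Type*} [AddCommGroup P] {α : I → P} {h : I → P →+ ℤ}
    {C : Crystal α h B} (hC : C.IsUpperSemiNormal) {v : Module.Basis B ℂ V}
    {E : I → Module.End ℂ V} (hE : C.IsCompatible v E) (i : I) :
    ∃ ε : B → ℕ, (∀ b, C.ε i b = ((ε b : ℤ) : WithBot ℤ)) ∧
      StringBasis v (C.e i) (C.f i) ε (E i) := by
  choose ε hε hg using fun b => (hC i b).2
  refine ⟨ε, hε, C.e_eq_iff i, fun b b' hb => ?_, fun b hb => ?_, fun b => ?_⟩
  · have h1 := C.ε_e i b b' hb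
    rw [hε, hε] at h1
    exact_mod_cast h1
  · have h1 : opPow (C.e i) (ε b) b ≠ none := (hg b).1
    obtain ⟨m, hm⟩ := Nat.exists_eq_succ_of_ne_zero hb
    rw [hm, opPow] at h1
    rcases h2 : C.e i b with _ | b'
    · rw [h2] at h1; exact absurd rfl h1
    · exact ⟨b', rfl⟩
  · have h1 := hE i b (ε b) (hε b)
    rw [Int.cast_natCast] at h1
    refine Submodule.span_mono (Set.image_mono fun b' hb' => ?_) h1
    have h2 : C.ε i b' < (((ε b : ℤ) - 1 : ℤ) : WithBot ℤ) := hb'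
    rw [hε, WithBot.coe_lt_coe] at h2
    change ε b' + 1 < ε b
    lia

end Strings

/-! ### The coordinate ζ dual to e_i -/

section SimpleRootCoordinate

variable {L : Type*} [LieRing L] [LieAlgebra ℂ L] {d : ℕ}

/-- The pairing between `ℂ[N]` and `U(𝔫)` as a bilinear map. -/
def pairingHom (ρ : L →ₗ⁅ℂ⁆ Matrix (Fin d) (Fin d) ℂ) (𝔫 : LieSubalgebra ℂ L) :
    coordRing ρ 𝔫 →ₗ[ℂ] UniversalEnvelopingAlgebra ℂ 𝔫 →ₗ[ℂ] ℂ :=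
  LinearMap.mk₂ ℂ pairing pairing_add_left pairing_smul_left
    (fun F u v => by simp [pairing]) (fun c F u => by simp [pairing])

theorem pairingHom_apply {ρ : L →ₗ⁅ℂ⁆ Matrix (Fin d) (Fin d) ℂ} {𝔫 : LieSubalgebra ℂ L}
    (F : coordRing ρ 𝔫) (u : UniversalEnvelopingAlgebra ℂ 𝔫) :
    pairingHom ρ 𝔫 F u = pairing F u := rfl

theorem pairing_one_right {ρ : L →ₗ⁅ℂ⁆ Matrix (Fin d) (Fin d) ℂ} {𝔫 : LieSubalgebra ℂ L}
    (F : coordRing ρ 𝔫) : pairing F 1 = (F : unipotentGroup ρ 𝔫 → ℂ) 1 := by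
  rw [pairing, map_one]; rfl

variable [FiniteDimensional ℂ L] [LieAlgebra.IsSimple ℂ L]
variable {H : LieSubalgebra ℂ L} [H.IsCartanSubalgebra] {Δ : (rootSystem H).Base}
variable {ρ : L →ₗ⁅ℂ⁆ Matrix (Fin d) (Fin d) ℂ}

/-- By `pairing_res` the pairing factors through the image in U(𝔤), so the injectivity of U(𝔫) →
U(𝔤) is never needed. -/
theorem pairing_congr {F : coordRing ρ (nPlus Δ)}
    {u v : UniversalEnvelopingAlgebra ℂ (nPlus Δ)} (h : inclU Δ u = inclU Δ v) :
    pairing F u = pairing F v := by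
  obtain ⟨P, rfl⟩ := res_surjective F
  rw [pairing_res, pairing_res]
  exact congrArg (ell ρ P) h

/-- Homogeneity gives c ⟨F, u⟩ = -μ(h) ⟨F, u⟩. -/
theorem pairing_eq_zero_of_weight (i : Δ.support) {μ : Module.Dual ℂ H}
    {F : coordRing ρ (nPlus Δ)} (hF : IsHomogeneous μ F) {h : H} {c : ℂ}
    {u : UniversalEnvelopingAlgebra ℂ (nPlus Δ)}
    (hu : adL (UniversalEnvelopingAlgebra.ι ℂ (h : L)) (inclU Δ u) = c • inclU Δ u)
    (hc : c ≠ -μ h) : pairing F u = 0 := by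
  obtain ⟨P, rfl⟩ := res_surjective F
  have h1 := ell_lie_of_homogeneous i hF h u
  rw [← adL_apply, hu, map_smul, smul_eq_mul] at h1
  have h2 : ell ρ P (inclU Δ u) = pairing (res ρ (nPlus Δ) P) u := (pairing_res P u).symm
  rw [h2] at h1
  by_contra h3
  exact hc (mul_right_cancel₀ h3 h1)

/-- The span of the elements of `U(𝔫)` of positive height. -/
def posWeight (Δ : (rootSystem H).Base) :
    Submodule ℂ (UniversalEnvelopingAlgebra ℂ (nPlus Δ)) :=
  Submodule.span ℂ {u | ∃ s : ℤ, 0 < s ∧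
    adL (UniversalEnvelopingAlgebra.ι ℂ (heightVector Δ : L)) (inclU Δ u) = (s : ℂ) • inclU Δ u}

theorem adL_height_mul {u v : UniversalEnvelopingAlgebra ℂ (nPlus Δ)} {s t : ℤ}
    (hu : adL (UniversalEnvelopingAlgebra.ι ℂ (heightVector Δ : L)) (inclU Δ u) =
      (s : ℂ) • inclU Δ u)
    (hv : adL (UniversalEnvelopingAlgebra.ι ℂ (heightVector Δ : L)) (inclU Δ v) =
      (t : ℂ) • inclU Δ v) :
    adL (UniversalEnvelopingAlgebra.ι ℂ (heightVector Δ : L)) (inclU Δ (u * v)) =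
      ((s + t : ℤ) : ℂ) • inclU Δ (u * v) := by
  rw [map_mul, adL_mul, hu, hv, smul_mul_assoc, mul_smul_comm, ← add_smul]
  push_cast
  rfl

theorem adL_inclU_ι {α : H.root} {x : nPlus Δ}
    (hx : (x : L) ∈ rootSpace H (α : LieModule.Weight ℂ H L)) (h : H) :
    adL (UniversalEnvelopingAlgebra.ι ℂ (h : L))
      (inclU Δ (UniversalEnvelopingAlgebra.ι ℂ x)) =
      ((α : LieModule.Weight ℂ H L) h) • inclU Δ (UniversalEnvelopingAlgebra.ι ℂ x) := by
  have h1 : inclU Δ (UniversalEnvelopingAlgebra.ι ℂ x) = UniversalEnvelopingAlgebra.ι ℂ (x : L) :=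
    envIncl_ι x
  rw [h1, adL_ι, lie_coe_of_mem_rootSpace hx, map_smul]

theorem adL_height_ι {α : H.root} {x : nPlus Δ}
    (hx : (x : L) ∈ rootSpace H (α : LieModule.Weight ℂ H L)) :
    adL (UniversalEnvelopingAlgebra.ι ℂ (heightVector Δ : L))
      (inclU Δ (UniversalEnvelopingAlgebra.ι ℂ x)) =
      ((Δ.height α : ℤ) : ℂ) • inclU Δ (UniversalEnvelopingAlgebra.ι ℂ x) := by
  rw [adL_inclU_ι hx, root_heightVector]

theorem adL_height_one :
    adL (UniversalEnvelopingAlgebra.ι ℂ (heightVector Δ : L)) (inclU Δ 1) =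
      ((0 : ℤ) : ℂ) • inclU Δ 1 := by
  rw [map_one, adL_one, Int.cast_zero, zero_smul]

theorem nPlus_induction (i : Δ.support) {C : nPlus Δ → Prop}
    (root : ∀ (α : H.root) (x : nPlus Δ), Δ.IsPos α →
      (x : L) ∈ rootSpace H (α : LieModule.Weight ℂ H L) → C x)
    (zero : C 0) (add : ∀ x y, C x → C y → C (x + y)) (smul : ∀ (c : ℂ) x, C x → C (c • x))
    (x : nPlus Δ) : C x := by
  obtain ⟨x, hx⟩ := x
  have h := (mem_nPlus_iff i).1 hx
  suffices h' : ∃ hx', C ⟨x, hx'⟩ from h'.2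
  clear hx
  induction h using Submodule.span_induction with
  | mem x hx =>
    obtain ⟨α, hα, hx⟩ := hx
    exact ⟨(mem_nPlus_iff i).2 (Submodule.subset_span ⟨α, hα, hx⟩), root α _ hα hx⟩
  | zero => exact ⟨_, zero⟩
  | add x y _ _ hx hy =>
    obtain ⟨hx, hCx⟩ := hx
    obtain ⟨hy, hCy⟩ := hy
    exact ⟨_, add ⟨x, hx⟩ ⟨y, hy⟩ hCx hCy⟩
  | smul c x _ hx =>
    obtain ⟨hx, hCx⟩ := hx
    exact ⟨_, smul c ⟨x, hx⟩ hCx⟩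

/-- A nonempty word in positive root vectors has positive height. -/
theorem exists_sub_smul_one_mem_posWeight (i : Δ.support)
    (u : UniversalEnvelopingAlgebra ℂ (nPlus Δ)) : ∃ c : ℂ, u - c • 1 ∈ posWeight Δ := by
  have key : ∀ (x : nPlus Δ) (v : UniversalEnvelopingAlgebra ℂ (nPlus Δ)) (s : ℤ), 0 ≤ s →
      adL (UniversalEnvelopingAlgebra.ι ℂ (heightVector Δ : L)) (inclU Δ v) =
        (s : ℂ) • inclU Δ v → UniversalEnvelopingAlgebra.ι ℂ x * v ∈ posWeight Δ := by
    intro x v s hs hv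
    induction x using nPlus_induction i with
    | root α x hα hx =>
      have h1 : 0 < Δ.height α := hα
      exact Submodule.subset_span ⟨Δ.height α + s, by lia, adL_height_mul (adL_height_ι hx) hv⟩
    | zero => rw [map_zero, zero_mul]; exact Submodule.zero_mem _
    | add x y hx hy => rw [map_add, add_mul]; exact Submodule.add_mem _ hx hy
    | smul c x hx => rw [map_smul, smul_mul_assoc]; exact Submodule.smul_mem _ _ hx
  induction u using enveloping_induction with
  | one => exact ⟨1, by rw [one_smul, sub_self]; exact Submodule.zero_mem _⟩
  | smul c u hu =>
    obtain ⟨a, ha⟩ := hu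
    exact ⟨c * a, by rw [mul_smul, ← smul_sub]; exact Submodule.smul_mem _ _ ha⟩
  | add u v hu hv =>
    obtain ⟨a, ha⟩ := hu
    obtain ⟨b, hb⟩ := hv
    refine ⟨a + b, ?_⟩
    rw [add_smul, add_sub_add_comm]
    exact Submodule.add_mem _ ha hb
  | ι_mul x u hu =>
    obtain ⟨c, hc⟩ := hu
    refine ⟨0, ?_⟩
    rw [zero_smul, sub_zero, ← sub_add_cancel u (c • 1), mul_add]
    refine Submodule.add_mem _ ?_ ?_
    · generalize u - c • 1 = v at hc
      induction hc using Submodule.span_induction with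
      | mem v hv =>
        obtain ⟨s, hs, hv⟩ := hv
        exact key x v s hs.le hv
      | zero => rw [mul_zero]; exact Submodule.zero_mem _
      | add v w _ _ hv hw => rw [mul_add]; exact Submodule.add_mem _ hv hw
      | smul a v _ hv => rw [mul_smul_comm]; exact Submodule.smul_mem _ _ hv
    · rw [mul_smul_comm]
      exact Submodule.smul_mem _ _ (key x 1 0 le_rfl adL_height_one)

/-- A linear form on `U(𝔫)` that vanishes on the vectors of positive height is determined by its
value at `1`. -/
theorem linearForm_ext_of_posWeight (i : Δ.support)
    {φ ψ : UniversalEnvelopingAlgebra ℂ (nPlus Δ) →ₗ[ℂ] ℂ}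
    (hφ : ∀ (s : ℤ) u, 0 < s → adL (UniversalEnvelopingAlgebra.ι ℂ (heightVector Δ : L))
      (inclU Δ u) = (s : ℂ) • inclU Δ u → φ u = ψ u) (h1 : φ 1 = ψ 1) : φ = ψ := by
  refine LinearMap.ext fun u => ?_
  obtain ⟨c, hc⟩ := exists_sub_smul_one_mem_posWeight i u
  have h2 : ∀ v ∈ posWeight Δ, φ v = ψ v := by
    intro v hv
    induction hv using Submodule.span_induction with
    | mem v hv =>
      obtain ⟨s, hs, hv⟩ := hv
      exact hφ s v hs hv
    | zero => rw [map_zero, map_zero]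
    | add v w _ _ hv hw => rw [map_add, map_add, hv, hw]
    | smul a v _ hv => rw [map_smul, map_smul, hv]
  rw [← sub_add_cancel u (c • 1), map_add, map_add, map_smul, map_smul, h1, h2 _ hc]

theorem isHomogeneous_one {H : LieSubalgebra ℂ L} {𝔫 : LieSubalgebra ℂ L} :
    IsHomogeneous (0 : Module.Dual ℂ H) (1 : coordRing ρ 𝔫) := by
  intro h m n _
  simp

variable (R : RootVectors Δ) (i : Δ.support)

/-- The matrix entries pair with e_i to the entries of ρ(e_i), which is nonzero as ρ is injective.
-/
theorem RootVectors.exists_pairing_e_ne_zero (hρ : Function.Injective ρ) {B : Type*}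
    (v : Module.Basis B ℂ (coordRing ρ (nPlus Δ))) :
    ∃ b, pairing (v b) (UniversalEnvelopingAlgebra.ι ℂ (R.eN i)) ≠ 0 := by
  by_contra! h
  have h1 : ∀ F : coordRing ρ (nPlus Δ), pairing F (UniversalEnvelopingAlgebra.ι ℂ (R.eN i)) = 0 := by
    have h2 : (pairingHom ρ (nPlus Δ)).flip (UniversalEnvelopingAlgebra.ι ℂ (R.eN i)) = 0 :=
      v.ext fun b => h b
    exact fun F => LinearMap.congr_fun h2 F
  apply R.e_ne_zero i
  apply hρ
  rw [map_zero]
  ext p q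
  have h2 := h1 ⟨entry ρ (nPlus Δ) p q, entry_mem p q⟩
  rw [← one_mul (UniversalEnvelopingAlgebra.ι ℂ (R.eN i)), pairing_mul_ι, pairing_one_right] at h2
  have h3 : leftAction ρ (nPlus Δ) (R.eN i) ⟨entry ρ (nPlus Δ) p q, entry_mem p q⟩ =
      ∑ k, ρ (R.e i) k q • (⟨entry ρ (nPlus Δ) p k, entry_mem p k⟩ : coordRing ρ (nPlus Δ)) :=
    leftDerivation_entry (R.eN i) p q
  rw [h3] at h2
  have h4 : toMat (1 : unipotentGroup ρ (nPlus Δ)) = 1 := rfl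
  simpa [entry, h4, Matrix.one_apply] using h2

/-- The function `ζ` on `N` dual to `e_i`. -/
theorem RootVectors.exists_coordinate (hρ : Function.Injective ρ) {B : Type*}
    (v : Module.Basis B ℂ (coordRing ρ (nPlus Δ))) (μ : B → Module.Dual ℂ H)
    (hv : ∀ b, IsHomogeneous (μ b) (v b)) :
    ∃ ζ : coordRing ρ (nPlus Δ), leftAction ρ (nPlus Δ) (R.eN i) ζ = 1 ∧
      rightAction ρ (R.eN i) ζ = 1 ∧
      (∀ x : nPlus Δ, (x : L) ∈ nilSpan Δ i → leftAction ρ (nPlus Δ) x ζ = 0) ∧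
      (ζ : unipotentGroup ρ (nPlus Δ) → ℂ) 1 = 0 := by
  obtain ⟨b, hb⟩ := R.exists_pairing_e_ne_zero i hρ v
  -- A nonzero pairing with e_i forces the basis element to have weight -α_i; in particular it pairs
  -- to 0 with every element of height other than 1.
  have hroot : ∀ h : H, ((i : H.root) : LieModule.Weight ℂ H L) h = -μ b h := by
    intro h
    by_contra h1
    exact hb (pairing_eq_zero_of_weight i (hv b) (adL_inclU_ι (x := R.eN i) (R.e_mem' i) h) h1)
  have hone : ∀ (s : ℤ) u, s ≠ 1 → adL (UniversalEnvelopingAlgebra.ι ℂ (heightVector Δ : L))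
      (inclU Δ u) = (s : ℂ) • inclU Δ u → pairing (v b) u = 0 := by
    intro s u hs hu
    refine pairing_eq_zero_of_weight i (hv b) hu ?_
    rw [← hroot, root_heightVector, RootPairing.Base.height_one_of_mem_support i.2]
    exact_mod_cast hs
  have hzero : ∀ (s : ℤ) u, 0 < s → adL (UniversalEnvelopingAlgebra.ι ℂ (heightVector Δ : L))
      (inclU Δ u) = (s : ℂ) • inclU Δ u → pairing (1 : coordRing ρ (nPlus Δ)) u = 0 := by
    intro s u hs hu
    refine pairing_eq_zero_of_weight i (isHomogeneous_one (H := H)) hu ?_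
    rw [LinearMap.zero_apply, neg_zero]
    exact_mod_cast hs.ne'
  set c := pairing (v b) (UniversalEnvelopingAlgebra.ι ℂ (R.eN i)) with hc
  have heh : adL (UniversalEnvelopingAlgebra.ι ℂ (heightVector Δ : L))
      (inclU Δ (UniversalEnvelopingAlgebra.ι ℂ (R.eN i))) =
      ((1 : ℤ) : ℂ) • inclU Δ (UniversalEnvelopingAlgebra.ι ℂ (R.eN i)) := by
    rw [adL_height_ι (x := R.eN i) (R.e_mem' i), RootPairing.Base.height_one_of_mem_support i.2]
  have h11 : pairing (1 : coordRing ρ (nPlus Δ)) 1 = 1 := by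
    rw [pairing_one_right]; rfl
  have hl : leftAction ρ (nPlus Δ) (R.eN i) (v b) = c • 1 := by
    have h1 : pairingHom ρ (nPlus Δ) (leftAction ρ (nPlus Δ) (R.eN i) (v b)) =
        pairingHom ρ (nPlus Δ) (c • 1) := by
      refine linearForm_ext_of_posWeight i (fun s u hs hu => ?_) ?_
      · rw [pairingHom_apply, pairingHom_apply, pairing_smul_left, hzero s u hs hu, mul_zero,
          ← pairing_mul_ι]
        exact hone (s + 1) _ (by lia) (adL_height_mul hu heh)
      · rw [pairingHom_apply, pairingHom_apply, pairing_smul_left, h11, ← pairing_mul_ι, one_mul,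
          mul_one]
    exact eq_of_pairing_eq fun u => LinearMap.congr_fun h1 u
  have hr : rightAction ρ (R.eN i) (v b) = c • 1 := by
    have h1 : pairingHom ρ (nPlus Δ) (rightAction ρ (R.eN i) (v b)) =
        pairingHom ρ (nPlus Δ) (c • 1) := by
      refine linearForm_ext_of_posWeight i (fun s u hs hu => ?_) ?_
      · rw [pairingHom_apply, pairingHom_apply, pairing_smul_left, hzero s u hs hu, mul_zero,
          ← pairing_ι_mul]
        exact hone (1 + s) _ (by lia) (adL_height_mul heh hu)
      · rw [pairingHom_apply, pairingHom_apply, pairing_smul_left, h11, ← pairing_ι_mul, mul_one,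
          mul_one]
    exact eq_of_pairing_eq fun u => LinearMap.congr_fun h1 u
  -- For a root vector x the form u ↦ ⟨v b, u x⟩ vanishes in positive height, and also at 1, since x
  -- has weight α ≠ α_i. The existential over membership lets the induction run on the span inside
  -- L.
  have hnil : ∀ x : L, x ∈ nilSpan Δ i → ∃ hx : x ∈ nPlus Δ,
      leftAction ρ (nPlus Δ) ⟨x, hx⟩ (v b) = 0 := by
    intro x hx
    induction hx using Submodule.span_induction with
    | mem x hx =>
      obtain ⟨α, hα, hαi, hx⟩ := hx
      have hxn : x ∈ nPlus Δ :=
        nilSpan_le_nPlus i (Submodule.subset_span ⟨α, hα, hαi, hx⟩)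
      refine ⟨hxn, ?_⟩
      have hpos : 0 < Δ.height α := hα
      have h1 : pairingHom ρ (nPlus Δ) (leftAction ρ (nPlus Δ) ⟨x, hxn⟩ (v b)) = 0 := by
        refine linearForm_ext_of_posWeight i (fun s u hs hu => ?_) ?_
        · rw [pairingHom_apply, ← pairing_mul_ι]
          exact hone (s + Δ.height α) _ (by lia)
            (adL_height_mul hu (adL_height_ι (x := ⟨x, hxn⟩) hx))
        · rw [pairingHom_apply, ← pairing_mul_ι, one_mul]
          have hne : ((α : LieModule.Weight ℂ H L) : H → ℂ) ≠
              ((i : H.root) : LieModule.Weight ℂ H L) := fun h =>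
            hαi (Subtype.ext (DFunLike.coe_injective h))
          obtain ⟨t, ht⟩ := Function.ne_iff.1 hne
          refine pairing_eq_zero_of_weight i (hv b) (adL_inclU_ι (x := ⟨x, hxn⟩) hx t) ?_
          rwa [← hroot]
      exact eq_zero_of_pairing_eq_zero _ fun u => LinearMap.congr_fun h1 u
    | zero => exact ⟨(nPlus Δ).zero_mem, LinearMap.congr_fun (map_zero (leftAction ρ (nPlus Δ))) _⟩
    | add x y _ _ hx hy =>
      obtain ⟨hx, h1⟩ := hx
      obtain ⟨hy, h2⟩ := hy
      refine ⟨(nPlus Δ).add_mem hx hy, ?_⟩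
      have h3 := LinearMap.congr_fun (map_add (leftAction ρ (nPlus Δ)) ⟨x, hx⟩ ⟨y, hy⟩) (v b)
      rw [LinearMap.add_apply, h1, h2, add_zero] at h3
      exact h3
    | smul a x _ hx =>
      obtain ⟨hx, h1⟩ := hx
      refine ⟨(nPlus Δ).smul_mem a hx, ?_⟩
      have h3 := LinearMap.congr_fun (map_smul (leftAction ρ (nPlus Δ)) a ⟨x, hx⟩) (v b)
      rw [LinearMap.smul_apply, h1, smul_zero] at h3
      exact h3
  refine ⟨c⁻¹ • v b, ?_, ?_, fun x hx => ?_, ?_⟩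
  · rw [map_smul, hl, smul_smul, inv_mul_cancel₀ hb, one_smul]
  · rw [map_smul, hr, smul_smul, inv_mul_cancel₀ hb, one_smul]
  · obtain ⟨hx', h1⟩ := hnil x hx
    rw [map_smul, h1, smul_zero]
  · rw [← pairing_one_right, pairing_smul_left, hone 0 1 (by lia) adL_height_one, mul_zero]

end SimpleRootCoordinate

/-! ### A lowest weight vector in V ⊗ V(p) -/

section SequenceVector

variable {V : Type*} [AddCommGroup V] [Module ℂ V] {e f h : Module.End ℂ V}

/-- The vector `∑ (-1)^{p-j} f^{(p-j)} v ⊗ s^j`, with divided powers of `f`. -/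
def lowestSeq (p : ℕ) (F : ℕ → V) (j : ℕ) : V :=
  if j ≤ p then ((-1 : ℂ) ^ (p - j) * ((p - j).factorial : ℂ)⁻¹) • F (p - j) else 0

theorem lowestSeq_of_lt {p j : ℕ} (F : ℕ → V) (hj : p < j) : lowestSeq p F j = 0 :=
  if_neg (not_le.2 hj)

theorem lowestSeq_self (p : ℕ) (F : ℕ → V) : lowestSeq p F p = F 0 := by
  simp [lowestSeq]

/-- In each degree from 1 to p, f acting on the coefficient cancels f acting on the preceding power
of s. Degree 0 uses f^{p+1} v = 0. -/
theorem seqF_lowestSeq {v : V} {p : ℕ} (hf : (f ^ (p + 1)) v = 0) :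
    seqF p f (lowestSeq p fun r => (f ^ r) v) = 0 := by
  funext j
  have hsucc : ∀ r, f ((f ^ r) v) = (f ^ (r + 1)) v := fun r => by
    rw [pow_succ', Module.End.mul_apply]
  rcases j with _ | j
  · rw [seqF_apply_zero, lowestSeq, if_pos (Nat.zero_le p), map_smul, Nat.sub_zero, hsucc, hf,
      smul_zero]
    rfl
  · rw [seqF_apply_succ]
    rcases lt_trichotomy j p with h1 | h1 | h1
    · obtain ⟨r, rfl⟩ := Nat.exists_eq_add_of_lt h1
      have e1 : j + r + 1 - (j + 1) = r := by lia
      have e2 : j + r + 1 - j = r + 1 := by lia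
      rw [lowestSeq, lowestSeq, if_pos (by lia), if_pos (by lia), e1, e2, map_smul, hsucc, smul_smul,
        ← add_smul, Nat.factorial_succ]
      have h2 : (r.factorial : ℂ) ≠ 0 := by exact_mod_cast r.factorial_ne_zero
      have h3 : (r : ℂ) + 1 ≠ 0 := by exact_mod_cast r.succ_ne_zero
      have h4 : (-1 : ℂ) ^ r * (r.factorial : ℂ)⁻¹ + (((j + r + 1 : ℕ) : ℂ) - j) *
          ((-1) ^ (r + 1) * (((r + 1) * r.factorial : ℕ) : ℂ)⁻¹) = 0 := by
        push_cast
        field_simp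
        ring
      rw [h4, zero_smul]
      rfl
    · subst h1
      rw [lowestSeq_of_lt _ (Nat.lt_succ_self j), map_zero, sub_self, zero_smul, add_zero]
      rfl
    · rw [lowestSeq_of_lt _ h1, lowestSeq_of_lt _ (by lia), map_zero, smul_zero, add_zero]
      rfl

/-- The term of degree j has weight (p - n) - 2(p - j) + (p - 2j) = -n. -/
theorem seqH_lowestSeq (S : Sl2Ops e f h) {v : V} {p n : ℕ} (hv : h v = ((p : ℂ) - n) • v) :
    seqH p h (lowestSeq p fun r => (f ^ r) v) = (-(n : ℂ)) • lowestSeq p fun r => (f ^ r) v := by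
  funext j
  rw [seqH_apply, Pi.smul_apply]
  rcases le_or_gt j p with h1 | h1
  · obtain ⟨r, rfl⟩ := Nat.exists_eq_add_of_le h1
    rw [lowestSeq, if_pos h1, Nat.add_sub_cancel_left, map_smul, S.h_f_pow_of_weight hv]
    simp only [smul_smul, ← add_smul]
    congr 1
    push_cast
    ring
  · rw [lowestSeq_of_lt _ h1, map_zero, smul_zero, smul_zero, add_zero]

theorem seqE_pow_lowestSeq_eq_zero (S : Sl2Ops e f h) (he : ∀ v, ∃ r, (e ^ r) v = 0) {v : V}
    {p n : ℕ} (hv : h v = ((p : ℂ) - n) • v) (hf : (f ^ (p + 1)) v = 0) :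
    (seqE e ^ (n + 1)) (lowestSeq p fun r => (f ^ r) v) = 0 := by
  obtain ⟨r, hr⟩ := seqE_locallyNilpotent he (g := lowestSeq p fun r => (f ^ r) v) (s := p + 1)
    fun j hj => lowestSeq_of_lt _ hj
  exact (S.seq p).e_pow_succ_eq_zero_of_f (seqH_lowestSeq S hv) (seqF_lowestSeq hf) hr

theorem seqE_pow_apply_of_eq_zero {g : ℕ → V} (hg : ∀ j, e (g j) = 0) (m j : ℕ) :
    (seqE e ^ m) g j = ((j + m).descFactorial m : ℂ) • g (j + m) := by
  induction m generalizing j with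
  | zero => simp
  | succ m ih =>
    rw [pow_succ', Module.End.mul_apply, seqE_apply, ih, ih, map_smul, hg, smul_zero, zero_add,
      smul_smul, show j + 1 + m = j + (m + 1) by ring]
    congr 1
    have h1 := Nat.descFactorial_succ (j + (m + 1)) m
    rw [h1, show j + (m + 1) - m = j + 1 by lia]
    push_cast
    ring

end SequenceVector

/-! ### Polynomials in ζ and derivations with D ζ = 1 -/

section PolynomialSums

variable {A : Type*} [CommRing A] [Algebra ℂ A]

/-- `∑_{j ≤ p} g_j ζ^j`. -/
def polySum (p : ℕ) (ζ : A) (g : ℕ → A) : A := ∑ j ∈ Finset.range (p + 1), g j * ζ ^ j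

/-- Substituting ζ for s turns d/ds into D. The condition on g (p + 1) removes the boundary term in
degree p. -/
theorem derivation_polySum (D : Derivation ℂ A A) {ζ : A} (hζ : D ζ = 1) {p : ℕ} {g : ℕ → A}
    (hg : g (p + 1) = 0) : D (polySum p ζ g) = polySum p ζ (seqE D.toLinearMap g) := by
  have h1 : ∀ j, D (g j * ζ ^ j) = D (g j) * ζ ^ j + (j : ℂ) • (g j * ζ ^ (j - 1)) := fun j => by
    rw [D.leibniz, D.leibniz_pow, hζ, smul_eq_mul, smul_eq_mul, smul_eq_mul, mul_one, mul_smul_comm,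
      Nat.cast_smul_eq_nsmul]
    ring
  simp only [polySum, map_sum, h1, seqE_apply, add_mul, Finset.sum_add_distrib]
  congr 1
  rw [Finset.sum_range_succ', Finset.sum_range_succ, hg]
  simp

theorem derivation_pow_polySum (D : Derivation ℂ A A) {ζ : A} (hζ : D ζ = 1) {p : ℕ} {g : ℕ → A}
    (hg : ∀ j, p < j → g j = 0) (m : ℕ) :
    (D.toLinearMap ^ m) (polySum p ζ g) = polySum p ζ ((seqE D.toLinearMap ^ m) g) := by
  induction m with
  | zero => rfl
  | succ m ih =>
    rw [pow_succ', Module.End.mul_apply, ih, pow_succ', Module.End.mul_apply]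
    exact derivation_polySum D hζ ((seqE_pow_spec D.toLinearMap hg m).1 _ (Nat.lt_succ_self p))

theorem derivation_pow_polySum_self (D : Derivation ℂ A A) {ζ : A} (hζ : D ζ = 1) {p : ℕ}
    {g : ℕ → A} (hg : ∀ j, p < j → g j = 0) (hD : ∀ j, D (g j) = 0) :
    (D.toLinearMap ^ p) (polySum p ζ g) = (p.factorial : ℂ) • g p := by
  rw [derivation_pow_polySum D hζ hg, polySum, Finset.sum_range_succ', Finset.sum_eq_zero]
  · rw [seqE_pow_apply_of_eq_zero (e := D.toLinearMap) hD, zero_add, zero_add,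
      Nat.descFactorial_self, pow_zero, mul_one]
  · intro j _
    rw [seqE_pow_apply_of_eq_zero (e := D.toLinearMap) hD, hg _ (by lia), smul_zero, zero_mul]

theorem derivation_pow_succ_polySum (D : Derivation ℂ A A) {ζ : A} (hζ : D ζ = 1) {p : ℕ}
    {g : ℕ → A} (hg : ∀ j, p < j → g j = 0) (hD : ∀ j, D (g j) = 0) :
    (D.toLinearMap ^ (p + 1)) (polySum p ζ g) = 0 := by
  rw [pow_succ', Module.End.mul_apply, derivation_pow_polySum_self D hζ hg hD, map_smul]
  exact (congrArg _ (hD p)).trans (smul_zero _)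

/-- `∑ (-ζ)^j / j! D^j G` is a constant of the derivation `D`. -/
theorem derivation_exp_neg_mul (D : Derivation ℂ A A) {ζ : A} (hζ : D ζ = 1) (G : A) (r : ℕ) :
    D (∑ j ∈ Finset.range (r + 1), ((-1 : ℂ) ^ j * (j.factorial : ℂ)⁻¹) •
      (ζ ^ j * (D.toLinearMap ^ j) G)) =
      ((-1 : ℂ) ^ r * (r.factorial : ℂ)⁻¹) • (ζ ^ r * (D.toLinearMap ^ (r + 1)) G) := by
  have hsucc : ∀ j, D ((D.toLinearMap ^ j) G) = (D.toLinearMap ^ (j + 1)) G := fun j => by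
    rw [pow_succ', Module.End.mul_apply]; rfl
  induction r with
  | zero => rw [Finset.sum_range_one]; simp
  | succ r ih =>
    rw [Finset.sum_range_succ, map_add, ih, Derivation.map_smul, D.leibniz, hsucc, D.leibniz_pow, hζ,
      smul_eq_mul, smul_eq_mul, smul_eq_mul, mul_one, Nat.add_sub_cancel, smul_add,
      Nat.factorial_succ]
    have h1 : ((-1 : ℂ) ^ (r + 1) * (((r + 1) * r.factorial : ℕ) : ℂ)⁻¹) •
        ((D.toLinearMap ^ (r + 1)) G * (r + 1) • ζ ^ r) =
        -(((-1 : ℂ) ^ r * (r.factorial : ℂ)⁻¹) • (ζ ^ r * (D.toLinearMap ^ (r + 1)) G)) := by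
      rw [mul_smul_comm, ← Nat.cast_smul_eq_nsmul ℂ, smul_smul, ← neg_smul, mul_comm (ζ ^ r)]
      congr 1
      have h2 : (r.factorial : ℂ) ≠ 0 := by exact_mod_cast r.factorial_ne_zero
      have h3 : (r : ℂ) + 1 ≠ 0 := by exact_mod_cast r.succ_ne_zero
      push_cast
      field_simp
      ring
    rw [h1]
    abel

end PolynomialSums

/-! ### Functions killed on the right by e_i, as linear forms on U_i -/

section NilDual

variable {L : Type*} [LieRing L] [LieAlgebra ℂ L] [FiniteDimensional ℂ L] [LieAlgebra.IsSimple ℂ L]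
variable {H : LieSubalgebra ℂ L} [H.IsCartanSubalgebra] {Δ : (rootSystem H).Base} {d : ℕ}
variable {ρ : L →ₗ⁅ℂ⁆ Matrix (Fin d) (Fin d) ℂ} (R : RootVectors Δ) (i : Δ.support)

/-- Any linear section will do: by `pairing_congr` all lifts of an element have the same pairing
with a function. -/
theorem exists_nilLift (k : ℕ) : ∃ g : nilFil Δ i k →ₗ[ℂ] UniversalEnvelopingAlgebra ℂ (nPlus Δ),
    ∀ z, inclU Δ (g z) = z := by
  obtain ⟨s, hs⟩ := (inclU Δ).toLinearMap.rangeRestrict.exists_rightInverse_of_surjective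
    (LinearMap.range_rangeRestrict _)
  have hle : nilFil Δ i k ≤ LinearMap.range (inclU Δ).toLinearMap := fun z hz => by
    obtain ⟨u, -, hu⟩ := exists_nilUN i (nilFil_le k hz)
    exact ⟨u, hu⟩
  refine ⟨s ∘ₗ Submodule.inclusion hle, fun z => ?_⟩
  exact congrArg Subtype.val (LinearMap.congr_fun hs (Submodule.inclusion hle z))

/-- A linear lift of `nilFil Δ i k` to `U(𝔫)`. -/
def nilLift (Δ : (rootSystem H).Base) (i : Δ.support) (k : ℕ) :
    nilFil Δ i k →ₗ[ℂ] UniversalEnvelopingAlgebra ℂ (nPlus Δ) :=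
  (exists_nilLift i k).choose

theorem inclU_nilLift (k : ℕ) (z : nilFil Δ i k) : inclU Δ (nilLift Δ i k z) = z :=
  (exists_nilLift i k).choose_spec z

/-- The linear form on `nilFil Δ i k` defined by a function on `N`. -/
def nilDual (ρ : L →ₗ⁅ℂ⁆ Matrix (Fin d) (Fin d) ℂ) (Δ : (rootSystem H).Base) (i : Δ.support)
    (k : ℕ) : coordRing ρ (nPlus Δ) →ₗ[ℂ] Module.Dual ℂ (nilFil Δ i k) :=
  LinearMap.lcomp ℂ ℂ (nilLift Δ i k) ∘ₗ pairingHom ρ (nPlus Δ)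

variable {i}

theorem nilDual_apply {k : ℕ} (F : coordRing ρ (nPlus Δ)) {z : nilFil Δ i k}
    {u : UniversalEnvelopingAlgebra ℂ (nPlus Δ)} (hu : inclU Δ u = z) :
    nilDual ρ Δ i k F z = pairing F u :=
  pairing_congr ((inclU_nilLift i k z).trans hu.symm)

theorem nilDual_res {k : ℕ} (P : MvPolynomial (Fin d × Fin d) ℂ) (z : nilFil Δ i k) :
    nilDual ρ Δ i k (res ρ (nPlus Δ) P) z = ell ρ P (z : UniversalEnvelopingAlgebra ℂ L) := by
  rw [nilDual_apply _ (inclU_nilLift i k z), pairing_res]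
  exact congrArg (ell ρ P) (inclU_nilLift i k z)

variable (i)

/-- The contragredient action of `e_i`. -/
def RootVectors.dualE (k : ℕ) : Module.End ℂ (Module.Dual ℂ (nilFil Δ i k)) :=
  -((adL (R.uE i)).restrict (R.isAdStable_nilFil k).e_mem).dualMap

/-- The contragredient action of `f_i`. -/
def RootVectors.dualF (k : ℕ) : Module.End ℂ (Module.Dual ℂ (nilFil Δ i k)) :=
  -((adL (R.uF i)).restrict (R.isAdStable_nilFil k).f_mem).dualMap

/-- The contragredient action of `h_i`. -/
def RootVectors.dualH (k : ℕ) : Module.End ℂ (Module.Dual ℂ (nilFil Δ i k)) :=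
  -((adL (coU Δ i)).restrict (R.isAdStable_nilFil k).h_mem).dualMap

theorem RootVectors.sl2Ops_dual (k : ℕ) :
    Sl2Ops (R.dualE i k) (R.dualF i k) (R.dualH i k) :=
  (((R.sl2Elts i).adL).restrict _ _ _).dual

theorem RootVectors.dualE_nilpotent (k : ℕ) : ∃ r, ∀ φ, (R.dualE i k ^ r) φ = 0 :=
  dual_restrict_locallyNilpotent _ (R.isAdStable_nilFil k).e_nilpotent

theorem RootVectors.dualF_nilpotent (k : ℕ) : ∃ r, ∀ φ, (R.dualF i k ^ r) φ = 0 :=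
  dual_restrict_locallyNilpotent _ (R.isAdStable_nilFil k).f_nilpotent

variable {i}

/-- Since ⟨F, e_i z⟩ = 0, one has ⟨e_i · F, z⟩ = ⟨F, z e_i⟩ = -⟨F, [e_i, z]⟩. -/
theorem RootVectors.nilDual_leftAction {F : coordRing ρ (nPlus Δ)}
    (hF : rightAction ρ (R.eN i) F = 0) (k : ℕ) :
    nilDual ρ Δ i k (leftAction ρ (nPlus Δ) (R.eN i) F) = R.dualE i k (nilDual ρ Δ i k F) := by
  refine LinearMap.ext fun z => ?_
  have h1 : nilDual ρ Δ i k F ((adL (R.uE i)).restrict (R.isAdStable_nilFil k).e_mem z) =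
      pairing F (UniversalEnvelopingAlgebra.ι ℂ (R.eN i) * nilLift Δ i k z -
        nilLift Δ i k z * UniversalEnvelopingAlgebra.ι ℂ (R.eN i)) := by
    refine nilDual_apply F ?_
    rw [map_sub, map_mul, map_mul, R.inclU_eN, inclU_nilLift]
    rfl
  have h2 : R.dualE i k (nilDual ρ Δ i k F) z =
      -nilDual ρ Δ i k F ((adL (R.uE i)).restrict (R.isAdStable_nilFil k).e_mem z) := rfl
  rw [h2, h1, ← pairingHom_apply, map_sub, pairingHom_apply, pairingHom_apply, pairing_ι_mul, hF,
    ← pairingHom_apply, map_zero, LinearMap.zero_apply, zero_sub, neg_neg, pairing_mul_ι]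
  exact nilDual_apply _ (inclU_nilLift i k z)

theorem RootVectors.dualH_nilDual {μ : Module.Dual ℂ H} {F : coordRing ρ (nPlus Δ)}
    (hF : IsHomogeneous μ F) (k : ℕ) :
    R.dualH i k (nilDual ρ Δ i k F) = μ (simpleCoroot Δ i) • nilDual ρ Δ i k F := by
  refine LinearMap.ext fun z => ?_
  obtain ⟨P, rfl⟩ := res_surjective F
  have h1 := ell_lie_of_homogeneous i hF (simpleCoroot Δ i) (nilLift Δ i k z)
  have h2 : R.dualH i k (nilDual ρ Δ i k (res ρ (nPlus Δ) P)) z =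
      -nilDual ρ Δ i k (res ρ (nPlus Δ) P)
        ((adL (coU Δ i)).restrict (R.isAdStable_nilFil k).h_mem z) := rfl
  rw [h2, nilDual_res, LinearMap.smul_apply, smul_eq_mul,
    nilDual_apply _ (inclU_nilLift i k z)]
  rw [inclU_nilLift] at h1
  have h3 : (((adL (coU Δ i)).restrict (R.isAdStable_nilFil k).h_mem z : nilFil Δ i k) :
      UniversalEnvelopingAlgebra ℂ L) = coU Δ i * z - z * coU Δ i := rfl
  rw [h3, h1]
  ring

/-- By U(𝔫) = U_i + e_i U(𝔫), such a function is determined by its values on U_i. -/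
theorem RootVectors.eq_zero_of_nilDual_eq_zero {F : coordRing ρ (nPlus Δ)}
    (hF : rightAction ρ (R.eN i) F = 0) (h : ∀ k, nilDual ρ Δ i k F = 0) : F = 0 := by
  refine eq_zero_of_pairing_eq_zero F fun u => ?_
  obtain ⟨a, ha, v, hu⟩ := R.exists_decomp_left i u
  obtain ⟨w, -, hw⟩ := exists_nilUN i ha
  obtain ⟨k, hk⟩ := exists_mem_nilFil ha
  have h1 : pairing F w = 0 := by
    rw [← nilDual_apply F (z := ⟨a, hk⟩) hw, h]; rfl
  have h2 : pairing F u = pairing F (w + UniversalEnvelopingAlgebra.ι ℂ (R.eN i) * v) :=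
    pairing_congr (by rw [map_add, hw, hu])
  rw [h2, ← pairingHom_apply, map_add, pairingHom_apply, pairingHom_apply, h1, pairing_ι_mul, hF,
    ← pairingHom_apply, map_zero, LinearMap.zero_apply, add_zero]

theorem lift_leftAction_pow_mul {ζ : coordRing ρ (nPlus Δ)}
    (hζ : ∀ x : nPlus Δ, (x : L) ∈ nilSpan Δ i → leftAction ρ (nPlus Δ) x ζ = 0)
    {u : UniversalEnvelopingAlgebra ℂ (nPlus Δ)} (hu : u ∈ nilUN Δ i) (j : ℕ)
    (G : coordRing ρ (nPlus Δ)) :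
    UniversalEnvelopingAlgebra.lift ℂ (leftAction ρ (nPlus Δ)) u (ζ ^ j * G) =
      ζ ^ j * UniversalEnvelopingAlgebra.lift ℂ (leftAction ρ (nPlus Δ)) u G := by
  induction hu using Algebra.adjoin_induction generalizing G with
  | mem u hu =>
    obtain ⟨x, hx, rfl⟩ := hu
    rw [UniversalEnvelopingAlgebra.lift_ι_apply, leftAction_mul]
    have h1 : leftAction ρ (nPlus Δ) x (ζ ^ j) = 0 := by
      have h2 := (leftDerivation ρ x).leibniz_pow ζ j
      have h3 : leftDerivation ρ x ζ = 0 := hζ x hx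
      rw [h3, smul_zero, smul_zero] at h2
      exact h2
    rw [h1, mul_zero, add_zero]
  | algebraMap r =>
    rw [AlgHom.commutes, Module.algebraMap_end_apply, Module.algebraMap_end_apply, mul_smul_comm]
  | add a b _ _ ha hb => rw [map_add, LinearMap.add_apply, LinearMap.add_apply, ha, hb, mul_add]
  | mul a b _ _ ha hb =>
    have h1 := map_mul (UniversalEnvelopingAlgebra.lift ℂ (leftAction ρ (nPlus Δ))) a b
    rw [h1, Module.End.mul_apply, hb, ha, Module.End.mul_apply]

/-- The generators of U_i act by derivations that kill ζ, so U_i acts linearly over ℂ[ζ]; evaluation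
at 1 then kills positive powers of ζ. -/
theorem pairing_pow_mul {ζ : coordRing ρ (nPlus Δ)}
    (hζ : ∀ x : nPlus Δ, (x : L) ∈ nilSpan Δ i → leftAction ρ (nPlus Δ) x ζ = 0)
    (hζ1 : (ζ : unipotentGroup ρ (nPlus Δ) → ℂ) 1 = 0)
    {u : UniversalEnvelopingAlgebra ℂ (nPlus Δ)} (hu : u ∈ nilUN Δ i) (j : ℕ)
    (G : coordRing ρ (nPlus Δ)) : pairing (ζ ^ j * G) u = if j = 0 then pairing G u else 0 := by
  rw [pairing, lift_leftAction_pow_mul hζ hu]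
  split_ifs with h
  · rw [h, pow_zero, one_mul, pairing]
  · have h1 : ((ζ ^ j * UniversalEnvelopingAlgebra.lift ℂ (leftAction ρ (nPlus Δ)) u G :
        coordRing ρ (nPlus Δ)) : unipotentGroup ρ (nPlus Δ) → ℂ) 1 =
        ((ζ : unipotentGroup ρ (nPlus Δ) → ℂ) 1) ^ j * ((UniversalEnvelopingAlgebra.lift ℂ
          (leftAction ρ (nPlus Δ)) u G : coordRing ρ (nPlus Δ)) :
            unipotentGroup ρ (nPlus Δ) → ℂ) 1 := rfl
    rw [h1, hζ1, zero_pow h, zero_mul]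

/-- The functions killed by the right action of `e_i` are stable under the contragredient action of
`f_i`. -/
theorem RootVectors.exists_dualF {ζ : coordRing ρ (nPlus Δ)}
    (hζe : rightAction ρ (R.eN i) ζ = 1)
    (hζ : ∀ x : nPlus Δ, (x : L) ∈ nilSpan Δ i → leftAction ρ (nPlus Δ) x ζ = 0)
    (hζ1 : (ζ : unipotentGroup ρ (nPlus Δ) → ℂ) 1 = 0)
    (hnil : ∀ F : coordRing ρ (nPlus Δ), ∃ r, (rightAction ρ (R.eN i) ^ r) F = 0)
    (F : coordRing ρ (nPlus Δ)) :
    ∃ F', rightAction ρ (R.eN i) F' = 0 ∧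
      ∀ k, nilDual ρ Δ i k F' = R.dualF i k (nilDual ρ Δ i k F) := by
  obtain ⟨P, rfl⟩ := res_surjective F
  -- On U_i this G represents the contragredient action of f_i on F, but e_i need not kill it on the
  -- right. The alternating series in ζ makes it constant for that action without changing its
  -- values on U_i.
  set G := res ρ (nPlus Δ) (polyDer ρ (Fin d) (R.f i) P - polyDerRight ρ (R.f i) P) with hG
  obtain ⟨r, hr⟩ := hnil G
  have h1 := derivation_exp_neg_mul (rightDerivation ρ (R.eN i)) hζe G r
  refine ⟨_, h1.trans ?_, fun k => ?_⟩
  · have h2 : ((rightDerivation ρ (R.eN i)).toLinearMap ^ (r + 1)) G = 0 := by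
      rw [pow_succ', Module.End.mul_apply]
      exact (congrArg _ hr).trans (map_zero _)
    rw [h2, mul_zero, smul_zero]
  · refine LinearMap.ext fun z => ?_
    obtain ⟨u, hu, huz⟩ := exists_nilUN i (nilFil_le k z.2)
    have h2 : R.dualF i k (nilDual ρ Δ i k (res ρ (nPlus Δ) P)) z =
      -nilDual ρ Δ i k (res ρ (nPlus Δ) P)
        ((adL (R.uF i)).restrict (R.isAdStable_nilFil k).f_mem z) := rfl
    have h3 : (((adL (R.uF i)).restrict (R.isAdStable_nilFil k).f_mem z : nilFil Δ i k) :
      UniversalEnvelopingAlgebra ℂ L) = R.uF i * z - z * R.uF i := rfl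
    rw [nilDual_apply _ huz, h2, nilDual_res, h3, ← pairingHom_apply, map_sum,
      LinearMap.sum_apply]
    simp only [map_smul, LinearMap.smul_apply, pairingHom_apply, pairing_pow_mul hζ hζ1 hu]
    rw [Finset.sum_eq_single_of_mem 0 (Finset.mem_range.2 (Nat.succ_pos r))
      (fun j _ hj => by rw [if_neg hj, smul_zero]), if_pos rfl]
    have h4 : pairing G u = ell ρ P ((z : UniversalEnvelopingAlgebra ℂ L) * R.uF i) -
        ell ρ P (R.uF i * (z : UniversalEnvelopingAlgebra ℂ L)) := by
      rw [ell_mul_ι, ell_ι_mul, ← huz, hG, map_sub, ← pairingHom_apply, map_sub,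
        LinearMap.sub_apply, pairingHom_apply, pairingHom_apply, pairing_res, pairing_res]
      rfl
    have h5 : ((rightDerivation ρ (R.eN i)).toLinearMap ^ 0) G = G := rfl
    rw [h5, h4, map_sub]
    simp

end NilDual

/-! ### Positivity of φ_i and the function X -/

section ReflectionVector

variable {L : Type*} [LieRing L] [LieAlgebra ℂ L] [FiniteDimensional ℂ L] [LieAlgebra.IsSimple ℂ L]
variable {H : LieSubalgebra ℂ L} [H.IsCartanSubalgebra] {Δ : (rootSystem H).Base} {d : ℕ}
variable {ρ : L →ₗ⁅ℂ⁆ Matrix (Fin d) (Fin d) ℂ} (R : RootVectors Δ) {i : Δ.support}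

theorem rightDerivation_toLinearMap {𝔫 : LieSubalgebra ℂ L} (x : 𝔫) :
    (rightDerivation ρ x).toLinearMap = rightAction ρ x := rfl

theorem leftDerivation_toLinearMap {𝔫 : LieSubalgebra ℂ L} (x : 𝔫) :
    (leftDerivation ρ x).toLinearMap = leftAction ρ 𝔫 x := rfl

theorem leftAction_pow_polySum {𝔫 : LieSubalgebra ℂ L} {x : 𝔫} {ζ : coordRing ρ 𝔫}
    (hζ : leftAction ρ 𝔫 x ζ = 1) {p m : ℕ} {g : ℕ → coordRing ρ 𝔫}
    (hg : ∀ j, p < j → g j = 0) (h : (seqE (leftAction ρ 𝔫 x) ^ m) g = 0) :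
    (leftAction ρ 𝔫 x ^ m) (polySum p ζ g) = 0 := by
  have h1 := derivation_pow_polySum (leftDerivation ρ x) hζ hg m
  rw [leftDerivation_toLinearMap, h] at h1
  rw [h1]
  simp [polySum]

theorem rightAction_pow_succ_polySum {𝔫 : LieSubalgebra ℂ L} {x : 𝔫} {ζ : coordRing ρ 𝔫}
    (hζ : rightAction ρ x ζ = 1) {p : ℕ} {g : ℕ → coordRing ρ 𝔫}
    (hg : ∀ j, p < j → g j = 0) (h : ∀ j, rightAction ρ x (g j) = 0) :
    (rightAction ρ x ^ (p + 1)) (polySum p ζ g) = 0 := by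
  have h1 := derivation_pow_succ_polySum (rightDerivation ρ x) (ζ := ζ) hζ hg h
  rwa [rightDerivation_toLinearMap] at h1

theorem rightAction_pow_polySum {𝔫 : LieSubalgebra ℂ L} {x : 𝔫} {ζ : coordRing ρ 𝔫}
    (hζ : rightAction ρ x ζ = 1) {p : ℕ} {g : ℕ → coordRing ρ 𝔫}
    (hg : ∀ j, p < j → g j = 0) (h : ∀ j, rightAction ρ x (g j) = 0) :
    (rightAction ρ x ^ p) (polySum p ζ g) = (p.factorial : ℂ) • g p := by
  have h1 := derivation_pow_polySum_self (rightDerivation ρ x) (ζ := ζ) hζ hg h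
  rwa [rightDerivation_toLinearMap] at h1

theorem RootVectors.nilDual_leftAction_pow {F : coordRing ρ (nPlus Δ)}
    (hF : rightAction ρ (R.eN i) F = 0) (k m : ℕ) :
    rightAction ρ (R.eN i) ((leftAction ρ (nPlus Δ) (R.eN i) ^ m) F) = 0 ∧
      nilDual ρ Δ i k ((leftAction ρ (nPlus Δ) (R.eN i) ^ m) F) =
        (R.dualE i k ^ m) (nilDual ρ Δ i k F) := by
  induction m with
  | zero => exact ⟨hF, rfl⟩
  | succ m ih =>
    rw [pow_succ', pow_succ', Module.End.mul_apply, Module.End.mul_apply]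
    exact ⟨by rw [← leftAction_rightAction_comm, ih.1, map_zero],
      by rw [R.nilDual_leftAction ih.1, ih.2]⟩

/-- A function of weight `w` that is killed by the right action of `e_i` and by `e_i^{n+1}` satisfies
`w + n ≥ 0`. -/
theorem RootVectors.weight_add_nonneg {μ : Module.Dual ℂ H} {F : coordRing ρ (nPlus Δ)}
    (hF : rightAction ρ (R.eN i) F = 0) (hμ : IsHomogeneous μ F) {w : ℤ} {n : ℕ}
    (hw : μ (simpleCoroot Δ i) = w) (hE : (leftAction ρ (nPlus Δ) (R.eN i) ^ (n + 1)) F = 0)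
    (hF0 : F ≠ 0) : 0 ≤ w + n := by
  by_contra! h
  -- If w + n < 0, each restriction to a filtration step has weight w and is killed by e^{n+1} with
  -- n + 1 ≤ -w, so it vanishes.
  refine hF0 (R.eq_zero_of_nilDual_eq_zero hF fun k => ?_)
  obtain ⟨r, hr⟩ := R.dualF_nilpotent i k
  refine (R.sl2Ops_dual i k).eq_zero_of_weight (w := w) (r := r) (k := n + 1) ?_ (hr _) ?_
    (by push_cast; lia)
  · rw [R.dualH_nilDual hμ, hw]
  · rw [← (R.nilDual_leftAction_pow hF k (n + 1)).2, hE, map_zero]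

/-- From a function `F` of weight `p - n` killed by the right action of `e_i` and by `e_i^{n+1}`, a
function `X` with `X · e_i^p = p! F`, still killed by `e_i^{n+1}`. -/
theorem RootVectors.exists_reflectionVector {ζ : coordRing ρ (nPlus Δ)}
    (hζl : leftAction ρ (nPlus Δ) (R.eN i) ζ = 1) (hζe : rightAction ρ (R.eN i) ζ = 1)
    (hζ : ∀ x : nPlus Δ, (x : L) ∈ nilSpan Δ i → leftAction ρ (nPlus Δ) x ζ = 0)
    (hζ1 : (ζ : unipotentGroup ρ (nPlus Δ) → ℂ) 1 = 0)
    (hnil : ∀ F : coordRing ρ (nPlus Δ), ∃ r, (rightAction ρ (R.eN i) ^ r) F = 0)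
    {μ : Module.Dual ℂ H} {F : coordRing ρ (nPlus Δ)} (hF : rightAction ρ (R.eN i) F = 0)
    (hμ : IsHomogeneous μ F) {p n : ℕ} (hw : μ (simpleCoroot Δ i) = (p : ℂ) - n)
    (hE : (leftAction ρ (nPlus Δ) (R.eN i) ^ (n + 1)) F = 0) :
    ∃ X : coordRing ρ (nPlus Δ), (leftAction ρ (nPlus Δ) (R.eN i) ^ (n + 1)) X = 0 ∧
      (rightAction ρ (R.eN i) ^ (p + 1)) X = 0 ∧
      (rightAction ρ (R.eN i) ^ p) X = (p.factorial : ℂ) • F := by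
  choose φ hφ1 hφ2 using R.exists_dualF hζe hζ hζ1 hnil
  -- `Fs r` is a function on N whose linear form on U_i is f_i^r applied to that of F.
  let Fs : ℕ → coordRing ρ (nPlus Δ) := fun r => Nat.rec F (fun _ G => φ G) r
  have hFs1 : ∀ r, rightAction ρ (R.eN i) (Fs r) = 0 := fun r => by
    cases r with
    | zero => exact hF
    | succ r => exact hφ1 (Fs r)
  have hFs2 : ∀ k r, nilDual ρ Δ i k (Fs r) = (R.dualF i k ^ r) (nilDual ρ Δ i k F) := fun k r => by
    induction r with
    | zero => rfl
    | succ r ih =>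
      rw [pow_succ', Module.End.mul_apply, ← ih]
      exact hφ2 (Fs r) k
  set g := lowestSeq p Fs with hg
  have hgp : ∀ j, p < j → g j = 0 := fun j hj => lowestSeq_of_lt _ hj
  have hgr : ∀ j, rightAction ρ (R.eN i) (g j) = 0 := fun j => by
    rw [hg, lowestSeq]
    split_ifs
    · rw [map_smul, hFs1, smul_zero]
    · exact map_zero _
  have hgd : ∀ k, (fun j => nilDual ρ Δ i k (g j)) =
      lowestSeq p fun r => (R.dualF i k ^ r) (nilDual ρ Δ i k F) := fun k => by
    funext j
    rw [hg, lowestSeq, lowestSeq]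
    split_ifs
    · rw [map_smul, hFs2]
    · exact map_zero _
  have hseq : ∀ m, (∀ j, rightAction ρ (R.eN i)
      ((seqE (leftAction ρ (nPlus Δ) (R.eN i)) ^ m) g j) = 0) ∧
      ∀ k, (fun j => nilDual ρ Δ i k ((seqE (leftAction ρ (nPlus Δ) (R.eN i)) ^ m) g j)) =
        (seqE (R.dualE i k) ^ m) (fun j => nilDual ρ Δ i k (g j)) := by
    intro m
    induction m with
    | zero => exact ⟨hgr, fun k => rfl⟩
    | succ m ih =>
      constructor
      · intro j
        rw [pow_succ', Module.End.mul_apply, seqE_apply, map_add, map_smul, ih.1,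
          ← leftAction_rightAction_comm, ih.1, map_zero, smul_zero, add_zero]
      · intro k
        rw [pow_succ', pow_succ', Module.End.mul_apply, Module.End.mul_apply, ← ih.2]
        funext j
        rw [seqE_apply, seqE_apply, map_add, map_smul, R.nilDual_leftAction (ih.1 j)]
  -- Every coefficient is killed on the right by e_i, so the equality may be tested on the steps of
  -- U_i, where `g` becomes the lowest weight vector of weight -n.
  have hseq0 : (seqE (leftAction ρ (nPlus Δ) (R.eN i)) ^ (n + 1)) g = 0 := by
    funext j
    refine R.eq_zero_of_nilDual_eq_zero ((hseq (n + 1)).1 j) fun k => ?_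
    obtain ⟨r, hr⟩ := R.dualF_nilpotent i k
    obtain ⟨s, hs⟩ := R.dualE_nilpotent i k
    have hv : R.dualH i k (nilDual ρ Δ i k F) = ((p : ℂ) - n) • nilDual ρ Δ i k F := by
      rw [R.dualH_nilDual hμ, hw]
    have hf := (R.sl2Ops_dual i k).f_pow_eq_zero hv (hr _)
      (by rw [← (R.nilDual_leftAction_pow hF k (n + 1)).2, hE, map_zero])
    have h1 := congrFun ((hseq (n + 1)).2 k) j
    rw [hgd, seqE_pow_lowestSeq_eq_zero (R.sl2Ops_dual i k) (fun v => ⟨s, hs v⟩) hv hf] at h1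
    exact h1
  have hgF : g p = F := by rw [hg, lowestSeq_self]; rfl
  refine ⟨polySum p ζ g, leftAction_pow_polySum hζl hgp hseq0, rightAction_pow_succ_polySum hζe hgp hgr,
    ?_⟩
  rw [rightAction_pow_polySum hζe hgp hgr, hgF]

end ReflectionVector

/-! ### The Saito reflection and the pairing formula -/

section SaitoReflection

variable {L : Type*} [LieRing L] [LieAlgebra ℂ L] [FiniteDimensional ℂ L] [LieAlgebra.IsSimple ℂ L]
variable {H : LieSubalgebra ℂ L} [H.IsCartanSubalgebra] {Δ : (rootSystem H).Base} {d : ℕ}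
variable {ρ : L →ₗ⁅ℂ⁆ Matrix (Fin d) (Fin d) ℂ} {R : RootVectors Δ} {i : Δ.support}

theorem leftAction_pow_rightAction_pow_comm {𝔫 : LieSubalgebra ℂ L} (x y : 𝔫) (m k : ℕ)
    (F : coordRing ρ 𝔫) : (leftAction ρ 𝔫 x ^ m) ((rightAction ρ y ^ k) F) =
      (rightAction ρ y ^ k) ((leftAction ρ 𝔫 x ^ m) F) := by
  have h : Commute (leftAction ρ 𝔫 x) (rightAction ρ y) :=
    LinearMap.ext fun F => leftAction_rightAction_comm x y F
  have h1 := LinearMap.congr_fun (h.pow_pow m k).eq F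
  exact h1

theorem Crystal.wt_of_opPow_e {I P : Type*} [AddCommGroup P] {α : I → P} {h : I → P →+ ℤ}
    {B : Type*} (C : Crystal α h B) (i : I) (n : ℕ) {b b' : B} (hb : opPow (C.e i) n b = some b') :
    C.wt b' = C.wt b + n • α i := by
  induction n generalizing b with
  | zero =>
    obtain rfl : b = b' := Option.some_injective _ hb
    rw [zero_smul, add_zero]
  | succ n ih =>
    obtain ⟨c, hc, hcb⟩ := Option.bind_eq_some_iff.1 hb
    rw [ih hcb, C.wt_e i b c hc, succ_nsmul', add_assoc]

theorem corootP_simpleRootP : corootP Δ i (simpleRootP Δ i) = 2 := by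
  have h1 := corootP_spec Δ i (simpleRootP Δ i)
  have h2 := simpleRoot_simpleCoroot (Δ := Δ) i
  have h3 : ((simpleRootP Δ i : weightLattice Δ) : Module.Dual ℂ H) (simpleCoroot Δ i) = 2 := h2
  rw [h3] at h1
  exact_mod_cast h1.symm

theorem pairing_pow_mul_mul_pow (F : coordRing ρ (nPlus Δ))
    (u : UniversalEnvelopingAlgebra ℂ (nPlus Δ)) (j k : ℕ) :
    pairing F (UniversalEnvelopingAlgebra.ι ℂ (R.eN i) ^ j * u *
      UniversalEnvelopingAlgebra.ι ℂ (R.eN i) ^ k) =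
      pairing ((rightAction ρ (R.eN i) ^ j) ((leftAction ρ (nPlus Δ) (R.eN i) ^ k) F)) u := by
  have hl : ∀ (k : ℕ) (G : coordRing ρ (nPlus Δ)) v,
      pairing G (v * UniversalEnvelopingAlgebra.ι ℂ (R.eN i) ^ k) =
      pairing ((leftAction ρ (nPlus Δ) (R.eN i) ^ k) G) v := by
    intro k
    induction k with
    | zero => intro G v; rw [pow_zero, mul_one]; rfl
    | succ k ih => intro G v; rw [pow_succ', ← mul_assoc, ih, pairing_mul_ι, pow_succ',
        Module.End.mul_apply]
  have hr : ∀ (j : ℕ) (G : coordRing ρ (nPlus Δ)) v,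
      pairing G (UniversalEnvelopingAlgebra.ι ℂ (R.eN i) ^ j * v) =
      pairing ((rightAction ρ (R.eN i) ^ j) G) v := by
    intro j
    induction j with
    | zero => intro G v; rw [pow_zero, one_mul]; rfl
    | succ j ih => intro G v; rw [pow_succ, mul_assoc, ih, pairing_ι_mul, pow_succ',
        Module.End.mul_apply]
  rw [hl, hr]

/-- The comparison of `F · e_i^p` and `e_i^n · F` through `T_i`. -/
theorem pairing_T {F : coordRing ρ (nPlus Δ)} {μ : Module.Dual ℂ H} (hμ : IsHomogeneous μ F)
    {p n : ℕ} (hw : μ (simpleCoroot Δ i) = -((p : ℂ) + n))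
    (hr : (rightAction ρ (R.eN i) ^ (p + 1)) F = 0)
    (hl : (leftAction ρ (nPlus Δ) (R.eN i) ^ (n + 1)) F = 0)
    {u u' : UniversalEnvelopingAlgebra ℂ (nPlus Δ)} (hu : u ∈ nilUN Δ i)
    (huu' : R.T i (inclU Δ u) = inclU Δ u') :
    (p.factorial : ℂ)⁻¹ * pairing ((rightAction ρ (R.eN i) ^ p) F) u' =
      (n.factorial : ℂ)⁻¹ * pairing ((leftAction ρ (nPlus Δ) (R.eN i) ^ n) F) u := by
  obtain ⟨P, rfl⟩ := res_surjective F
  have hval : ∀ (v : UniversalEnvelopingAlgebra ℂ (nPlus Δ)) (j k : ℕ),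
      ell ρ P (R.uE i ^ j * inclU Δ v * R.uE i ^ k) =
      pairing ((rightAction ρ (R.eN i) ^ j)
        ((leftAction ρ (nPlus Δ) (R.eN i) ^ k) (res ρ (nPlus Δ) P))) v := by
    intro v j k
    rw [← pairing_pow_mul_mul_pow, pairing_res]
    have h1 : inclU Δ (UniversalEnvelopingAlgebra.ι ℂ (R.eN i) ^ j * v *
        UniversalEnvelopingAlgebra.ι ℂ (R.eN i) ^ k) = R.uE i ^ j * inclU Δ v * R.uE i ^ k := by
      rw [map_mul, map_mul, map_pow, map_pow, R.inclU_eN]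
    exact congrArg (ell ρ P) h1.symm
  have hz : inclU Δ u ∈ nilU Δ i := by rw [← map_nilUN]; exact ⟨u, hu, rfl⟩
  have hpair0 : ∀ v : UniversalEnvelopingAlgebra ℂ (nPlus Δ),
      pairing (0 : coordRing ρ (nPlus Δ)) v = 0 := fun v => by
    rw [← pairingHom_apply, map_zero, LinearMap.zero_apply]
  -- The two open goals are the vanishing outside 0 ≤ j ≤ p, 0 ≤ k ≤ n, which comes from `hr` and
  -- `hl`, and the weight p + n, which comes from homogeneity.
  have h1 := R.apply_T i (l := ell ρ P) (p := p) (n := n) ?_ ?_ hz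
  · have h2 := hval u' p 0
    have h3 := hval u 0 n
    rw [pow_zero, mul_one] at h2
    rw [pow_zero, one_mul] at h3
    rw [huu', h2, h3] at h1
    exact h1
  · intro z hz j k hjk
    obtain ⟨v, -, rfl⟩ := exists_nilUN i hz
    rw [hval]
    have hpow : ∀ {V : Type _} [AddCommGroup V] [Module ℂ V] {D : Module.End ℂ V} {w : V} {a b : ℕ},
        (D ^ (a + 1)) w = 0 → a < b → (D ^ b) w = 0 := by
      intro V _ _ D w a b h hab
      rw [← Nat.sub_add_cancel (Nat.succ_le_of_lt hab), pow_add, Module.End.mul_apply]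
      exact (congrArg _ h).trans (map_zero _)
    rcases hjk with h | h
    · rw [← leftAction_pow_rightAction_pow_comm, hpow hr h, map_zero, hpair0]
    · rw [hpow hl h, map_zero, hpair0]
  · intro z hz j k
    obtain ⟨v, -, rfl⟩ := exists_nilUN i hz
    have h1 : inclU Δ (UniversalEnvelopingAlgebra.ι ℂ (R.eN i) ^ j * v *
        UniversalEnvelopingAlgebra.ι ℂ (R.eN i) ^ k) = R.uE i ^ j * inclU Δ v * R.uE i ^ k := by
      rw [map_mul, map_mul, map_pow, map_pow, R.inclU_eN]
    have h2 := ell_lie_of_homogeneous i hμ (simpleCoroot Δ i)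
      (UniversalEnvelopingAlgebra.ι ℂ (R.eN i) ^ j * v *
        UniversalEnvelopingAlgebra.ι ℂ (R.eN i) ^ k)
    rw [hw, neg_neg, pairing_res] at h2
    have h3 : envIncl (nPlus Δ) (UniversalEnvelopingAlgebra.ι ℂ (R.eN i) ^ j * v *
        UniversalEnvelopingAlgebra.ι ℂ (R.eN i) ^ k) = R.uE i ^ j * inclU Δ v * R.uE i ^ k := h1
    rw [h1, h3] at h2
    exact h2

theorem pairing_eq_of_pow_eq {F G G' : coordRing ρ (nPlus Δ)} {μ : Module.Dual ℂ H}
    (hμ : IsHomogeneous μ F) {p n : ℕ} (hw : μ (simpleCoroot Δ i) = -((p : ℂ) + n))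
    (hr : (rightAction ρ (R.eN i) ^ (p + 1)) F = 0)
    (hl : (leftAction ρ (nPlus Δ) (R.eN i) ^ (n + 1)) F = 0)
    (hG : (rightAction ρ (R.eN i) ^ p) F = (p.factorial : ℂ) • G)
    (hG' : (leftAction ρ (nPlus Δ) (R.eN i) ^ n) F = (n.factorial : ℂ) • G')
    {u u' : UniversalEnvelopingAlgebra ℂ (nPlus Δ)} (hu : u ∈ nilUN Δ i)
    (huu' : R.T i (inclU Δ u) = inclU Δ u') : pairing G u' = pairing G' u := by
  have hpf : (p.factorial : ℂ) ≠ 0 := by exact_mod_cast p.factorial_ne_zero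
  have hnf : (n.factorial : ℂ) ≠ 0 := by exact_mod_cast n.factorial_ne_zero
  have h1 := pairing_T hμ hw hr hl hu huu'
  rwa [hG, hG', pairing_smul_left, pairing_smul_left, inv_mul_cancel_left₀ hpf,
    inv_mul_cancel_left₀ hnf] at h1

/-- A function on `N` is determined by its values on `U⁺ ∩ T_i⁻¹(U⁺)` and on `U⁺ e_i`. -/
theorem eq_of_pairing_eq_of_T {F G : coordRing ρ (nPlus Δ)}
    (h : ∀ u u' : UniversalEnvelopingAlgebra ℂ (nPlus Δ), R.T i (inclU Δ u) = inclU Δ u' →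
      pairing F u = pairing G u)
    (hF : ∀ u, pairing F (u * UniversalEnvelopingAlgebra.ι ℂ (R.eN i)) = 0)
    (hG : ∀ u, pairing G (u * UniversalEnvelopingAlgebra.ι ℂ (R.eN i)) = 0) : F = G := by
  refine eq_of_pairing_eq fun u => ?_
  obtain ⟨a, ha, v, hu⟩ := R.exists_decomp i u
  obtain ⟨w, -, hw⟩ := exists_nilUN i ha
  -- T_i preserves U_i, so the component in U_i is a legitimate argument for `h`.
  obtain ⟨w', -, hw'⟩ := exists_nilUN i (R.T_mem_nilU i ha)
  have h1 : inclU Δ u = inclU Δ (w + v * UniversalEnvelopingAlgebra.ι ℂ (R.eN i)) := by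
    rw [map_add, hw, hu]
  rw [pairing_congr h1, pairing_congr h1, ← pairingHom_apply, ← pairingHom_apply, map_add, map_add,
    pairingHom_apply, pairingHom_apply, pairingHom_apply, pairingHom_apply, hF, hG,
    h w w' (by rw [hw, hw'])]

/-- A single basis element x in the support of X yields both b, by e_i^{(p)} on the right, and
σ_i(b), by e_i^{(n)} on the left. The formula on U_i then becomes a statement about x alone. -/
theorem BiperfectBasis.exists_saitoReflection (hρ : Function.Injective ρ) {B : Type*}
    (S : BiperfectBasis R ρ B) {b : B} (hb : S.starCrystal.ε i b = 0) :
    ∃ b' : B, S.IsSaitoReflection i b b' ∧ leftAction ρ (nPlus Δ) (R.eN i) (S.vec b') = 0 ∧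
      ∀ u u' : UniversalEnvelopingAlgebra ℂ (nPlus Δ), u ∈ nilUN Δ i →
        R.T i (inclU Δ u) = inclU Δ u' → pairing (S.vec b') u = pairing (S.vec b) u' := by
  obtain ⟨ε, hε, SB⟩ := Crystal.stringBasis S.upperSemiNormal S.compatible i
  obtain ⟨ε', hε', SB'⟩ := Crystal.stringBasis S.starUpperSemiNormal S.starCompatible i
  obtain ⟨ζ, hζl, hζe, hζ, hζ1⟩ := R.exists_coordinate i hρ S.vec
    (fun b => (S.crystal.wt b : Module.Dual ℂ H)) S.homogeneous
  have hb0 : ε' b = 0 := by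
    rw [hε'] at hb
    exact_mod_cast hb
  have hbr : rightAction ρ (R.eN i) (S.vec b) = 0 := by
    have h1 := SB'.pow_succ_eq_zero b
    rwa [hb0, zero_add, pow_one] at h1
  set n := ε b with hn
  have hbl := SB.pow_succ_eq_zero b
  rw [← hn] at hbl
  have hwb := corootP_spec Δ i (S.crystal.wt b)
  have hnonneg := R.weight_add_nonneg hbr (S.homogeneous b) hwb hbl (S.vec.ne_zero b)
  -- This p is φ_i(b), since φ_i = ⟨h_i, wt⟩ + ε_i.
  obtain ⟨p, hp⟩ := Int.eq_ofNat_of_zero_le hnonneg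
  have hwp : corootP Δ i (S.crystal.wt b) = p - n := by lia
  have hwc : (S.crystal.wt b : Module.Dual ℂ H) (simpleCoroot Δ i) = (p : ℂ) - n := by
    rw [hwb, hwp]; push_cast; rfl
  obtain ⟨X, hX1, hX2, hX3⟩ := R.exists_reflectionVector hζl hζe hζ hζ1 SB'.exists_pow_eq_zero hbr
    (S.homogeneous b) hwc hbl
  obtain ⟨x, hxX, hxp, hxb⟩ := SB'.exists_of_pow_apply hX2 hX3
  have hpf : (p.factorial : ℂ) ≠ 0 := by exact_mod_cast p.factorial_ne_zero
  have hnf : (n.factorial : ℂ) ≠ 0 := by exact_mod_cast n.factorial_ne_zero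
  obtain ⟨c, hc, hcv⟩ := SB.pow_apply (b := b) hn.symm
  obtain ⟨b₁, hb₁, hb₁v⟩ := SB'.pow_apply hxp
  obtain rfl : b₁ = b := Option.some_injective _ (hb₁.symm.trans hxb)
  have hxn' : ε x < n + 1 := SB.eps_le_of_pow_eq_zero hX1 hxX
  have hcomm : (rightAction ρ (R.eN i) ^ p) ((leftAction ρ (nPlus Δ) (R.eN i) ^ n) (S.vec x)) =
      ((p.factorial : ℂ) * n.factorial) • S.vec c := by
    rw [← leftAction_pow_rightAction_pow_comm, hb₁v, map_smul, hcv, smul_smul]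
  -- If ε x < n then e_i^n kills x, contradicting `hcomm`, whose right side is a nonzero multiple of
  -- a basis vector.
  have hxn : ε x = n := by
    by_contra h
    have h1 : (leftAction ρ (nPlus Δ) (R.eN i) ^ n) (S.vec x) = 0 :=
      SB.pow_eq_zero (Submodule.subset_span ⟨x, (by lia : ε x < n), rfl⟩)
    rw [h1, map_zero] at hcomm
    exact S.vec.ne_zero c ((smul_eq_zero.1 hcomm.symm).resolve_left (mul_ne_zero hpf hnf))
  obtain ⟨b', hb', hb'v⟩ := SB.pow_apply hxn
  have hxl := SB.pow_succ_eq_zero x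
  rw [hxn] at hxl
  have hxr := SB'.pow_succ_eq_zero x
  rw [hxp] at hxr
  have hb'p : (rightAction ρ (R.eN i) ^ p) (S.vec b') = (p.factorial : ℂ) • S.vec c := by
    rw [hb'v, map_smul, mul_comm, mul_smul] at hcomm
    exact smul_right_injective _ hnf hcomm
  have hb'r : (rightAction ρ (R.eN i) ^ (p + 1)) (S.vec b') = 0 := by
    have h1 := leftAction_pow_rightAction_pow_comm (R.eN i) (R.eN i) n (p + 1) (S.vec x)
    rw [hxr, map_zero, hb'v, map_smul] at h1
    exact (smul_eq_zero.1 h1.symm).resolve_left hnf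
  have hb'e : ε' b' = p := by
    refine SB'.eps_eq ?_ hb'r
    rw [hb'p]
    exact smul_ne_zero hpf (S.vec.ne_zero c)
  obtain ⟨c', hc', hc'v⟩ := SB'.pow_apply hb'e
  -- The star string of b' ends at c = ẽ_i^n b, and reading it backwards gives b' = (f̃_i^*)^p c.
  obtain rfl : c' = c := by
    rw [hb'p] at hc'v
    exact (S.vec.injective (smul_right_injective _ hpf hc'v)).symm
  refine ⟨b', ⟨n, p, hε b₁, ?_, ?_⟩, ?_, fun u u' hu huu' => ?_⟩
  · rw [S.crystal.φ_eq, hε, hwp, ← WithBot.coe_add]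
    congr 1
    lia
  · rw [hc]
    exact (opPow_eq_some_iff SB'.e_eq_iff p b' c').1 hc'
  · have h1 : (leftAction ρ (nPlus Δ) (R.eN i) ^ (n + 1)) (S.vec x) =
        (n.factorial : ℂ) • leftAction ρ (nPlus Δ) (R.eN i) (S.vec b') := by
      rw [pow_succ', Module.End.mul_apply, hb'v, map_smul]
    rw [hxl] at h1
    exact (smul_eq_zero.1 h1.symm).resolve_left hnf
  -- From wt b = wt x + p α_i the value of wt x on h_i is (p - n) - 2p = -(p + n).
  · have hwx : (S.crystal.wt x : Module.Dual ℂ H) (simpleCoroot Δ i) = -((p : ℂ) + n) := by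
      have h1 := S.starCrystal.wt_of_opPow_e i p hxb
      rw [S.wt_eq] at h1
      have h2 := congrArg (corootP Δ i) h1
      rw [map_add, map_nsmul, corootP_simpleRootP, hwp] at h2
      rw [corootP_spec, show corootP Δ i (S.crystal.wt x) = -(p + n) by
        rw [nsmul_eq_mul] at h2; lia]
      push_cast
      rfl
    exact (pairing_eq_of_pow_eq (S.homogeneous x) hwx hxr hxl hb₁v hb'v hu huu').symm

end SaitoReflection

end Biperfect

end

open Biperfect in
/-- The Saito reflection `σ_i(b)` of an element `b` of a biperfect basis with `ε_i^*(b) = 0` satisfies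
`⟨σ_i(b), u⟩ = ⟨b, T_i(u)⟩` for `u ∈ U⁺ ∩ T_i⁻¹(U⁺)`. As it also annihilates `U⁺ e_i`, it is
the only element of `ℂ[N]` with these two properties. -/
theorem mainTheorem12 {L : Type*} [LieRing L] [LieAlgebra ℂ L] [FiniteDimensional ℂ L]
    [LieAlgebra.IsSimple ℂ L] (H : LieSubalgebra ℂ L) [H.IsCartanSubalgebra]
    (Δ : (LieAlgebra.IsKilling.rootSystem H).Base) (R : RootVectors Δ)
    {d : ℕ} (ρ : L →ₗ⁅ℂ⁆ Matrix (Fin d) (Fin d) ℂ) (hρ : Function.Injective ρ)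
    {B : Type*} (S : BiperfectBasis R ρ B) (i : Δ.support) (b : B)
    (hb : S.starCrystal.ε i b = 0) :
    ∃ b' : B, S.IsSaitoReflection i b b' ∧
      (∀ u u' : UniversalEnvelopingAlgebra ℂ (nPlus Δ),
        R.T i (inclU Δ u) = inclU Δ u' → pairing (S.vec b') u = pairing (S.vec b) u') ∧
      (∀ u : UniversalEnvelopingAlgebra ℂ (nPlus Δ),
        pairing (S.vec b') (u * UniversalEnvelopingAlgebra.ι ℂ (R.eN i)) = 0) ∧
      ∀ F : coordRing ρ (nPlus Δ),
        (∀ u u' : UniversalEnvelopingAlgebra ℂ (nPlus Δ),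
          R.T i (inclU Δ u) = inclU Δ u' → pairing F u = pairing (S.vec b) u') →
        (∀ u : UniversalEnvelopingAlgebra ℂ (nPlus Δ),
          pairing F (u * UniversalEnvelopingAlgebra.ι ℂ (R.eN i)) = 0) →
        F = S.vec b' := by
  obtain ⟨b', hσ, hl, hT⟩ := S.exists_saitoReflection hρ hb
  have hE : ∀ u : UniversalEnvelopingAlgebra ℂ (nPlus Δ),
      pairing (S.vec b') (u * UniversalEnvelopingAlgebra.ι ℂ (R.eN i)) = 0 := fun u => by
    rw [pairing_mul_ι, hl, ← pairingHom_apply, map_zero, LinearMap.zero_apply]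
  have hT' : ∀ u u' : UniversalEnvelopingAlgebra ℂ (nPlus Δ),
      R.T i (inclU Δ u) = inclU Δ u' → pairing (S.vec b') u = pairing (S.vec b) u' := by
    intro u u' huu'
    -- Replacing u by its component a in U_i changes neither T_i(u) nor the pairing with b', which
    -- vanishes on U⁺ e_i.
    obtain ⟨a, ha, v, hu, hu'⟩ := R.exists_decomp_T i huu'
    obtain ⟨w, hwN, hw⟩ := exists_nilUN i ha
    have h1 : inclU Δ u = inclU Δ (w + v * UniversalEnvelopingAlgebra.ι ℂ (R.eN i)) := by
      rw [map_add, hw, hu]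
    rw [pairing_congr h1, ← pairingHom_apply, map_add, pairingHom_apply, pairingHom_apply, hE,
      add_zero]
    exact hT w u' hwN (by rw [hw, hu'])
  refine ⟨b', hσ, hT', hE, fun F hF hFE => ?_⟩
  exact eq_of_pairing_eq_of_T (fun u u' h => (hF u u' h).trans (hT' u u' h).symm) hFE hE
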